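/- Let $\varepsilon,\lambda,c>0$, $Q=(0,1)^2$, and consider, for $t\ge 0$ and $(x,y)\in Q$, $$u_t=\varepsilon(u_{xx}+u_{yy})+\lambda u,\qquad u(t,0,y)=0,\quad u(t,1,y)=U(t,y),\quad u(t,x,0)=u(t,x,1)=0 .$$ Let $N\in\mathbb N$ with $N\ge\sqrt{\frac{c+\lambda}{\pi^2\varepsilon}}$, let $\phi_1,\dots,\phi_m\in L^2(0,1)$ be shape functions with sine coefficients $\phi_{k,n}=2\int_0^1\phi_k(y)\sin(n\pi y)\,dy$, let $\Phi=(\phi_{k,n})_{1\le n\le N,\,1\le k\le m}\in\mathbb R^{N\times m}$ (row index $n$, column index $k$), and let $\Phi^\dagger$ be its Moore–Penrose pseudoinverse. Put $\lambda_0=\frac{\lambda+c}{\varepsilon}$ and $$K(x,\xi)=-\lambda_0\,\xi\,\frac{\mathrm I_1\!\big(\sqrt{\lambda_0(x^2-\xi^2)}\big)}{\sqrt{\lambda_0(x^2-\xi^2)}},\qquad 0\le\xi\le x$$ (with $K(x,x)=-\lambda_0x/2$), where $\mathrm I_1$ is the modified Bessel function of the first kind of order one. Close the loop with the feedback $$U(t,y)=\sum_{k=1}^m\phi_k(y)\,\big[\Phi^\dagger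 g(t)\big]_k,\qquad g_n(t)=\int_0^1K(1,\xi)\Big(2\int_0^1u(t,\xi,\eta)\sin(n\pi\eta)\,d\eta\Big)d\xi,\quad n=1,\dots,N .$$ By a solution of the closed loop we mean a function $u\in C([0,\infty);L^2(Q))$ with $u(t)\in H^1(Q)$ for every $t\ge0$, whose boundary values for every $t\ge 0$ are those above in the sense of traces, and which satisfies the equation weakly: for all $v\in H^1_0(Q)$ and $t\ge0$, $$\int_Q u(t)v-\int_Q u(0)v=\int_0^t\!\int_Q\big(-\varepsilon\nabla u(s)\cdot\nabla v+\lambda u(s)v\big)\,ds .$$ **Theorem (Stability with finite-dimensional control).** If $\operatorname{rank}\Phi=N$, then $u\equiv0$ is an equilibrium of the closed loop and it is exponentially stable with decay rate $c$ in the $H^1$ norm: there is a constant $M>0$ such that every solution $u$ of the closed loop satisfies $$\|u(t)\|_{H^1(Q)}\le M e^{-ct}\,\|u(0)\|_{H^1(Q)}\qquad\text{for all }t\ge0 .$$ -/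

import Mathlib

open MeasureTheory Filter Topology
open scoped ContDiff Matrix

noncomputable section

namespace SquareControl

/-! ### Moore-Penrose pseudoinverse of a real matrix -/

/-- The four Penrose equations. -/
structure IsMoorePenrose {a b : Type*} [Fintype a] [Fintype b]
    (A : Matrix a b ℝ) (P : Matrix b a ℝ) : Prop where
  mul_mul_self : A * P * A = A
  self_mul_mul : P * A * P = P
  symm_left : (A * P)ᵀ = A * P
  symm_right : (P * A)ᵀ = P * A

theorem IsMoorePenrose.unique {a b : Type*} [Fintype a] [Fintype b]
    {A : Matrix a b ℝ} {P R : Matrix b a ℝ}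
    (hP : IsMoorePenrose A P) (hR : IsMoorePenrose A R) : P = R := by
  have h1 : A * P = A * R := by
    calc A * P = (A * P)ᵀ := hP.symm_left.symm
      _ = ((A * R) * (A * P))ᵀ := by
          rw [← Matrix.mul_assoc, hR.mul_mul_self]
      _ = (A * P) * (A * R) := by
          rw [Matrix.transpose_mul, hP.symm_left, hR.symm_left]
      _ = A * R := by rw [← Matrix.mul_assoc, hP.mul_mul_self]
  have h2 : P * A = R * A := by
    calc P * A = (P * A)ᵀ := hP.symm_right.symm
      _ = ((P * A) * (R * A))ᵀ := by
          rw [Matrix.mul_assoc, ← Matrix.mul_assoc A, hR.mul_mul_self]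
      _ = (R * A) * (P * A) := by
          rw [Matrix.transpose_mul, hP.symm_right, hR.symm_right]
      _ = R * A := by rw [Matrix.mul_assoc, ← Matrix.mul_assoc A, hP.mul_mul_self]
  calc P = P * A * P := hP.self_mul_mul.symm
    _ = R * A * P := by rw [h2]
    _ = R * (A * P) := Matrix.mul_assoc _ _ _
    _ = R * (A * R) := by rw [h1]
    _ = R := by rw [← Matrix.mul_assoc, hR.self_mul_mul]

theorem exists_isMoorePenrose {a b : Type*} [Fintype a] [Fintype b]
    (A : Matrix a b ℝ) : ∃ P : Matrix b a ℝ, IsMoorePenrose A P := by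
  classical
  -- a symmetric generalised inverse of the Gram matrix
  obtain ⟨X, hX1, hX2, hXt, hXc⟩ : ∃ X : Matrix b b ℝ,
      (Aᵀ * A) * X * (Aᵀ * A) = Aᵀ * A ∧ X * (Aᵀ * A) * X = X ∧ Xᵀ = X ∧
        X * (Aᵀ * A) = (Aᵀ * A) * X := by
    have hS : (Aᵀ * A).IsHermitian := by
      simpa using Matrix.isHermitian_conjTranspose_mul_self A
    set S := Aᵀ * A with hSdef
    have hsa : IsSelfAdjoint S := hS
    have hc : ∀ f : ℝ → ℝ, ContinuousOn f (spectrum ℝ S) := fun f =>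
      (Matrix.finite_real_spectrum (A := S)).continuousOn f
    refine ⟨cfc (fun x : ℝ => x⁻¹) S, ?_, ?_, ?_, ?_⟩
    · nth_rewrite 1 [← cfc_id' ℝ S]
      nth_rewrite 3 [← cfc_id' ℝ S]
      rw [← cfc_mul _ _ S (hc _) (hc _), ← cfc_mul _ _ S (hc _) (hc _)]
      simp [cfc_id' ℝ S]
    · nth_rewrite 2 [← cfc_id' ℝ S]
      rw [← cfc_mul _ _ S (hc _) (hc _), ← cfc_mul _ _ S (hc _) (hc _)]
      congr 1
      funext x
      by_cases hx : x = 0 <;> simp [hx]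
    · have : IsSelfAdjoint (cfc (fun x : ℝ => x⁻¹) S) := cfc_predicate _ _
      simpa [IsSelfAdjoint, Matrix.star_eq_conjTranspose] using this
    · have h := cfc_commute_cfc (fun x : ℝ => x⁻¹) (fun x : ℝ => x) S
      rw [cfc_id' ℝ S] at h
      exact h
  refine ⟨X * Aᵀ, ?_, ?_, ?_, ?_⟩
  · have h0 : Aᵀ * (A * X * Aᵀ * A - A) = 0 := by
      rw [Matrix.mul_sub, sub_eq_zero]
      simpa [Matrix.mul_assoc] using hX1
    have h1 : (A * X * Aᵀ * A - A)ᵀ * (A * X * Aᵀ * A - A) = 0 := by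
      have : (A * X * Aᵀ * A - A)ᵀ = (Aᵀ * A * X - 1) * Aᵀ := by
        simp [Matrix.transpose_mul, Matrix.mul_assoc, hXt, Matrix.sub_mul]
      rw [this, Matrix.mul_assoc, h0, Matrix.mul_zero]
    have h2 : A * X * Aᵀ * A - A = 0 := by
      rw [← Matrix.conjTranspose_mul_self_eq_zero]
      simpa using h1
    rw [← Matrix.mul_assoc]
    exact sub_eq_zero.mp h2
  · calc X * Aᵀ * A * (X * Aᵀ) = (X * (Aᵀ * A) * X) * Aᵀ := by
          simp only [Matrix.mul_assoc]
      _ = X * Aᵀ := by rw [hX2]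
  · simp [Matrix.transpose_mul, Matrix.mul_assoc, hXt]
  · rw [Matrix.mul_assoc, Matrix.transpose_mul, hXt, Matrix.transpose_mul,
      Matrix.transpose_transpose, hXc]

/-- The Moore-Penrose pseudoinverse `A†`. -/
def pinv {a b : Type*} [Fintype a] [Fintype b] (A : Matrix a b ℝ) : Matrix b a ℝ :=
  (exists_isMoorePenrose A).choose

theorem pinv_spec {a b : Type*} [Fintype a] [Fintype b] (A : Matrix a b ℝ) :
    IsMoorePenrose A (pinv A) :=
  (exists_isMoorePenrose A).choose_spec

/-! ### The backstepping kernel -/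

/-- Modified Bessel function of the first kind of order one. -/
def besselI1 (z : ℝ) : ℝ :=
  ∑' k : ℕ, (z / 2) ^ (2 * k + 1) / ((k.factorial : ℝ) * ((k + 1).factorial : ℝ))

/-- The function `s ↦ I₁(s) / s`, extended by its limit `1 / 2` to `s = 0`. -/
def besselI1Quot (s : ℝ) : ℝ := if s = 0 then 1 / 2 else besselI1 s / s

/-- The solution `K(x, ξ) = -lam0 ξ I₁(s) / s`, `s = √(lam0 (x² - ξ²))`, on `0 ≤ ξ ≤ x`, of
`K_xx - K_ξξ = lam0 K`, `K(x, 0) = 0`, `K(x, x) = -lam0 x / 2`. -/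
def kernel (lam0 x ξ : ℝ) : ℝ :=
  -(lam0 * ξ) * besselI1Quot (Real.sqrt (lam0 * (x ^ 2 - ξ ^ 2)))

/-! ### The Sobolev space `H¹` of the unit square -/

/-- The open unit square. A point is `z = (x, y)`. -/
def Q : Set (ℝ × ℝ) := Set.Ioo 0 1 ×ˢ Set.Ioo 0 1

/-- Lebesgue measure on the unit square. -/
def volQ : Measure (ℝ × ℝ) := volume.restrict Q

/-- Lebesgue measure on the unit interval. -/
def volI : Measure ℝ := volume.restrict (Set.Ioo 0 1)

/-- Classical partial derivative in `x`. -/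
def dx (η : ℝ × ℝ → ℝ) (z : ℝ × ℝ) : ℝ := deriv (fun s => η (s, z.2)) z.1

/-- Classical partial derivative in `y`. -/
def dy (η : ℝ × ℝ → ℝ) (z : ℝ × ℝ) : ℝ := deriv (fun s => η (z.1, s)) z.2

/-- `f` lies in `H¹(Q)` and `p`, `q` are its weak partial derivatives in `x` and `y`. -/
structure IsWeakGrad (f p q : ℝ × ℝ → ℝ) : Prop where
  memLp : MemLp f 2 volQ
  memLp_x : MemLp p 2 volQ
  memLp_y : MemLp q 2 volQ
  weak_x : ∀ η : ℝ × ℝ → ℝ, ContDiff ℝ ∞ η → HasCompactSupport η → tsupport η ⊆ Q →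
    ∫ z, f z * dx η z ∂volQ = -∫ z, p z * η z ∂volQ
  weak_y : ∀ η : ℝ × ℝ → ℝ, ContDiff ℝ ∞ η → HasCompactSupport η → tsupport η ⊆ Q →
    ∫ z, f z * dy η z ∂volQ = -∫ z, q z * η z ∂volQ

/-- Membership in `H¹(Q)`. -/
def MemH1 (f : ℝ × ℝ → ℝ) : Prop := ∃ g : (ℝ × ℝ → ℝ) × (ℝ × ℝ → ℝ), IsWeakGrad f g.1 g.2

open Classical in
/-- The weak gradient of `f ∈ H¹(Q)` (unique almost everywhere); zero if `f ∉ H¹(Q)`. -/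
def weakGrad (f : ℝ × ℝ → ℝ) : (ℝ × ℝ → ℝ) × (ℝ × ℝ → ℝ) :=
  if h : MemH1 f then h.choose else 0

/-- The weak derivative in `x` of `f ∈ H¹(Q)`. -/
def wdx (f : ℝ × ℝ → ℝ) : ℝ × ℝ → ℝ := (weakGrad f).1

/-- The weak derivative in `y` of `f ∈ H¹(Q)`. -/
def wdy (f : ℝ × ℝ → ℝ) : ℝ × ℝ → ℝ := (weakGrad f).2

/-- The norm of `f ∈ H¹(Q)`. -/
def h1Norm (f : ℝ × ℝ → ℝ) : ℝ :=
  Real.sqrt (∫ z, (f z ^ 2 + wdx f z ^ 2 + wdy f z ^ 2) ∂volQ)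

/-- `f ∈ H¹(Q)` has the boundary values (traces) `gL` on `x = 0`, `gR` on `x = 1`, `gB` on
`y = 0`, `gT` on `y = 1`. The traces are characterised by the Gauss-Green formula against
functions that are smooth up to the boundary; it determines each of them almost everywhere. -/
structure HasTrace (f : ℝ × ℝ → ℝ) (gL gR gB gT : ℝ → ℝ) : Prop where
  memH1 : MemH1 f
  memLp_left : MemLp gL 2 volI
  memLp_right : MemLp gR 2 volI
  memLp_bottom : MemLp gB 2 volI
  memLp_top : MemLp gT 2 volI
  green_x : ∀ η : ℝ × ℝ → ℝ, ContDiff ℝ ∞ η →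
    ∫ z, (f z * dx η z + wdx f z * η z) ∂volQ
      = (∫ y, gR y * η (1, y) ∂volI) - ∫ y, gL y * η (0, y) ∂volI
  green_y : ∀ η : ℝ × ℝ → ℝ, ContDiff ℝ ∞ η →
    ∫ z, (f z * dy η z + wdy f z * η z) ∂volQ
      = (∫ x, gT x * η (x, 1) ∂volI) - ∫ x, gB x * η (x, 0) ∂volI

/-- Membership in `H¹₀(Q)`. -/
def MemH10 (f : ℝ × ℝ → ℝ) : Prop := HasTrace f 0 0 0 0

/-! ### The reaction-diffusion equation -/

/-- `u` is a weak solution with values in `H¹(Q)`, for `t ≥ 0`, of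
`u_t = ε (u_xx + u_yy) + lam u` with `u(t, 0, y) = 0`, `u(t, 1, y) = U t y`,
`u(t, x, 0) = u(t, x, 1) = 0`: it is continuous in time with values in `L²(Q)`, takes its
boundary values in the sense of traces, and satisfies
`d/dt ∫ u v = ∫ (-ε ∇u · ∇v + lam u v)`, integrated in time, for every `v ∈ H¹₀(Q)`. -/
structure IsSolution (ε lam : ℝ) (U : ℝ → ℝ → ℝ) (u : ℝ → ℝ × ℝ → ℝ) : Prop where
  memH1 : ∀ t, 0 ≤ t → MemH1 (u t)
  continuous_L2 : ∀ t, 0 ≤ t →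
    Tendsto (fun s => eLpNorm (u s - u t) 2 volQ) (𝓝[Set.Ici 0] t) (𝓝 0)
  boundary : ∀ t, 0 ≤ t → HasTrace (u t) 0 (U t) 0 0
  weak_eq : ∀ v : ℝ × ℝ → ℝ, MemH10 v → ∀ t, 0 ≤ t →
    IntervalIntegrable (fun s => ∫ z, (-ε * (wdx (u s) z * wdx v z + wdy (u s) z * wdy v z)
      + lam * (u s z * v z)) ∂volQ) volume 0 t ∧
    (∫ z, u t z * v z ∂volQ) - (∫ z, u 0 z * v z ∂volQ)
      = ∫ s in (0 : ℝ)..t, ∫ z, (-ε * (wdx (u s) z * wdx v z + wdy (u s) z * wdy v z)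
          + lam * (u s z * v z)) ∂volQ

/-! ### The finite-dimensional feedback law -/

/-- The `n`-th sine coefficient of a function on `[0, 1]`: `2 ∫₀¹ h(y) sin(n π y) dy`. -/
def sineCoeff (n : ℕ) (h : ℝ → ℝ) : ℝ :=
  2 * ∫ y in (0 : ℝ)..1, h y * Real.sin (n * Real.pi * y)

/-- The matrix `Φ`, whose `(n, k)` entry is the `n`-th sine coefficient of the `k`-th shape
function, `n = 1, …, N` (row `i : Fin N` is the mode `n = i + 1`). -/
def shapeMatrix (N : ℕ) {m : ℕ} (φ : Fin m → ℝ → ℝ) : Matrix (Fin N) (Fin m) ℝ :=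
  Matrix.of fun i k => sineCoeff (i + 1) (φ k)

/-- `∫₀¹ K(1, ξ) fₙ(ξ) dξ`, where `fₙ(ξ)` is the `n`-th sine coefficient of `f(ξ, ·)` and `K` is
the kernel with `lam0 = (lam + c) / ε`. -/
def modalFeedback (ε lam c : ℝ) (n : ℕ) (f : ℝ × ℝ → ℝ) : ℝ :=
  ∫ ξ in (0 : ℝ)..1, kernel ((lam + c) / ε) 1 ξ * sineCoeff n (fun y => f (ξ, y))

/-- The control as a function of `y`, when the state is `f`. -/
def feedback (ε lam c : ℝ) (N : ℕ) {m : ℕ} (φ : Fin m → ℝ → ℝ) (f : ℝ × ℝ → ℝ) (y : ℝ) : ℝ :=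
  ∑ k : Fin m, φ k y *
    (pinv (shapeMatrix N φ) *ᵥ fun i : Fin N => modalFeedback ε lam c (i + 1) f) k

/-- Solutions of the closed-loop system. -/
def IsClosedLoopSolution (ε lam c : ℝ) (N : ℕ) {m : ℕ} (φ : Fin m → ℝ → ℝ)
    (u : ℝ → ℝ × ℝ → ℝ) : Prop :=
  IsSolution ε lam (fun t => feedback ε lam c N φ (u t)) u

end SquareControl

end

noncomputable section

namespace SquareControl

/-! ### Fourier series on the unit interval -/

/-! Pairing `u` with `sin (n π y)` splits the system into one-dimensional problems on `(0, 1)`: the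
mode `f_n` satisfies `∂ₜ f = ε f'' + (λ - ε (n π)²) f`, vanishes at `0` and takes the value `U_n`,
the pairing of the control with `sin (n π y)`, at `1`. The modes interact only through the control.
By Parseval (`HasTrace.hasSum_modeEnergy`) the squared `H¹` norm is the sum of twice the mode
energies. All evolution equations come from testing the weak equation with smooth products `p(x) sin
(n π y)` (`IsSolution.integral_pair_eq`), so no regularity beyond `H¹` is needed.

Modes `n ≤ N`. Full row rank gives `Φ Φ† = 1` (`mul_pinv_of_rank`), hence `U_n = ∫ K(1, ξ) f_n(ξ)
dξ`, exactly the backstepping boundary value. Instead of transforming the equation, the proof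
applies the adjoint transformation to the sine functions. The resulting `dualMode`s solve a
second-order equation whose inhomogeneity `i π (-1)^i K(1, ·)` cancels the boundary contribution of
the control, so the coefficients of `f_n` against them are pure exponentials with rates `ε ((i π)² +
(n π)²) + c`. The Volterra transformation is bounded with bounded inverse, so a weighted `ℓ²` norm
of these coefficients is equivalent to the `H¹` norm (`exists_backstep_equiv`). Hence these modes
decay at rate `c`, and the control is Hölder continuous of order `1/2` in time, with an
exponentially decaying constant (`exists_low_mode_bound`).

Modes `n > N`. The bound on `N` makes their free decay faster than `c`, with a uniform gap
(`exists_spectral_gap`), but they are driven through the boundary. The input is only Hölder in time,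
so each Fourier coefficient is compared with its quasi-stationary value (`abs_quasistationary_le`).
Summing over the frequencies in `x` bounds the energy of mode `n` by `n U_n(t)²` plus exponentially
decaying terms (`exists_high_mode_bound`).

It remains to sum `n U_n(t)²` over `n`. For shape functions that are merely `L²` this sum need not
converge for arbitrary control coefficients. It does converge along a solution, because `u(t) ∈ H¹`
and each mode obeys the trace inequality `mul_sq_trace_le`. The coefficient vectors with a
convergent sum form a subspace of `ℝᵐ`, on which the sum is a quadratic form and therefore bounded
(`exists_tsum_sq_dotProduct_le`). So the sum inherits the decay of the squared control coefficients.
-/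

/-- The sine mode `x ↦ sin (n π x)`. -/
def sn (n : ℕ) (x : ℝ) : ℝ := Real.sin (n * Real.pi * x)

/-- The cosine mode `x ↦ cos (n π x)`. -/
def cs (n : ℕ) (x : ℝ) : ℝ := Real.cos (n * Real.pi * x)

theorem contDiff_sn (n : ℕ) : ContDiff ℝ ∞ (sn n) := by
  unfold sn; fun_prop

theorem contDiff_cs (n : ℕ) : ContDiff ℝ ∞ (cs n) := by
  unfold cs; fun_prop

theorem continuous_sn (n : ℕ) : Continuous (sn n) := (contDiff_sn n).continuous

theorem continuous_cs (n : ℕ) : Continuous (cs n) := (contDiff_cs n).continuous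

theorem hasDerivAt_sn (n : ℕ) (x : ℝ) : HasDerivAt (sn n) (n * Real.pi * cs n x) x := by
  unfold sn cs
  have := ((hasDerivAt_id x).const_mul (n * Real.pi)).sin
  simpa [mul_comm] using this

theorem hasDerivAt_cs (n : ℕ) (x : ℝ) : HasDerivAt (cs n) (-(n * Real.pi * sn n x)) x := by
  unfold sn cs
  have := ((hasDerivAt_id x).const_mul (n * Real.pi)).cos
  simpa [mul_comm] using this

@[simp] theorem sn_at_zero (n : ℕ) : sn n 0 = 0 := by simp [sn]

@[simp] theorem sn_at_one (n : ℕ) : sn n 1 = 0 := by simp [sn, Real.sin_nat_mul_pi]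

@[simp] theorem cs_at_one (n : ℕ) : cs n 1 = (-1) ^ n := by simp [cs, Real.cos_nat_mul_pi]

@[simp] theorem sn_zero (x : ℝ) : sn 0 x = 0 := by simp [sn]

@[simp] theorem cs_zero (x : ℝ) : cs 0 x = 1 := by simp [cs]

instance : IsProbabilityMeasure volI := ⟨by simp [volI]⟩

theorem integral_volI (f : ℝ → ℝ) : ∫ x, f x ∂volI = ∫ x in (0 : ℝ)..1, f x := by
  rw [intervalIntegral.integral_of_le zero_le_one, volI, integral_Ioc_eq_integral_Ioo]

theorem ae_mem_volI : ∀ᵐ x ∂volI, x ∈ Set.Ioo (0 : ℝ) 1 :=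
  ae_restrict_mem measurableSet_Ioo

/-- Parseval on the circle of length `2` for the extension `h(x) + s h(-x)` of `f` to `(-1, 1)`, odd
for `s = -1` and even for `s = 1`. The two halves have disjoint supports, so the norms add. Both
half-range Parseval identities are instances. -/
theorem hasSum_sq_fourier_symm {f : ℝ → ℝ} (hf : MemLp f 2 volI) (s : ℝ) (hs : s ^ 2 = 1)
    (n : ℤ → ℝ) (hn : ∀ k : ℤ, (n k) ^ 2 = ‖(1 / 2 : ℂ) * ∫ x, (f x : ℂ) *
      (Complex.exp (-(Real.pi * Complex.I * k * x)) +
        s * Complex.exp (Real.pi * Complex.I * k * x)) ∂volI‖ ^ 2) :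
    HasSum (fun k => (n k) ^ 2) (∫ x, f x ^ 2 ∂volI) := by
  set h : ℝ → ℝ := (Set.Ioo (0 : ℝ) 1).indicator f with hh
  have hL : MemLp h 2 volume := (memLp_indicator_iff_restrict measurableSet_Ioo).2 hf
  have hLn : MemLp (fun x => h (-x)) 2 volume :=
    hL.comp_measurePreserving (Measure.measurePreserving_neg volume)
  set F : ℝ → ℂ := fun x => ((h x + s * h (-x) : ℝ) : ℂ) with hF
  have hFL : MemLp F 2 volume := (hL.add (hLn.const_mul s)).ofReal
  have hab : (-1 : ℝ) < 1 := by norm_num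
  have hz : ∀ x : ℝ, x ∉ Set.Ioc (-1 : ℝ) 1 → h x = 0 ∧ h (-x) = 0 := by
    intro x hx
    simp only [hh, Set.indicator_apply, Set.mem_Ioo, Set.mem_Ioc, not_and_or, not_lt, not_le]
      at hx ⊢
    constructor <;> rw [if_neg] <;> rintro ⟨h1, h2⟩ <;> rcases hx with hx | hx <;> linarith
  have hsup : ∀ (g : ℝ → ℂ), (∀ x, h x = 0 → h (-x) = 0 → g x = 0) →
      ∫ x in (-1 : ℝ)..1, g x = ∫ x, g x := by
    intro g hg
    rw [intervalIntegral.integral_of_le hab.le]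
    exact setIntegral_eq_integral_of_forall_compl_eq_zero fun x hx =>
      hg x (hz x hx).1 (hz x hx).2
  have hres : ∀ g : ℝ → ℂ, ∫ x, (h x : ℂ) * g x = ∫ x, (f x : ℂ) * g x ∂volI := by
    intro g
    rw [volI, ← integral_indicator measurableSet_Ioo]
    congr 1; ext x
    by_cases hx : x ∈ Set.Ioo (0 : ℝ) 1 <;> simp [hh, hx]
  have hint : ∀ c : ℂ, c.re = 0 → Integrable (fun x : ℝ => (h x : ℂ) * Complex.exp (c * x)) := by
    intro c hc
    have h1 : Integrable h := by
      rw [hh, integrable_indicator_iff measurableSet_Ioo]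
      exact hf.integrable one_le_two
    refine h1.ofReal.mul_bdd (c := 1) ?_ ?_
    · exact (by fun_prop : Continuous fun x : ℝ => Complex.exp (c * x)).aestronglyMeasurable
    · filter_upwards with x
      simp [Complex.norm_exp, hc]
  have hcoef : ∀ k : ℤ, ‖fourierCoeffOn hab F k‖ ^ 2 = (n k) ^ 2 := by
    intro k
    rw [hn k, fourierCoeffOn_eq_integral]
    have e1 : ∀ x : ℝ, (fourier (-k) (x : AddCircle (1 - (-1 : ℝ)))) • F x
        = (h x : ℂ) * Complex.exp ((-(Real.pi * Complex.I * k)) * x)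
          + s * ((h (-x) : ℂ) * Complex.exp ((Real.pi * Complex.I * k) * ((-x : ℝ) : ℂ))) := by
      intro x
      rw [fourier_coe_apply]
      have : 2 * (Real.pi : ℂ) * Complex.I * ((-k : ℤ) : ℂ) * x / ((1 - (-1 : ℝ) : ℝ) : ℂ)
          = (-(Real.pi * Complex.I * k)) * x := by
        push_cast; ring
      rw [this]
      simp only [hF, smul_eq_mul]
      push_cast
      ring_nf
    rw [hsup]
    · simp_rw [e1]
      have i1 := hint (-(Real.pi * Complex.I * k)) (by simp)
      have i2 := hint (Real.pi * Complex.I * k) (by simp)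
      rw [integral_add i1 ((i2.comp_neg).const_mul _), integral_const_mul,
        integral_neg_eq_self (fun x : ℝ => (h x : ℂ) * Complex.exp (Real.pi * Complex.I * k * x))
          volume, ← integral_const_mul, ← integral_add i1 (i2.const_mul _)]
      have e2 : ∀ x : ℝ, (h x : ℂ) * Complex.exp (-(Real.pi * Complex.I * k) * x)
          + s * ((h x : ℂ) * Complex.exp (Real.pi * Complex.I * k * x))
          = (h x : ℂ) * (Complex.exp (-(Real.pi * Complex.I * k * x)) +
            s * Complex.exp (Real.pi * Complex.I * k * x)) := by
        intro x; ring_nf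
      simp_rw [e2]
      rw [hres]
      norm_num
    · intro x h1 h2
      simp [hF, h1, h2]
  have key := hasSum_sq_fourierCoeffOn hab (hFL.mono_measure Measure.restrict_le_self)
  simp_rw [hcoef] at key
  convert key using 1
  have hprod : ∀ x, h x * h (-x) = 0 := by
    intro x
    simp only [hh, Set.indicator_apply, Set.mem_Ioo]
    split_ifs with h1 h2 <;> first | (exfalso; linarith [h1.1, h2.1]) | simp
  have e3 : ∀ x, ‖F x‖ ^ 2 = h x ^ 2 + h (-x) ^ 2 := by
    intro x
    simp only [hF, Complex.norm_real, Real.norm_eq_abs, sq_abs]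
    linear_combination 2 * s * hprod x + h (-x) ^ 2 * hs
  have e4 : ∫ x in (-1 : ℝ)..1, ‖F x‖ ^ 2 = ∫ x, ‖F x‖ ^ 2 := by
    rw [intervalIntegral.integral_of_le hab.le]
    exact setIntegral_eq_integral_of_forall_compl_eq_zero fun x hx => by
      simp [e3, (hz x hx).1, (hz x hx).2]
  rw [e4]
  simp_rw [e3]
  rw [integral_add hL.integrable_sq hLn.integrable_sq,
    integral_neg_eq_self (fun x : ℝ => h x ^ 2) volume]
  have e5 : ∫ x, h x ^ 2 = ∫ x, f x ^ 2 ∂volI := by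
    rw [volI, ← integral_indicator measurableSet_Ioo]
    congr 1; ext x
    by_cases hx : x ∈ Set.Ioo (0 : ℝ) 1 <;> simp [hh, hx]
  rw [e5]
  norm_num
  ring

/-- Parseval's identity for sine series on `(0, 1)`. -/
theorem hasSum_sq_sn {f : ℝ → ℝ} (hf : MemLp f 2 volI) :
    HasSum (fun n : ℕ => 2 * (∫ x, f x * sn n x ∂volI) ^ 2) (∫ x, f x ^ 2 ∂volI) := by
  have h := hasSum_sq_fourier_symm hf (-1) (by norm_num)
    (fun k => ∫ x, f x * Real.sin (k * Real.pi * x) ∂volI) ?_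
  · have h2 := h.nat_add_neg
    convert h2 using 1
    · ext n
      simp [sn, integral_neg]
      ring
    · simp
  · intro k
    have : ∀ x : ℝ, (f x : ℂ) * (Complex.exp (-(Real.pi * Complex.I * k * x)) +
        ((-1 : ℝ) : ℂ) * Complex.exp (Real.pi * Complex.I * k * x))
        = (-2 * Complex.I) * ((f x * Real.sin (k * Real.pi * x) : ℝ) : ℂ) := by
      intro x
      push_cast
      rw [Complex.sin]
      ring_nf
      simp
      ring
    simp_rw [this]
    rw [integral_const_mul, integral_complex_ofReal]
    simp

/-- Parseval's identity for cosine series on `(0, 1)`. -/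
theorem hasSum_sq_cs {f : ℝ → ℝ} (hf : MemLp f 2 volI) :
    HasSum (fun n : ℕ => 2 * (∫ x, f x * cs n x ∂volI) ^ 2)
      (∫ x, f x ^ 2 ∂volI + (∫ x, f x ∂volI) ^ 2) := by
  have h := hasSum_sq_fourier_symm hf 1 (by norm_num)
    (fun k => ∫ x, f x * Real.cos (k * Real.pi * x) ∂volI) ?_
  -- Folding the integers onto `ℕ` counts the index `0` twice, which is the source of the extra `(∫
  -- f)²`.
  · have h2 := h.nat_add_neg
    convert h2 using 1
    · ext n
      simp [cs]
      ring
    · simp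
  · intro k
    have : ∀ x : ℝ, (f x : ℂ) * (Complex.exp (-(Real.pi * Complex.I * k * x)) +
        ((1 : ℝ) : ℂ) * Complex.exp (Real.pi * Complex.I * k * x))
        = 2 * ((f x * Real.cos (k * Real.pi * x) : ℝ) : ℂ) := by
      intro x
      push_cast
      rw [Complex.cos]
      ring_nf
    simp_rw [this]
    rw [integral_const_mul, integral_complex_ofReal]
    simp

/-! ### The backstepping kernel as an entire function -/

/-- The entire function `z ↦ ∑ zᵏ / (4ᵏ k! (k + a)!)`. -/
def besselSeries (a : ℕ) (z : ℝ) : ℝ :=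
  ∑' k : ℕ, z ^ k / (4 ^ k * (k.factorial : ℝ) * ((k + a).factorial : ℝ))

theorem besselSeries_summable (a : ℕ) (z : ℝ) :
    Summable fun k : ℕ => z ^ k / (4 ^ k * (k.factorial : ℝ) * ((k + a).factorial : ℝ)) := by
  refine Summable.of_norm_bounded (Real.summable_pow_div_factorial |z|) fun k => ?_
  rw [Real.norm_eq_abs, abs_div, abs_pow, abs_of_pos (by positivity :
    (0 : ℝ) < 4 ^ k * (k.factorial : ℝ) * ((k + a).factorial : ℝ))]
  have h1 : (1 : ℝ) ≤ 4 ^ k := one_le_pow₀ (by norm_num)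
  have h2 : (1 : ℝ) ≤ ((k + a).factorial : ℝ) := by exact_mod_cast Nat.factorial_pos _
  have h3 : (0 : ℝ) < (k.factorial : ℝ) := by positivity
  gcongr
  nlinarith [mul_le_mul h1 h2 zero_le_one (by positivity)]

/-- Termwise differentiation only raises the index `a`. The family is therefore closed under
differentiation, which yields smoothness and all derivatives of the kernel. -/
theorem hasDerivAt_besselSeries (a : ℕ) (z : ℝ) :
    HasDerivAt (besselSeries a) (besselSeries (a + 1) z / 4) z := by
  set R : ℝ := |z| + 1 with hR
  have hR0 : 0 ≤ R := by positivity
  set g' : ℕ → ℝ → ℝ := fun k y =>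
    (k * y ^ (k - 1)) / (4 ^ k * (k.factorial : ℝ) * ((k + a).factorial : ℝ)) with hg'
  have hu : Summable fun k : ℕ => (k : ℝ) * R ^ (k - 1) / (k.factorial : ℝ) := by
    rw [← summable_nat_add_iff 1]
    refine (Real.summable_pow_div_factorial R).congr fun k => ?_
    rw [Nat.factorial_succ]
    push_cast
    field_simp
  have key := hasDerivAt_tsum_of_isPreconnected (t := Metric.ball (0 : ℝ) R) (y := z) (y₀ := 0)
    (g := fun k y => y ^ k / (4 ^ k * (k.factorial : ℝ) * ((k + a).factorial : ℝ)))
    (g' := g') hu Metric.isOpen_ball (convex_ball _ _).isPreconnected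
    (fun k y _ => (hasDerivAt_pow k y).div_const _) ?_ ?_ (besselSeries_summable a 0) ?_
  · have e : ∑' k, g' k z = besselSeries (a + 1) z / 4 := by
      have hs : Summable fun k => g' k z := by
        rw [← summable_nat_add_iff 1]
        refine ((besselSeries_summable (a + 1) z).div_const 4).congr fun k => ?_
        simp only [hg']
        rw [Nat.factorial_succ k, Nat.add_sub_cancel, show k + 1 + a = k + (a + 1) by ring]
        push_cast
        field_simp
        ring
      rw [hs.tsum_eq_zero_add, besselSeries, ← tsum_div_const]
      simp only [hg']
      simp only [Nat.cast_zero, zero_mul, zero_div, zero_add]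
      congr 1; ext k
      rw [Nat.factorial_succ k, Nat.add_sub_cancel, show k + 1 + a = k + (a + 1) by ring]
      push_cast
      field_simp
      ring
    rw [e] at key
    exact key
  · intro k y hy
    have hy' : |y| ≤ R := by simpa using (mem_ball_zero_iff.1 hy).le
    simp only [hg']
    rw [Real.norm_eq_abs, abs_div, abs_mul, abs_pow, Nat.abs_cast, abs_of_pos (by positivity :
      (0 : ℝ) < 4 ^ k * (k.factorial : ℝ) * ((k + a).factorial : ℝ))]
    have h1 : (1 : ℝ) ≤ 4 ^ k := one_le_pow₀ (by norm_num)
    have h2 : (1 : ℝ) ≤ ((k + a).factorial : ℝ) := by exact_mod_cast Nat.factorial_pos _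
    have h3 : (0 : ℝ) < (k.factorial : ℝ) := by positivity
    gcongr
    nlinarith [mul_le_mul h1 h2 zero_le_one (by positivity)]
  · simp [hR]; positivity
  · simp [hR]

theorem contDiff_besselSeries (a : ℕ) : ContDiff ℝ ∞ (besselSeries a) := by
  rw [contDiff_infty]
  intro n
  induction n generalizing a with
  | zero =>
    exact contDiff_zero.2 (continuous_iff_continuousAt.2 fun z =>
      (hasDerivAt_besselSeries a z).continuousAt)
  | succ n ih =>
    push_cast
    rw [contDiff_succ_iff_deriv]
    refine ⟨fun z => (hasDerivAt_besselSeries a z).differentiableAt, by simp, ?_⟩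
    have : deriv (besselSeries a) = fun z => besselSeries (a + 1) z / 4 :=
      funext fun z => (hasDerivAt_besselSeries a z).deriv
    rw [this]
    exact (ih (a + 1)).div_const 4

theorem continuous_besselSeries (a : ℕ) : Continuous (besselSeries a) :=
  (contDiff_besselSeries a).continuous

theorem besselSeries_at_zero (a : ℕ) : besselSeries a 0 = 1 / (a.factorial : ℝ) := by
  rw [besselSeries, tsum_eq_single 0]
  · simp
  · intro k hk; simp [hk]

/-- Comparison of coefficients: `k + 2` cancels against `(k + 2)!`. This Bessel recurrence is what
makes the kernel satisfy its wave equation. -/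
theorem besselSeries_recurrence (z : ℝ) :
    z * besselSeries 3 z / 4 + 2 * besselSeries 2 z = besselSeries 1 z := by
  have h3 := (besselSeries_summable 3 z).hasSum.mul_left (z / 4)
  have h3' : HasSum (fun k : ℕ => (k : ℝ) * z ^ k /
      (4 ^ k * (k.factorial : ℝ) * ((k + 2).factorial : ℝ))) (z / 4 * besselSeries 3 z) := by
    rw [← hasSum_nat_add_iff' 1]
    simp only [Finset.range_one, Finset.sum_singleton, Nat.cast_zero, zero_mul, zero_div, sub_zero]
    convert! h3 using 1
    ext k
    rw [Nat.factorial_succ k, show k + 1 + 2 = k + 3 by ring]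
    push_cast
    field_simp
    ring
  have h2 := (besselSeries_summable 2 z).hasSum.mul_left 2
  have h1 := h3'.add h2
  have h := h1.unique (((besselSeries_summable 1 z).hasSum).congr_fun ?_)
  · simp only [besselSeries] at h ⊢
    rw [← h]; ring
  · intro k
    rw [show k + 2 = (k + 1) + 1 by ring, Nat.factorial_succ (k + 1)]
    push_cast
    field_simp
    ring

/-- `I₁` has only odd powers, so `I₁(s) / s` is a power series in `s²` and the square root
disappears; the value prescribed at `s = 0` is its constant term. -/
theorem besselI1Quot_sqrt {z : ℝ} (hz : 0 ≤ z) :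
    besselI1Quot (Real.sqrt z) = besselSeries 1 z / 2 := by
  unfold besselI1Quot
  split_ifs with h
  · rw [(Real.sqrt_eq_zero hz).1 h, besselSeries_at_zero]; norm_num
  · rw [besselI1, besselSeries, ← tsum_div_const, ← tsum_div_const]
    congr 1; ext k
    have h4 : (Real.sqrt z / 2) ^ (2 * k + 1) = z ^ k / 4 ^ k * (Real.sqrt z / 2) := by
      rw [pow_succ, pow_mul, div_pow, Real.sq_sqrt hz, div_pow]; norm_num
    rw [h4]
    field_simp

/-- The smooth extension of the backstepping kernel to all of `ℝ²`. -/
def smoothKernel (l x ξ : ℝ) : ℝ := -(l * ξ) * (besselSeries 1 (l * (x ^ 2 - ξ ^ 2)) / 2)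

theorem kernel_eq_smoothKernel {l x ξ : ℝ} (hl : 0 ≤ l) (hξ : 0 ≤ ξ) (hx : ξ ≤ x) :
    kernel l x ξ = smoothKernel l x ξ := by
  rw [kernel, smoothKernel, besselI1Quot_sqrt]
  have : 0 ≤ x ^ 2 - ξ ^ 2 := by nlinarith
  positivity

/-- The derivative of the kernel in its first variable. -/
def smoothKernelX (l x ξ : ℝ) : ℝ :=
  -(l ^ 2 * x * ξ / 4) * besselSeries 2 (l * (x ^ 2 - ξ ^ 2))

/-- The derivative of the kernel in its second variable. -/
def smoothKernelY (l x ξ : ℝ) : ℝ :=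
  -(l / 2) * besselSeries 1 (l * (x ^ 2 - ξ ^ 2))
    + l ^ 2 * ξ ^ 2 / 4 * besselSeries 2 (l * (x ^ 2 - ξ ^ 2))

/-- The second derivative of the kernel in its first variable. -/
def smoothKernelXX (l x ξ : ℝ) : ℝ :=
  -(l ^ 2 * ξ / 4) * besselSeries 2 (l * (x ^ 2 - ξ ^ 2))
    - l ^ 3 * x ^ 2 * ξ / 8 * besselSeries 3 (l * (x ^ 2 - ξ ^ 2))

theorem contDiff_smoothKernel (l : ℝ) : ContDiff ℝ ∞ (Function.uncurry (smoothKernel l)) := by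
  have h := contDiff_besselSeries 1
  simp only [Function.uncurry_def, smoothKernel]
  fun_prop

theorem continuous_smoothKernel (l : ℝ) : Continuous (Function.uncurry (smoothKernel l)) :=
  (contDiff_smoothKernel l).continuous

theorem continuous_smoothKernelX (l : ℝ) : Continuous (Function.uncurry (smoothKernelX l)) := by
  have h := continuous_besselSeries 2
  simp only [Function.uncurry_def, smoothKernelX]
  fun_prop

theorem continuous_smoothKernelY (l : ℝ) : Continuous (Function.uncurry (smoothKernelY l)) := by
  have h := continuous_besselSeries 1
  have h' := continuous_besselSeries 2
  simp only [Function.uncurry_def, smoothKernelY]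
  fun_prop

theorem continuous_smoothKernelXX (l : ℝ) : Continuous (Function.uncurry (smoothKernelXX l)) := by
  have h := continuous_besselSeries 2
  have h' := continuous_besselSeries 3
  simp only [Function.uncurry_def, smoothKernelXX]
  fun_prop

theorem hasDerivAt_besselSeries_x (a : ℕ) (l x ξ : ℝ) :
    HasDerivAt (fun x => besselSeries a (l * (x ^ 2 - ξ ^ 2)))
      (besselSeries (a + 1) (l * (x ^ 2 - ξ ^ 2)) / 4 * (l * (2 * x))) x := by
  have h : HasDerivAt (fun x : ℝ => l * (x ^ 2 - ξ ^ 2)) (l * (2 * x)) x := by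
    simpa using ((hasDerivAt_pow 2 x).sub_const (ξ ^ 2)).const_mul l
  exact (hasDerivAt_besselSeries a _).comp x h

theorem hasDerivAt_besselSeries_y (a : ℕ) (l x ξ : ℝ) :
    HasDerivAt (fun ξ => besselSeries a (l * (x ^ 2 - ξ ^ 2)))
      (besselSeries (a + 1) (l * (x ^ 2 - ξ ^ 2)) / 4 * (l * (-(2 * ξ)))) ξ := by
  have h : HasDerivAt (fun ξ : ℝ => l * (x ^ 2 - ξ ^ 2)) (l * (-(2 * ξ))) ξ := by
    simpa using ((hasDerivAt_pow 2 ξ).const_sub (x ^ 2)).const_mul l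
  exact (hasDerivAt_besselSeries a _).comp ξ h

theorem hasDerivAt_smoothKernel_x (l x ξ : ℝ) :
    HasDerivAt (fun x => smoothKernel l x ξ) (smoothKernelX l x ξ) x := by
  have h := ((hasDerivAt_besselSeries_x 1 l x ξ).div_const 2).const_mul (-(l * ξ))
  convert! h using 1
  rw [smoothKernelX]; ring

theorem hasDerivAt_smoothKernelX_x (l x ξ : ℝ) :
    HasDerivAt (fun x => smoothKernelX l x ξ) (smoothKernelXX l x ξ) x := by
  have h0 : HasDerivAt (fun x : ℝ => -(l ^ 2 * x * ξ / 4)) (-(l ^ 2 * 1 * ξ / 4)) x :=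
    ((((hasDerivAt_id x).const_mul (l ^ 2)).mul_const ξ).div_const 4).neg
  have h := h0.mul (hasDerivAt_besselSeries_x 2 l x ξ)
  convert! h using 1
  rw [smoothKernelXX]; ring

theorem hasDerivAt_smoothKernel_y (l x ξ : ℝ) :
    HasDerivAt (fun ξ => smoothKernel l x ξ) (smoothKernelY l x ξ) ξ := by
  have h0 : HasDerivAt (fun ξ : ℝ => -(l * ξ)) (-(l * 1)) ξ :=
    ((hasDerivAt_id ξ).const_mul l).neg
  have h := h0.mul ((hasDerivAt_besselSeries_y 1 l x ξ).div_const 2)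
  convert! h using 1
  rw [smoothKernelY]; ring

/-- The kernel equation `K_xx - K_ξξ = l K`, solved for `K_ξξ`. -/
theorem hasDerivAt_smoothKernelY_y (l x ξ : ℝ) :
    HasDerivAt (fun ξ => smoothKernelY l x ξ)
      (smoothKernelXX l x ξ - l * smoothKernel l x ξ) ξ := by
  have h0 : HasDerivAt (fun ξ : ℝ => l ^ 2 * ξ ^ 2 / 4) (l ^ 2 * (2 * ξ) / 4) ξ := by
    simpa using ((hasDerivAt_pow 2 ξ).const_mul (l ^ 2)).div_const 4
  have h := ((hasDerivAt_besselSeries_y 1 l x ξ).const_mul (-(l / 2))).add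
    (h0.mul (hasDerivAt_besselSeries_y 2 l x ξ))
  convert! h using 1
  have hr := besselSeries_recurrence (l * (x ^ 2 - ξ ^ 2))
  rw [smoothKernelXX, smoothKernel]
  linear_combination (-(l ^ 2 * ξ / 2)) * hr

theorem smoothKernel_diag (l x : ℝ) : smoothKernel l x x = -(l * x / 2) := by
  simp [smoothKernel, besselSeries_at_zero]; ring

/-- The Leibniz rule for `ξ ↦ ∫_ξ^1 h ξ x dx`. -/
theorem hasDerivAt_integral_lower {h h' : ℝ → ℝ → ℝ} (hc : Continuous (Function.uncurry h))
    (hc' : Continuous (Function.uncurry h'))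
    (hd : ∀ ξ x, HasDerivAt (fun ξ => h ξ x) (h' ξ x) ξ) (ξ : ℝ) :
    HasDerivAt (fun ξ => ∫ x in ξ..1, h ξ x) (-h ξ ξ + ∫ x in ξ..1, h' ξ x) ξ := by
  have c1 : ∀ {k : ℝ → ℝ → ℝ}, Continuous (Function.uncurry k) → ∀ ξ, Continuous (k ξ) :=
    fun hk ξ => hk.comp (Continuous.prodMk_right ξ)
  have d1 : ∀ a ξ : ℝ, HasDerivAt (fun a => ∫ x in a..1, h ξ x) (-h ξ a) a := fun a ξ =>
    intervalIntegral.integral_hasDerivAt_left ((c1 hc ξ).intervalIntegrable _ _)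
      (c1 hc ξ).stronglyMeasurable.stronglyMeasurableAtFilter (c1 hc ξ).continuousAt
  have d2 : ∀ a ξ : ℝ, HasDerivAt (fun ξ => ∫ x in a..1, h ξ x) (∫ x in a..1, h' ξ x) ξ := by
    intro a ξ
    obtain ⟨C, hC⟩ := ((isCompact_closedBall ξ 1).prod (isCompact_uIcc (a := a) (b := 1))).exists_bound_of_continuousOn
      hc'.continuousOn
    refine (intervalIntegral.hasDerivAt_integral_of_dominated_loc_of_deriv_le
      (bound := fun _ => C) (Metric.closedBall_mem_nhds ξ one_pos)
      (Eventually.of_forall fun y => (c1 hc y).aestronglyMeasurable)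
      ((c1 hc ξ).intervalIntegrable _ _) (c1 hc' ξ).aestronglyMeasurable ?_
      intervalIntegrable_const ?_).2
    · exact Eventually.of_forall fun t ht y hy => hC (y, t) ⟨hy, Set.uIoc_subset_uIcc ht⟩
    · exact Eventually.of_forall fun t _ y _ => hd y t
  have cI : Continuous fun p : ℝ × ℝ => ∫ x in p.1..1, h' p.2 x := by
    have := (intervalIntegral.continuous_parametric_primitive_of_continuous (μ := volume)
      (a₀ := 1) hc').comp (continuous_swap (X := ℝ) (Y := ℝ))
    refine this.neg.congr fun p => ?_
    simp [intervalIntegral.integral_symm p.1 1]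
  -- The lower limit and the parameter are decoupled into two variables. Continuous partial
  -- derivatives give joint differentiability, and the chain rule along the diagonal gives the
  -- claim.
  have hF := hasStrictFDerivAt_uncurry_coprod (𝕜 := ℝ) (u := (ξ, ξ))
    (f := fun a ξ => ∫ x in a..1, h ξ x)
    (f₁ := fun a ξ => ContinuousLinearMap.toSpanSingleton ℝ (-h ξ a))
    (f₂ := fun a ξ => ContinuousLinearMap.toSpanSingleton ℝ (∫ x in a..1, h' ξ x))
    (Eventually.of_forall fun v => (d1 v.1 v.2).hasFDerivAt)
    (Eventually.of_forall fun v => (d2 v.1 v.2).hasFDerivAt) ?_ ?_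
  · have h2 := HasFDerivAt.comp_hasDerivAt (f := fun t : ℝ => (t, t)) ξ hF.hasFDerivAt
      ((hasDerivAt_id ξ).prodMk (hasDerivAt_id ξ))
    convert! h2 using 1
    simp [Function.HasUncurry.uncurry]
  · refine Continuous.continuousAt ?_
    refine (ContinuousLinearMap.toSpanSingletonCLE (𝕜 := ℝ) (E := ℝ)).continuous.comp ?_
    exact (hc.comp continuous_swap).neg
  · refine Continuous.continuousAt ?_
    exact (ContinuousLinearMap.toSpanSingletonCLE (𝕜 := ℝ) (E := ℝ)).continuous.comp cI

/-! ### The adjoint backstepping transformation of the sine modes -/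

/-- The adjoint backstepping transformation of the sine mode `sn i`. -/
def dualMode (l : ℝ) (i : ℕ) (ξ : ℝ) : ℝ :=
  sn i ξ - ∫ x in ξ..1, smoothKernel l x ξ * sn i x

/-- The derivative of `dualMode`. -/
def dualModeDeriv (l : ℝ) (i : ℕ) (ξ : ℝ) : ℝ :=
  i * Real.pi * cs i ξ - l * ξ / 2 * sn i ξ - ∫ x in ξ..1, smoothKernelY l x ξ * sn i x

theorem hasDerivAt_dualMode (l : ℝ) (i : ℕ) (ξ : ℝ) :
    HasDerivAt (dualMode l i) (dualModeDeriv l i ξ) ξ := by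
  have h := hasDerivAt_integral_lower
    (h := fun ξ x => smoothKernel l x ξ * sn i x) (h' := fun ξ x => smoothKernelY l x ξ * sn i x)
    (((continuous_smoothKernel l).comp continuous_swap).mul ((continuous_sn i).comp continuous_snd))
    (((continuous_smoothKernelY l).comp continuous_swap).mul
      ((continuous_sn i).comp continuous_snd))
    (fun ξ x => (hasDerivAt_smoothKernel_y l x ξ).mul_const _) ξ
  refine ((hasDerivAt_sn i ξ).sub h).congr_deriv ?_
  rw [dualModeDeriv, smoothKernel_diag]
  ring

/-- Integration by parts for `∫_ξ^1 K_xx(x, ξ) sin(i π x) dx`. -/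
theorem integral_smoothKernelXX_mul_sn (l : ℝ) (i : ℕ) (ξ : ℝ) :
    ∫ x in ξ..1, smoothKernelXX l x ξ * sn i x
      = -(smoothKernelX l ξ ξ * sn i ξ) - i * Real.pi * ((-1) ^ i * smoothKernel l 1 ξ
          - cs i ξ * smoothKernel l ξ ξ)
        - (i * Real.pi) ^ 2 * ∫ x in ξ..1, smoothKernel l x ξ * sn i x := by
  have c : ∀ {k : ℝ → ℝ → ℝ}, Continuous (Function.uncurry k) → Continuous fun x => k x ξ :=
    fun hk => hk.comp (Continuous.prodMk_left ξ)
  have hK := c (continuous_smoothKernel l)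
  have hX := c (continuous_smoothKernelX l)
  have hXX := c (continuous_smoothKernelXX l)
  have hs := continuous_sn i
  have hcs := continuous_cs i
  have key := intervalIntegral.integral_eq_sub_of_hasDerivAt (a := ξ) (b := 1)
    (f := fun x => smoothKernelX l x ξ * sn i x - smoothKernel l x ξ * (i * Real.pi * cs i x))
    (f' := fun x => smoothKernelXX l x ξ * sn i x
      + (i * Real.pi) ^ 2 * (smoothKernel l x ξ * sn i x))
    (fun x _ => by
      refine (((hasDerivAt_smoothKernelX_x l x ξ).mul (hasDerivAt_sn i x)).sub
        ((hasDerivAt_smoothKernel_x l x ξ).mul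
          ((hasDerivAt_cs i x).const_mul (i * Real.pi)))).congr_deriv ?_
      ring)
    (by apply Continuous.intervalIntegrable; fun_prop)
  rw [intervalIntegral.integral_add (by apply Continuous.intervalIntegrable; fun_prop)
    (by apply Continuous.intervalIntegrable; fun_prop),
    intervalIntegral.integral_const_mul] at key
  simp only [sn_at_one, cs_at_one] at key
  linear_combination key

/-- The kernel equation replaces `K_ξξ` by `K_xx - l K`, and two integrations by parts in `x` move
`K_xx` onto the sine. The terms at `x = ξ` cancel thanks to `K(ξ, ξ) = -l ξ / 2`. At `x = 1` the
cosine does not vanish and leaves a multiple of `K(1, ξ)`, which the feedback later removes. -/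
theorem hasDerivAt_dualModeDeriv (l : ℝ) (i : ℕ) (ξ : ℝ) :
    HasDerivAt (dualModeDeriv l i) (-((i * Real.pi) ^ 2 + l) * dualMode l i ξ
      + i * Real.pi * (-1) ^ i * smoothKernel l 1 ξ) ξ := by
  have hK := continuous_smoothKernel l
  have hXX := continuous_smoothKernelXX l
  have h := hasDerivAt_integral_lower
    (h := fun ξ x => smoothKernelY l x ξ * sn i x)
    (h' := fun ξ x => (smoothKernelXX l x ξ - l * smoothKernel l x ξ) * sn i x)
    (((continuous_smoothKernelY l).comp continuous_swap).mul
      ((continuous_sn i).comp continuous_snd))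
    (((hXX.comp continuous_swap).sub ((hK.comp continuous_swap).const_mul l)).mul
      ((continuous_sn i).comp continuous_snd))
    (fun ξ x => (hasDerivAt_smoothKernelY_y l x ξ).mul_const _) ξ
  have h1 : HasDerivAt (fun ξ : ℝ => l * ξ / 2) (l * 1 / 2) ξ :=
    ((hasDerivAt_id ξ).const_mul l).div_const 2
  refine ((((hasDerivAt_cs i ξ).const_mul (i * Real.pi)).sub (h1.mul (hasDerivAt_sn i ξ))).sub
    h).congr_deriv ?_
  have c : ∀ {k : ℝ → ℝ → ℝ}, Continuous (Function.uncurry k) → Continuous fun x => k x ξ :=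
    fun hk => hk.comp (Continuous.prodMk_left ξ)
  have hs := continuous_sn i
  have hK' := c hK
  have hXX' := c hXX
  have e : ∫ x in ξ..1, (smoothKernelXX l x ξ - l * smoothKernel l x ξ) * sn i x
      = (∫ x in ξ..1, smoothKernelXX l x ξ * sn i x)
        - l * ∫ x in ξ..1, smoothKernel l x ξ * sn i x := by
    rw [← intervalIntegral.integral_const_mul, ← intervalIntegral.integral_sub
      (by apply Continuous.intervalIntegrable; fun_prop)
      (by apply Continuous.intervalIntegrable; fun_prop)]
    congr 1; ext x; ring
  rw [e, integral_smoothKernelXX_mul_sn, dualMode]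
  have dX : smoothKernelX l ξ ξ = -(l ^ 2 * ξ ^ 2 / 8) := by
    simp [smoothKernelX, besselSeries_at_zero]; ring
  have dY : smoothKernelY l ξ ξ = -(l / 2) + l ^ 2 * ξ ^ 2 / 8 := by
    simp [smoothKernelY, besselSeries_at_zero]; ring
  rw [dX, dY, smoothKernel_diag]
  ring

/-- Bootstrapping in the second-order equation, whose inhomogeneity is smooth. Smoothness is
required of a factor in a product test function. -/
theorem contDiff_dualMode (l : ℝ) (i : ℕ) : ContDiff ℝ ∞ (dualMode l i) := by
  have hd : deriv (dualMode l i) = dualModeDeriv l i :=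
    funext fun ξ => (hasDerivAt_dualMode l i ξ).deriv
  have hdd : deriv (dualModeDeriv l i) = fun ξ => -((i * Real.pi) ^ 2 + l) * dualMode l i ξ
      + i * Real.pi * (-1) ^ i * smoothKernel l 1 ξ :=
    funext fun ξ => (hasDerivAt_dualModeDeriv l i ξ).deriv
  have hk : ContDiff ℝ ∞ fun ξ => smoothKernel l 1 ξ :=
    (contDiff_smoothKernel l).comp (contDiff_prodMk_right 1)
  have hdiff : Differentiable ℝ (dualMode l i) := fun ξ => (hasDerivAt_dualMode l i ξ).differentiableAt
  have hdiff' : Differentiable ℝ (dualModeDeriv l i) :=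
    fun ξ => (hasDerivAt_dualModeDeriv l i ξ).differentiableAt
  have main : ∀ n : ℕ, ContDiff ℝ n (dualMode l i) ∧ ContDiff ℝ n (dualModeDeriv l i) := by
    intro n
    induction n with
    | zero => exact ⟨contDiff_zero.2 hdiff.continuous, contDiff_zero.2 hdiff'.continuous⟩
    | succ n ih =>
      push_cast
      rw [contDiff_succ_iff_deriv, contDiff_succ_iff_deriv, hd, hdd]
      refine ⟨⟨hdiff, by simp, ih.2⟩, hdiff', by simp, ?_⟩
      exact (contDiff_const.mul ih.1).add
        (contDiff_const.mul (hk.of_le (by exact_mod_cast le_top)))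
  exact contDiff_infty.2 fun n => (main n).1

theorem deriv_dualMode (l : ℝ) (i : ℕ) : deriv (dualMode l i) = dualModeDeriv l i :=
  funext fun ξ => (hasDerivAt_dualMode l i ξ).deriv

theorem deriv_deriv_dualMode (l : ℝ) (i : ℕ) (ξ : ℝ) :
    deriv (deriv (dualMode l i)) ξ = -((i * Real.pi) ^ 2 + l) * dualMode l i ξ
      + i * Real.pi * (-1) ^ i * smoothKernel l 1 ξ := by
  rw [deriv_dualMode]; exact (hasDerivAt_dualModeDeriv l i ξ).deriv

/-- The integral drops out because `K(x, 0) = 0`. Vanishing at both end points puts the products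
with `sin (n π y)` in `H¹₀`. -/
theorem dualMode_at_zero (l : ℝ) (i : ℕ) : dualMode l i 0 = 0 := by
  simp [dualMode, smoothKernel]

theorem dualMode_at_one (l : ℝ) (i : ℕ) : dualMode l i 1 = 0 := by
  simp [dualMode]

theorem deriv_dualMode_at_one (l : ℝ) (i : ℕ) :
    deriv (dualMode l i) 1 = i * Real.pi * (-1) ^ i := by
  simp [deriv_dualMode, dualModeDeriv]

/-! ### Volterra operators on `L²(0, 1)` -/

theorem integrable_fun_sub {α : Type*} [MeasurableSpace α] {μ : Measure α} {f g : α → ℝ}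
    (hf : Integrable f μ) (hg : Integrable g μ) : Integrable (fun x => f x - g x) μ := hf.sub hg

/-- The Cauchy-Schwarz inequality for integrals of real functions. -/
theorem sq_integral_mul_le {α : Type*} [MeasurableSpace α] {μ : Measure α} {f g : α → ℝ}
    (hf : MemLp f 2 μ) (hg : MemLp g 2 μ) :
    (∫ x, f x * g x ∂μ) ^ 2 ≤ (∫ x, f x ^ 2 ∂μ) * ∫ x, g x ^ 2 ∂μ := by
  have hfg : Integrable (fun x => f x * g x) μ := hf.integrable_mul hg
  have h : ∀ t : ℝ, 0 ≤ (∫ x, g x ^ 2 ∂μ) * (t * t) + 2 * (∫ x, f x * g x ∂μ) * t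
      + ∫ x, f x ^ 2 ∂μ := by
    intro t
    have : (∫ x, g x ^ 2 ∂μ) * (t * t) + 2 * (∫ x, f x * g x ∂μ) * t + ∫ x, f x ^ 2 ∂μ
        = ∫ x, (f x + t * g x) ^ 2 ∂μ := by
      have e : ∀ x, (f x + t * g x) ^ 2 = (t * t) * g x ^ 2 + (2 * t) * (f x * g x) + f x ^ 2 := by
        intro x; ring
      simp_rw [e]
      rw [integral_add ((hg.integrable_sq.const_mul _).fun_add (hfg.const_mul _)) hf.integrable_sq,
        integral_add (hg.integrable_sq.const_mul _) (hfg.const_mul _),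
        integral_const_mul, integral_const_mul]
      ring
    rw [this]
    exact integral_nonneg fun x => sq_nonneg _
  have := discrim_le_zero h
  rw [discrim] at this
  nlinarith

theorem memLp_of_continuous {f : ℝ → ℝ} (hf : Continuous f) : MemLp f 2 volI := by
  obtain ⟨C, hC⟩ := (isCompact_Icc (a := (0 : ℝ)) (b := 1)).exists_bound_of_continuousOn
    hf.continuousOn
  refine MemLp.of_bound hf.aestronglyMeasurable C ?_
  filter_upwards [ae_mem_volI] with x hx using hC x (Set.Ioo_subset_Icc_self hx)

/-- The Volterra operator `f ↦ ∫_0^x κ(x, ξ) f(ξ) dξ` on the unit interval. -/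
def volterra (κ : ℝ → ℝ → ℝ) (f : ℝ → ℝ) (x : ℝ) : ℝ :=
  ∫ ξ, (if ξ ≤ x then κ x ξ * f ξ else 0) ∂volI

section

variable {κ : ℝ → ℝ → ℝ} {f : ℝ → ℝ}

theorem exists_bound_kernel (hκ : Continuous (Function.uncurry κ)) :
    ∃ M : ℝ, 0 < M ∧ ∀ x ∈ Set.Icc (0 : ℝ) 1, ∀ ξ ∈ Set.Icc (0 : ℝ) 1, |κ x ξ| ≤ M := by
  obtain ⟨C, hC⟩ := ((isCompact_Icc (a := (0 : ℝ)) (b := 1)).prod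
    (isCompact_Icc (a := (0 : ℝ)) (b := 1))).exists_bound_of_continuousOn hκ.continuousOn
  exact ⟨max C 1, by positivity, fun x hx ξ hξ => (hC (x, ξ) ⟨hx, hξ⟩).trans (le_max_left _ _)⟩

theorem integrable_triangle (hκ : Continuous (Function.uncurry κ)) (hf : MemLp f 2 volI)
    {h : ℝ → ℝ} (hh : Continuous h) :
    Integrable (fun p : ℝ × ℝ => if p.2 ≤ p.1 then κ p.1 p.2 * f p.2 * h p.1 else 0)
      (volI.prod volI) := by
  obtain ⟨M, hM0, hM⟩ := exists_bound_kernel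
    (κ := fun x ξ => κ x ξ * h x) (hκ.mul (hh.comp continuous_fst))
  have hset : MeasurableSet {p : ℝ × ℝ | p.2 ≤ p.1} :=
    measurableSet_le measurable_snd measurable_fst
  have h1 : Integrable (fun p : ℝ × ℝ => f p.2) (volI.prod volI) :=
    (hf.integrable one_le_two).comp_snd volI
  have h2 : Integrable (fun p : ℝ × ℝ => (if p.2 ≤ p.1 then κ p.1 p.2 * h p.1 else 0) * f p.2)
      (volI.prod volI) := by
    refine h1.bdd_mul (c := M) ?_ ?_
    · exact (((hκ.measurable).mul (hh.measurable.comp measurable_fst)).ite hset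
        measurable_const).aestronglyMeasurable
    · have hp : ∀ᵐ p ∂(volI.prod volI), p ∈ Set.Ioo (0 : ℝ) 1 ×ˢ Set.Ioo (0 : ℝ) 1 := by
        rw [volI, Measure.prod_restrict]
        exact ae_restrict_mem (measurableSet_Ioo.prod measurableSet_Ioo)
      filter_upwards [hp] with p hp
      split_ifs
      · exact hM p.1 (Set.Ioo_subset_Icc_self hp.1) p.2 (Set.Ioo_subset_Icc_self hp.2)
      · simpa using hM0.le
  refine h2.congr (Eventually.of_forall fun p => ?_)
  dsimp only
  split_ifs <;> ring

/-- Fubini's theorem on the triangle `0 < ξ < x < 1`. -/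
theorem integral_volterra_mul (hκ : Continuous (Function.uncurry κ)) (hf : MemLp f 2 volI)
    {h : ℝ → ℝ} (hh : Continuous h) :
    ∫ x, volterra κ f x * h x ∂volI = ∫ ξ, f ξ * (∫ x in ξ..1, κ x ξ * h x) ∂volI := by
  have hi := integrable_triangle hκ hf hh
  have e1 : ∀ x, volterra κ f x * h x
      = ∫ ξ, (if ξ ≤ x then κ x ξ * f ξ * h x else 0) ∂volI := by
    intro x
    rw [volterra, ← integral_mul_const]
    congr 1; ext ξ
    split_ifs <;> simp
  simp_rw [e1]
  rw [integral_integral_swap hi]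
  refine integral_congr_ae ?_
  filter_upwards [ae_mem_volI] with ξ hξ
  rw [intervalIntegral.integral_of_le hξ.2.le, ← integral_const_mul,
    ← integral_indicator measurableSet_Ioc, volI, ← integral_indicator measurableSet_Ioo]
  refine integral_congr_ae ?_
  have h1 : ∀ᵐ x : ℝ, x ≠ ξ := by simp [ae_iff]
  have h2 : ∀ᵐ x : ℝ, x ≠ 1 := by simp [ae_iff]
  filter_upwards [h1, h2] with x hx hx1
  simp only [Set.indicator_apply, Set.mem_Ioo, Set.mem_Ioc]
  by_cases hxξ : ξ ≤ x
  · have : ξ < x := lt_of_le_of_ne hxξ (Ne.symm hx)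
    by_cases hx2 : x < 1
    · simp [hxξ, this, hx2, hx2.le, hξ.1.trans this]; ring
    · have : ¬ x ≤ 1 := fun h => hx2 (lt_of_le_of_ne h hx1)
      simp [hx2, this]
  · have : ¬ ξ < x := fun h => hxξ h.le
    simp [hxξ, this]

theorem aestronglyMeasurable_volterra (hκ : Continuous (Function.uncurry κ))
    (hf : MemLp f 2 volI) : AEStronglyMeasurable (volterra κ f) volI := by
  have := (integrable_triangle hκ hf (h := fun _ => 1) continuous_const).aestronglyMeasurable
  have h2 := this.integral_prod_right'
  simp only [mul_one] at h2
  exact h2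

theorem abs_volterra_le {M x : ℝ} (hM : ∀ x ∈ Set.Icc (0 : ℝ) 1, ∀ ξ ∈ Set.Icc (0 : ℝ) 1,
    |κ x ξ| ≤ M) (hx : x ∈ Set.Ioo (0 : ℝ) 1) (hf : MemLp f 2 volI) :
    |volterra κ f x| ≤ M * ∫ ξ, (Set.Iic x).indicator (fun ξ => |f ξ|) ξ ∂volI := by
  rw [volterra, ← integral_const_mul]
  rw [← Real.norm_eq_abs]
  refine norm_integral_le_of_norm_le
    ((((hf.integrable one_le_two).abs).indicator measurableSet_Iic).const_mul M) ?_
  filter_upwards [ae_mem_volI] with ξ hξ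
  simp only [Set.indicator_apply, Set.mem_Iic]
  split_ifs
  · rw [Real.norm_eq_abs, abs_mul]
    have := hM x (Set.Ioo_subset_Icc_self hx) ξ (Set.Ioo_subset_Icc_self hξ)
    gcongr
  · simp

/-- Cauchy-Schwarz after splitting `|f| = e^{αξ} · e^{-αξ} |f|`. The gain `1 / (2α)` allows a
Volterra term to be absorbed in an exponentially weighted norm. -/
theorem sq_integral_indicator_le (hf : MemLp f 2 volI) {α : ℝ} (hα : 0 < α) (x : ℝ) :
    (∫ ξ, (Set.Iic x).indicator (fun ξ => |f ξ|) ξ ∂volI) ^ 2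
      ≤ Real.exp (2 * α * x) / (2 * α) * ∫ ξ, Real.exp (-(2 * α * ξ)) * f ξ ^ 2 ∂volI := by
  have e : ∀ ξ, (Set.Iic x).indicator (fun ξ => |f ξ|) ξ
      = (Set.Iic x).indicator (fun ξ => Real.exp (α * ξ)) ξ * (Real.exp (-(α * ξ)) * |f ξ|) := by
    intro ξ
    simp only [Set.indicator_apply]
    split_ifs
    · rw [← mul_assoc, ← Real.exp_add]; simp
    · simp
  simp_rw [e]
  have m1 : MemLp ((Set.Iic x).indicator (fun ξ => Real.exp (α * ξ))) 2 volI :=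
    (memLp_of_continuous (by fun_prop)).indicator measurableSet_Iic
  have m2 : MemLp (fun ξ => Real.exp (-(α * ξ)) * |f ξ|) 2 volI := by
    refine (hf.abs).of_le_mul (c := 1)
      ((by fun_prop : Continuous fun ξ => Real.exp (-(α * ξ))).aestronglyMeasurable.mul
        hf.abs.aestronglyMeasurable) ?_
    filter_upwards [ae_mem_volI] with ξ hξ
    rw [norm_mul, Real.norm_eq_abs, Real.abs_exp]
    have : Real.exp (-(α * ξ)) ≤ 1 := Real.exp_le_one_iff.2 (by nlinarith [hξ.1])
    exact mul_le_mul_of_nonneg_right this (norm_nonneg _)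
  refine (sq_integral_mul_le m1 m2).trans ?_
  have e2 : ∀ ξ, (Real.exp (-(α * ξ)) * |f ξ|) ^ 2 = Real.exp (-(2 * α * ξ)) * f ξ ^ 2 := by
    intro ξ
    rw [mul_pow, sq_abs, ← Real.exp_nat_mul]; congr 2; push_cast; ring
  simp_rw [e2]
  refine mul_le_mul_of_nonneg_right ?_ (integral_nonneg fun ξ => by positivity)
  · have e3 : ∀ ξ, (Set.Iic x).indicator (fun ξ => Real.exp (α * ξ)) ξ ^ 2
        = (Set.Iic x).indicator (fun ξ => Real.exp (2 * α * ξ)) ξ := by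
      intro ξ
      simp only [Set.indicator_apply]
      split_ifs
      · rw [← Real.exp_nat_mul]; congr 1; push_cast; ring
      · simp
    simp_rw [e3]
    rw [integral_indicator measurableSet_Iic]
    have hint := integrableOn_exp_mul_Iic (a := 2 * α) (by positivity) x
    calc ∫ ξ in Set.Iic x, Real.exp (2 * α * ξ) ∂volI
        ≤ ∫ ξ in Set.Iic x, Real.exp (2 * α * ξ) := by
          refine integral_mono_measure ?_ (Eventually.of_forall fun ξ => (Real.exp_pos _).le) hint
          exact Measure.restrict_mono le_rfl Measure.restrict_le_self
      _ = Real.exp (2 * α * x) / (2 * α) := integral_exp_mul_Iic (by positivity) x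

/-- A Volterra perturbation of the identity is bounded below on `L²(0, 1)`. -/
theorem integral_sq_le_of_volterra {w : ℝ → ℝ} {M : ℝ} (hM : 0 < M) (hf : MemLp f 2 volI)
    (hw : MemLp w 2 volI)
    (h : ∀ᵐ x ∂volI, |f x| ≤ |w x| + M * ∫ ξ, (Set.Iic x).indicator (fun ξ => |f ξ|) ξ ∂volI) :
    ∫ x, f x ^ 2 ∂volI ≤ 4 * Real.exp (4 * M ^ 2) * ∫ x, w x ^ 2 ∂volI := by
  -- With this weight the Volterra term costs `2 M² / (2α) = 1/2` of the weighted norm `A`, which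
  -- can be absorbed on the left.
  set α : ℝ := 2 * M ^ 2 with hα
  have hα0 : 0 < α := by positivity
  set A : ℝ := ∫ ξ, Real.exp (-(2 * α * ξ)) * f ξ ^ 2 ∂volI with hA
  have hle1 : ∀ᵐ ξ ∂volI, ‖Real.exp (-(2 * α * ξ))‖ ≤ 1 := by
    filter_upwards [ae_mem_volI] with ξ hξ
    rw [Real.norm_eq_abs, Real.abs_exp]
    exact Real.exp_le_one_iff.2 (by nlinarith [hξ.1])
  have hm : AEStronglyMeasurable (fun ξ => Real.exp (-(2 * α * ξ))) volI :=
    (by fun_prop : Continuous fun ξ => Real.exp (-(2 * α * ξ))).aestronglyMeasurable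
  have hfi : Integrable (fun ξ => Real.exp (-(2 * α * ξ)) * f ξ ^ 2) volI :=
    hf.integrable_sq.bdd_mul hm hle1
  have hA4 : A ≤ 2 * ∫ x, w x ^ 2 ∂volI + A / 2 := by
    have : A ≤ ∫ x, (2 * w x ^ 2 + A / 2) ∂volI := by
      refine integral_mono_ae hfi ((hw.integrable_sq.const_mul 2).add (integrable_const _)) ?_
      filter_upwards [h, ae_mem_volI] with x hx hx01
      have hI := sq_integral_indicator_le hf hα0 x
      rw [← hA] at hI
      set I := ∫ ξ, (Set.Iic x).indicator (fun ξ => |f ξ|) ξ ∂volI with hIdef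
      have hI0 : 0 ≤ I := integral_nonneg fun ξ => Set.indicator_nonneg (fun _ _ => abs_nonneg _) _
      have h1 : f x ^ 2 ≤ 2 * w x ^ 2 + 2 * M ^ 2 * I ^ 2 := by
        rw [← sq_abs (f x), ← sq_abs (w x)]
        have := pow_le_pow_left₀ (abs_nonneg _) hx 2
        nlinarith [sq_nonneg (|w x| - M * I)]
      have he : Real.exp (-(2 * α * x)) ≤ 1 := Real.exp_le_one_iff.2 (by nlinarith [hx01.1])
      have hexp : Real.exp (-(2 * α * x)) * Real.exp (2 * α * x) = 1 := by
        rw [← Real.exp_add]; simp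
      calc Real.exp (-(2 * α * x)) * f x ^ 2
          ≤ Real.exp (-(2 * α * x)) * (2 * w x ^ 2 + 2 * M ^ 2 * I ^ 2) := by gcongr
        _ = Real.exp (-(2 * α * x)) * (2 * w x ^ 2)
            + α * (Real.exp (-(2 * α * x)) * I ^ 2) := by rw [hα]; ring
        _ ≤ 1 * (2 * w x ^ 2) + α * (Real.exp (-(2 * α * x)) *
            (Real.exp (2 * α * x) / (2 * α) * A)) := by gcongr
        _ = 2 * w x ^ 2 + A / 2 := by
            have : α * (Real.exp (-(2 * α * x)) * (Real.exp (2 * α * x) / (2 * α) * A))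
                = Real.exp (-(2 * α * x)) * Real.exp (2 * α * x) * (A / 2) := by
              field_simp
            rw [this, hexp]; ring
    rwa [integral_add (hw.integrable_sq.const_mul 2) (integrable_const _), integral_const_mul,
      integral_const, probReal_univ, one_smul] at this
  have hfA : ∫ x, f x ^ 2 ∂volI ≤ Real.exp (2 * α) * A := by
    rw [hA, ← integral_const_mul]
    refine integral_mono_ae hf.integrable_sq (hfi.const_mul _) ?_
    filter_upwards [ae_mem_volI] with x hx
    rw [← mul_assoc, ← Real.exp_add]
    have : 1 ≤ Real.exp (2 * α + -(2 * α * x)) := Real.one_le_exp (by nlinarith [hx.2])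
    nlinarith [sq_nonneg (f x)]
  have : 2 * α = 4 * M ^ 2 := by rw [hα]; ring
  rw [this] at hfA
  have := mul_le_mul_of_nonneg_left (by linarith : A ≤ 4 * ∫ x, w x ^ 2 ∂volI)
    (Real.exp_pos (4 * M ^ 2)).le
  linarith

theorem sq_integral_abs_le (hf : MemLp f 2 volI) (s : Set ℝ) (hs : MeasurableSet s) :
    (∫ ξ, s.indicator (fun ξ => |f ξ|) ξ ∂volI) ^ 2 ≤ ∫ ξ, f ξ ^ 2 ∂volI := by
  have h1 : ∫ ξ, s.indicator (fun ξ => |f ξ|) ξ ∂volI ≤ ∫ ξ, |f ξ| ∂volI :=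
    integral_mono ((hf.integrable one_le_two).abs.indicator hs) (hf.integrable one_le_two).abs
      (Set.indicator_le_self' fun _ _ => abs_nonneg _)
  have h0 : 0 ≤ ∫ ξ, s.indicator (fun ξ => |f ξ|) ξ ∂volI :=
    integral_nonneg fun ξ => Set.indicator_nonneg (fun _ _ => abs_nonneg _) _
  have h2 := sq_integral_mul_le hf.abs (memLp_of_continuous (f := fun _ => (1 : ℝ))
    continuous_const)
  simp only [mul_one, sq_abs, one_pow, integral_const, probReal_univ, smul_eq_mul,
    Pi.abs_apply] at h2
  exact (pow_le_pow_left₀ h0 h1 2).trans h2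

theorem memLp_volterra (hκ : Continuous (Function.uncurry κ)) (hf : MemLp f 2 volI) :
    MemLp (volterra κ f) 2 volI := by
  obtain ⟨M, hM0, hM⟩ := exists_bound_kernel hκ
  refine MemLp.of_bound (aestronglyMeasurable_volterra hκ hf) (M * ∫ ξ, |f ξ| ∂volI) ?_
  filter_upwards [ae_mem_volI] with x hx
  refine (abs_volterra_le hM hx hf).trans ?_
  refine mul_le_mul_of_nonneg_left ?_ hM0.le
  exact integral_mono ((hf.integrable one_le_two).abs.indicator measurableSet_Iic)
      (hf.integrable one_le_two).abs (Set.indicator_le_self' fun _ _ => abs_nonneg _)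

theorem integral_sq_volterra_le {M : ℝ} (hκ : Continuous (Function.uncurry κ))
    (hM : ∀ x ∈ Set.Icc (0 : ℝ) 1, ∀ ξ ∈ Set.Icc (0 : ℝ) 1, |κ x ξ| ≤ M) (hf : MemLp f 2 volI) :
    ∫ x, volterra κ f x ^ 2 ∂volI ≤ M ^ 2 * ∫ x, f x ^ 2 ∂volI := by
  have h : ∫ x, volterra κ f x ^ 2 ∂volI ≤ ∫ x, (M ^ 2 * ∫ x, f x ^ 2 ∂volI) ∂volI := by
    refine integral_mono_ae (memLp_volterra hκ hf).integrable_sq (integrable_const _) ?_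
    filter_upwards [ae_mem_volI] with x hx
    have h1 := pow_le_pow_left₀ (abs_nonneg _) (abs_volterra_le hM hx hf) 2
    rw [sq_abs, mul_pow] at h1
    exact h1.trans (by gcongr; exact sq_integral_abs_le hf _ measurableSet_Iic)
  simpa using h

end

/-! ### The backstepping transformation on the unit interval -/

/-- The backstepping transform `f - ∫_0^x K(x, ξ) f(ξ) dξ`. -/
def backstep (l : ℝ) (f : ℝ → ℝ) (x : ℝ) : ℝ := f x - volterra (smoothKernel l) f x

/-- The derivative of `backstep l f` when `g` is the derivative of `f`. -/
def backstepDeriv (l : ℝ) (f g : ℝ → ℝ) (x : ℝ) : ℝ :=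
  g x - (smoothKernel l x x * f x + volterra (smoothKernelX l) f x)

section

variable {f g : ℝ → ℝ}

theorem memLp_backstep (l : ℝ) (hf : MemLp f 2 volI) : MemLp (backstep l f) 2 volI :=
  hf.sub (memLp_volterra (continuous_smoothKernel l) hf)

theorem memLp_continuous_mul {h : ℝ → ℝ} (hh : Continuous h) (hf : MemLp f 2 volI) :
    MemLp (fun x => h x * f x) 2 volI := by
  obtain ⟨C, hC⟩ := (isCompact_Icc (a := (0 : ℝ)) (b := 1)).exists_bound_of_continuousOn
    hh.continuousOn
  refine hf.of_le_mul (c := C) (hh.aestronglyMeasurable.mul hf.aestronglyMeasurable) ?_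
  filter_upwards [ae_mem_volI] with x hx
  rw [norm_mul]
  gcongr
  exact hC x (Set.Ioo_subset_Icc_self hx)

theorem continuous_smoothKernel_diag (l : ℝ) : Continuous fun x => smoothKernel l x x :=
  (continuous_smoothKernel l).comp (continuous_id.prodMk continuous_id)

theorem memLp_backstepDeriv (l : ℝ) (hf : MemLp f 2 volI) (hg : MemLp g 2 volI) :
    MemLp (backstepDeriv l f g) 2 volI :=
  hg.sub ((memLp_continuous_mul (continuous_smoothKernel_diag l) hf).add
    (memLp_volterra (continuous_smoothKernelX l) hf))

theorem integrable_mul_continuous (hf : MemLp f 2 volI) {h : ℝ → ℝ} (hh : Continuous h) :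
    Integrable (fun x => f x * h x) volI :=
  hf.integrable_mul (memLp_of_continuous hh)

/-- The sine coefficients of the backstepping transform. -/
theorem integral_backstep_mul_sn (l : ℝ) (i : ℕ) (hf : MemLp f 2 volI) :
    ∫ x, backstep l f x * sn i x ∂volI = ∫ x, f x * dualMode l i x ∂volI := by
  have hK := continuous_smoothKernel l
  have hs := continuous_sn i
  have h1 := integrable_mul_continuous hf hs
  have h2 := integrable_mul_continuous (memLp_volterra hK hf) hs
  have hp := integrable_mul_continuous hf (contDiff_dualMode l i).continuous
  simp_rw [backstep, sub_mul]
  rw [integral_sub h1 h2, integral_volterra_mul hK hf hs, ← integral_sub h1]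
  · simp_rw [dualMode, mul_sub]
  · refine (h1.sub hp).congr (Eventually.of_forall fun x => ?_)
    simp only [dualMode, Pi.sub_apply]; ring

/-- The cosine coefficients of the derivative of the backstepping transform, for a function
that vanishes at `0` and whose value at `1` is given by the backstepping feedback. -/
theorem integral_backstepDeriv_mul_cs (l : ℝ) (i : ℕ) (hf : MemLp f 2 volI)
    (hg : MemLp g 2 volI)
    (hR : ∫ x, (f x * -(i * Real.pi * sn i x) + g x * cs i x) ∂volI
      = (∫ x, smoothKernel l 1 x * f x ∂volI) * (-1) ^ i) :
    ∫ x, backstepDeriv l f g x * cs i x ∂volI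
      = i * Real.pi * ∫ x, f x * dualMode l i x ∂volI := by
  have hK := continuous_smoothKernel l
  have hX := continuous_smoothKernelX l
  have hD := continuous_smoothKernel_diag l
  have hs := continuous_sn i
  have hcs := continuous_cs i
  have hK1 : Continuous fun x => smoothKernel l 1 x := hK.comp (Continuous.prodMk_right 1)
  have ig := integrable_mul_continuous hg hcs
  have iD : Integrable (fun x => f x * (smoothKernel l x x * cs i x)) volI :=
    integrable_mul_continuous hf (hD.mul hcs)
  have iX := integrable_mul_continuous (memLp_volterra hX hf) hcs
  have ip := integrable_mul_continuous hf (contDiff_dualMode l i).continuous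
  have is := integrable_mul_continuous hf hs
  have iK1 := integrable_mul_continuous hf hK1
  -- Integration by parts in `x`: the term at `x = ξ` cancels the diagonal term of `backstepDeriv`,
  -- and the term at `x = 1`, integrated against `f`, is the boundary value in `hR`.
  have hparts : ∀ ξ, ∫ x in ξ..1, smoothKernelX l x ξ * cs i x
      = smoothKernel l 1 ξ * (-1) ^ i - smoothKernel l ξ ξ * cs i ξ
        + i * Real.pi * (sn i ξ - dualMode l i ξ) := by
    intro ξ
    have c : ∀ {k : ℝ → ℝ → ℝ}, Continuous (Function.uncurry k) → Continuous fun x => k x ξ :=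
      fun hk => hk.comp (Continuous.prodMk_left ξ)
    have hK' := c hK
    have hX' := c hX
    have key := intervalIntegral.integral_eq_sub_of_hasDerivAt (a := ξ) (b := 1)
      (f := fun x => smoothKernel l x ξ * cs i x)
      (f' := fun x => smoothKernelX l x ξ * cs i x - i * Real.pi * (smoothKernel l x ξ * sn i x))
      (fun x _ => by
        refine ((hasDerivAt_smoothKernel_x l x ξ).mul (hasDerivAt_cs i x)).congr_deriv ?_
        ring)
      (by apply Continuous.intervalIntegrable; fun_prop)
    rw [intervalIntegral.integral_sub (by apply Continuous.intervalIntegrable; fun_prop)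
      (by apply Continuous.intervalIntegrable; fun_prop),
      intervalIntegral.integral_const_mul] at key
    simp only [cs_at_one] at key
    rw [dualMode]
    linear_combination key
  have eX : ∫ x, volterra (smoothKernelX l) f x * cs i x ∂volI
      = ∫ x, ((-1) ^ i * (f x * smoothKernel l 1 x) - f x * (smoothKernel l x x * cs i x)
        + i * Real.pi * (f x * sn i x - f x * dualMode l i x)) ∂volI := by
    rw [integral_volterra_mul hX hf hcs]
    congr 1; ext ξ
    rw [hparts]; ring
  rw [integral_add (integrable_fun_sub (iK1.const_mul _) iD)
    ((integrable_fun_sub is ip).const_mul _),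
    integral_sub (iK1.const_mul _) iD, integral_const_mul, integral_const_mul,
    integral_sub is ip] at eX
  have eG : ∫ x, backstepDeriv l f g x * cs i x ∂volI = ∫ x, (g x * cs i x
      - (f x * (smoothKernel l x x * cs i x) + volterra (smoothKernelX l) f x * cs i x)) ∂volI := by
    congr 1; ext x; rw [backstepDeriv]; ring
  rw [integral_sub ig (iD.fun_add iX), integral_add iD iX, eX] at eG
  have eR : ∫ x, (f x * -(i * Real.pi * sn i x) + g x * cs i x) ∂volI
      = -(i * Real.pi) * (∫ x, f x * sn i x ∂volI) + ∫ x, g x * cs i x ∂volI := by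
    rw [← integral_const_mul, ← integral_add (is.const_mul _) ig]
    congr 1; ext x; ring
  rw [eR] at hR
  have eK : ∫ x, smoothKernel l 1 x * f x ∂volI = ∫ x, f x * smoothKernel l 1 x ∂volI := by
    congr 1; ext x; ring
  rw [eK] at hR
  linear_combination eG + hR

/-- The `L²` norm of a function is controlled by that of its backstepping transform. -/
theorem exists_integral_sq_le_backstep (l : ℝ) : ∃ C : ℝ, 0 < C ∧ ∀ f : ℝ → ℝ, MemLp f 2 volI →
    ∫ x, f x ^ 2 ∂volI ≤ C * ∫ x, backstep l f x ^ 2 ∂volI := by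
  obtain ⟨M, hM0, hM⟩ := exists_bound_kernel (continuous_smoothKernel l)
  refine ⟨4 * Real.exp (4 * M ^ 2), by positivity, fun f hf => ?_⟩
  refine integral_sq_le_of_volterra hM0 hf (memLp_backstep l hf) ?_
  filter_upwards [ae_mem_volI] with x hx
  have h1 := abs_volterra_le hM hx hf
  have h2 : f x = backstep l f x + volterra (smoothKernel l) f x := by rw [backstep]; ring
  calc |f x| ≤ |backstep l f x| + |volterra (smoothKernel l) f x| := by
        conv_lhs => rw [h2]
        exact abs_add_le _ _
    _ ≤ _ := by gcongr

end

/-- The coefficient of `f` against the adjoint backstepping mode `dualMode l i`. -/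
def dualCoeff (l : ℝ) (f : ℝ → ℝ) (i : ℕ) : ℝ := ∫ x, f x * dualMode l i x ∂volI

theorem hasSum_sq_dualCoeff (l : ℝ) {f : ℝ → ℝ} (hf : MemLp f 2 volI) :
    HasSum (fun i => 2 * dualCoeff l f i ^ 2) (∫ x, backstep l f x ^ 2 ∂volI) := by
  have := hasSum_sq_sn (memLp_backstep l hf)
  simp only [integral_backstep_mul_sn l _ hf] at this
  exact this

/-- The boundary relation, tested with the cosine modes, for a function `f` with derivative `g`
that vanishes at `0` and takes at `1` the value prescribed by the backstepping feedback. -/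
def BackstepRelation (l : ℝ) (f g : ℝ → ℝ) : Prop :=
  ∀ i : ℕ, ∫ x, (f x * -(i * Real.pi * sn i x) + g x * cs i x) ∂volI
    = (∫ x, smoothKernel l 1 x * f x ∂volI) * (-1) ^ i

/-- Cosine Parseval for the derivative of the transform. The feedback makes the transform vanish at
both ends; its derivative then has mean zero (the relation for `i = 0`), so the correction term in
Parseval disappears. -/
theorem hasSum_sq_mul_dualCoeff (l : ℝ) {f g : ℝ → ℝ} (hf : MemLp f 2 volI) (hg : MemLp g 2 volI)
    (hR : BackstepRelation l f g) :
    HasSum (fun i : ℕ => 2 * ((i * Real.pi) ^ 2 * dualCoeff l f i ^ 2))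
      (∫ x, backstepDeriv l f g x ^ 2 ∂volI) := by
  have h := hasSum_sq_cs (memLp_backstepDeriv l hf hg)
  have h0 : ∫ x, backstepDeriv l f g x ∂volI = 0 := by
    have := integral_backstepDeriv_mul_cs l 0 hf hg (hR 0)
    simpa using this
  rw [h0] at h
  simp only [fun i => integral_backstepDeriv_mul_cs l i hf hg (hR i)] at h
  simpa [mul_pow, dualCoeff] using h

theorem integral_sq_add_le {f g : ℝ → ℝ} (hf : MemLp f 2 volI) (hg : MemLp g 2 volI) :
    ∫ x, (f x + g x) ^ 2 ∂volI ≤ 2 * ∫ x, f x ^ 2 ∂volI + 2 * ∫ x, g x ^ 2 ∂volI := by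
  rw [← integral_const_mul, ← integral_const_mul, ← integral_add
    (hf.integrable_sq.const_mul 2) (hg.integrable_sq.const_mul 2)]
  refine integral_mono (hf.add hg).integrable_sq
    ((hf.integrable_sq.const_mul 2).add (hg.integrable_sq.const_mul 2)) fun x => ?_
  dsimp only
  nlinarith [sq_nonneg (f x - g x)]

theorem exists_integral_sq_le {l : ℝ} : ∃ C : ℝ, 0 < C ∧ ∀ f : ℝ → ℝ, MemLp f 2 volI →
    ∫ x, volterra (smoothKernel l) f x ^ 2 ∂volI ≤ C * ∫ x, f x ^ 2 ∂volI ∧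
    ∫ x, (smoothKernel l x x * f x + volterra (smoothKernelX l) f x) ^ 2 ∂volI
      ≤ C * ∫ x, f x ^ 2 ∂volI ∧
    (∫ x, smoothKernel l 1 x * f x ∂volI) ^ 2 ≤ C * ∫ x, f x ^ 2 ∂volI := by
  have hK := continuous_smoothKernel l
  have hX := continuous_smoothKernelX l
  have hD := continuous_smoothKernel_diag l
  have hK1 : Continuous fun x => smoothKernel l 1 x := hK.comp (Continuous.prodMk_right 1)
  obtain ⟨M, hM0, hM⟩ := exists_bound_kernel hK
  obtain ⟨M', hM'0, hM'⟩ := exists_bound_kernel hX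
  refine ⟨2 * M ^ 2 + 2 * M' ^ 2, by positivity, fun f hf => ?_⟩
  have hf0 : 0 ≤ ∫ x, f x ^ 2 ∂volI := integral_nonneg fun x => sq_nonneg _
  have hV := integral_sq_volterra_le hK hM hf
  have hVX := integral_sq_volterra_le hX hM' hf
  have hsq : ∀ h : ℝ → ℝ, Continuous h → (∀ x ∈ Set.Icc (0 : ℝ) 1, |h x| ≤ M) →
      ∫ x, (h x * f x) ^ 2 ∂volI ≤ M ^ 2 * ∫ x, f x ^ 2 ∂volI := by
    intro h hh hb
    rw [← integral_const_mul]
    refine integral_mono_ae (memLp_continuous_mul hh hf).integrable_sq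
      (hf.integrable_sq.const_mul _) ?_
    filter_upwards [ae_mem_volI] with x hx
    rw [mul_pow]
    have := sq_le_sq.2 ((hb x (Set.Ioo_subset_Icc_self hx)).trans (le_abs_self M))
    gcongr
  refine ⟨?_, ?_, ?_⟩
  · nlinarith [mul_nonneg (sq_nonneg M) hf0, mul_nonneg (sq_nonneg M') hf0]
  · have h1 := integral_sq_add_le (memLp_continuous_mul hD hf) (memLp_volterra hX hf)
    have h2 := hsq _ hD fun x hx => hM x hx x hx
    linarith
  · have h1 := sq_integral_mul_le (memLp_continuous_mul hK1 hf)
      (memLp_of_continuous (f := fun _ => (1 : ℝ)) continuous_const)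
    simp only [mul_one, one_pow, integral_const, probReal_univ, smul_eq_mul] at h1
    have h2 := hsq _ hK1 fun x hx => hM 1 (by simp) x hx
    nlinarith [mul_nonneg (sq_nonneg M) hf0, mul_nonneg (sq_nonneg M') hf0]

/-- The backstepping feedback is controlled by the adjoint coefficients. -/
theorem exists_sq_feedback_le (l : ℝ) : ∃ C : ℝ, 0 < C ∧ ∀ f : ℝ → ℝ, MemLp f 2 volI →
    (∫ x, smoothKernel l 1 x * f x ∂volI) ^ 2 ≤ C * ∑' i, dualCoeff l f i ^ 2 := by
  obtain ⟨C₁, h₁, H₁⟩ := exists_integral_sq_le (l := l)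
  obtain ⟨C₂, h₂, H₂⟩ := exists_integral_sq_le_backstep l
  refine ⟨C₁ * (C₂ * 2), by positivity, fun f hf => ?_⟩
  have h := (hasSum_sq_dualCoeff l hf).tsum_eq
  rw [tsum_mul_left] at h
  calc _ ≤ C₁ * ∫ x, f x ^ 2 ∂volI := (H₁ f hf).2.2
    _ ≤ C₁ * (C₂ * ∫ x, backstep l f x ^ 2 ∂volI) := by gcongr; exact H₂ f hf
    _ = _ := by rw [← h]; ring

/-- The `H¹` norm of a function that satisfies the backstepping feedback relation is equivalent to
a weighted `ℓ²` norm of its adjoint coefficients. -/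
theorem exists_backstep_equiv (l : ℝ) : ∃ C : ℝ, 0 < C ∧ ∀ f g : ℝ → ℝ, MemLp f 2 volI →
    MemLp g 2 volI → BackstepRelation l f g →
    Summable (fun i : ℕ => (1 + (i * Real.pi) ^ 2) * dualCoeff l f i ^ 2) ∧
    ∫ x, f x ^ 2 ∂volI + ∫ x, g x ^ 2 ∂volI
      ≤ C * ∑' i : ℕ, (1 + (i * Real.pi) ^ 2) * dualCoeff l f i ^ 2 ∧
    ∑' i : ℕ, (1 + (i * Real.pi) ^ 2) * dualCoeff l f i ^ 2
      ≤ C * (∫ x, f x ^ 2 ∂volI + ∫ x, g x ^ 2 ∂volI) := by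
  obtain ⟨C₁, h₁, H₁⟩ := exists_integral_sq_le (l := l)
  obtain ⟨C₂, h₂, H₂⟩ := exists_integral_sq_le_backstep l
  refine ⟨2 * C₂ + 4 * C₁ * C₂ + 4 + (1 + 2 * C₁), by positivity, fun f g hf hg hR => ?_⟩
  obtain ⟨hV, hX, -⟩ := H₁ f hf
  have hB := H₂ f hf
  have s1 := hasSum_sq_dualCoeff l hf
  have s2 := hasSum_sq_mul_dualCoeff l hf hg hR
  have s : HasSum (fun i : ℕ => (1 + (i * Real.pi) ^ 2) * dualCoeff l f i ^ 2)
      ((∫ x, backstep l f x ^ 2 ∂volI + ∫ x, backstepDeriv l f g x ^ 2 ∂volI) * (1 / 2)) := by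
    convert! (s1.add s2).mul_right (1 / 2) using 1
    ext i; ring
  have mV := memLp_volterra (continuous_smoothKernel l) hf
  have mX := (memLp_continuous_mul (continuous_smoothKernel_diag l) hf).add
      (memLp_volterra (continuous_smoothKernelX l) hf)
  have hw : ∫ x, backstep l f x ^ 2 ∂volI ≤ (2 + 2 * C₁) * ∫ x, f x ^ 2 ∂volI := by
    have := integral_sq_add_le hf mV.neg
    simp only [Pi.neg_apply, neg_sq, ← sub_eq_add_neg] at this
    change ∫ x, backstep l f x ^ 2 ∂volI ≤ _ at this
    linarith
  have hG : ∫ x, backstepDeriv l f g x ^ 2 ∂volI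
      ≤ 2 * ∫ x, g x ^ 2 ∂volI + 2 * C₁ * ∫ x, f x ^ 2 ∂volI := by
    have := integral_sq_add_le hg mX.neg
    simp only [Pi.neg_apply, neg_sq, ← sub_eq_add_neg, Pi.add_apply] at this
    change ∫ x, backstepDeriv l f g x ^ 2 ∂volI ≤ _ at this
    linarith
  have hg' : ∫ x, g x ^ 2 ∂volI
      ≤ 2 * ∫ x, backstepDeriv l f g x ^ 2 ∂volI + 2 * C₁ * ∫ x, f x ^ 2 ∂volI := by
    have := integral_sq_add_le (memLp_backstepDeriv l hf hg) mX
    simp only [Pi.add_apply, backstepDeriv, sub_add_cancel] at this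
    change ∫ x, g x ^ 2 ∂volI ≤ 2 * ∫ x, backstepDeriv l f g x ^ 2 ∂volI + _ at this
    linarith
  have f0 : 0 ≤ ∫ x, f x ^ 2 ∂volI := integral_nonneg fun x => sq_nonneg _
  have g0 : 0 ≤ ∫ x, g x ^ 2 ∂volI := integral_nonneg fun x => sq_nonneg _
  have w0 : 0 ≤ ∫ x, backstep l f x ^ 2 ∂volI := integral_nonneg fun x => sq_nonneg _
  have G0 : 0 ≤ ∫ x, backstepDeriv l f g x ^ 2 ∂volI := integral_nonneg fun x => sq_nonneg _
  refine ⟨s.summable, ?_, ?_⟩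
  · rw [s.tsum_eq]
    have a1 := mul_nonneg h₁.le w0
    have a2 := mul_nonneg h₂.le G0
    have a3 := mul_nonneg h₁.le G0
    have a4 := mul_nonneg (mul_nonneg h₁.le h₂.le) G0
    have a5 := mul_le_mul_of_nonneg_left hB (by positivity : 0 ≤ 1 + 2 * C₁)
    nlinarith
  · rw [s.tsum_eq]
    have a1 := mul_nonneg h₁.le f0
    have a2 := mul_nonneg h₂.le f0
    have a3 := mul_nonneg h₁.le g0
    have a4 := mul_nonneg (mul_nonneg h₁.le h₂.le) g0
    have a5 := mul_nonneg h₂.le g0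
    have a6 := mul_nonneg (mul_nonneg h₁.le h₂.le) f0
    nlinarith

/-- `1 - e^{-a}` lies between `0` and both `1` and `a`, so its square is at most `1 · a`. Keeping
only one power of `a` trades time regularity for weights: Hölder order `1/2` costs one power of the
decay rate. -/
theorem sq_one_sub_exp_neg_le {a : ℝ} (ha : 0 ≤ a) : (1 - Real.exp (-a)) ^ 2 ≤ a := by
  have h1 : Real.exp (-a) ≤ 1 := Real.exp_le_one_iff.2 (by linarith)
  have h2 : 1 - a ≤ Real.exp (-a) := by linarith [Real.add_one_le_exp (-a)]
  have h3 := Real.exp_pos (-a)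
  nlinarith

/-- Decay of a mode whose adjoint coefficients decay at the rates `ε ((i π)² + (n π)²) + c`, and
Hölder continuity in time of the corresponding feedback. -/
theorem exists_low_mode_bound (l : ℝ) {ε c : ℝ} (hε : 0 < ε) (hc : 0 < c) (n : ℕ) :
    ∃ C : ℝ, 0 < C ∧ ∀ f g : ℝ → ℝ → ℝ, (∀ t, 0 ≤ t → MemLp (f t) 2 volI) →
    (∀ t, 0 ≤ t → MemLp (g t) 2 volI) → (∀ t, 0 ≤ t → BackstepRelation l (f t) (g t)) →
    (∀ t, 0 ≤ t → ∀ i : ℕ, dualCoeff l (f t) i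
      = Real.exp (-((ε * ((i * Real.pi) ^ 2 + (n * Real.pi) ^ 2) + c) * t))
        * dualCoeff l (f 0) i) →
    (∀ t, 0 ≤ t → ∫ x, f t x ^ 2 ∂volI + ∫ x, g t x ^ 2 ∂volI
      ≤ C * Real.exp (-(2 * c * t)) * (∫ x, f 0 x ^ 2 ∂volI + ∫ x, g 0 x ^ 2 ∂volI)) ∧
    (∀ t, 0 ≤ t → (∫ x, smoothKernel l 1 x * f t x ∂volI) ^ 2
      ≤ C * Real.exp (-(2 * c * t)) * (∫ x, f 0 x ^ 2 ∂volI + ∫ x, g 0 x ^ 2 ∂volI)) ∧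
    (∀ s t, 0 ≤ s → s ≤ t →
      (∫ x, smoothKernel l 1 x * f t x ∂volI - ∫ x, smoothKernel l 1 x * f s x ∂volI) ^ 2
      ≤ C * (t - s) * Real.exp (-(2 * c * s))
        * (∫ x, f 0 x ^ 2 ∂volI + ∫ x, g 0 x ^ 2 ∂volI)) := by
  obtain ⟨C₁, h₁, H₁⟩ := exists_backstep_equiv l
  obtain ⟨C₂, h₂, H₂⟩ := exists_sq_feedback_le l
  set A : ℝ := ε * (1 + (n * Real.pi) ^ 2) + c with hA
  have hA0 : 0 < A := by positivity
  refine ⟨C₁ * C₁ + C₂ * C₁ + C₂ * A * C₁, by positivity, fun f g hf hg hR hD => ?_⟩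
  set ν : ℕ → ℝ := fun i => ε * ((i * Real.pi) ^ 2 + (n * Real.pi) ^ 2) + c with hν
  set E := ∫ x, f 0 x ^ 2 ∂volI + ∫ x, g 0 x ^ 2 ∂volI with hE
  set S : ℕ → ℝ := fun i => (1 + (i * Real.pi) ^ 2) * dualCoeff l (f 0) i ^ 2 with hS
  have hE0 : 0 ≤ E := add_nonneg (integral_nonneg fun x => sq_nonneg _)
    (integral_nonneg fun x => sq_nonneg _)
  obtain ⟨sum0, -, hS0⟩ := H₁ (f 0) (g 0) (hf 0 le_rfl) (hg 0 le_rfl) (hR 0 le_rfl)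
  change ∑' i, S i ≤ C₁ * E at hS0
  have hexp : ∀ t, 0 ≤ t → ∀ i, Real.exp (-(ν i * t)) ^ 2 ≤ Real.exp (-(2 * c * t)) := by
    intro t ht i
    rw [← Real.exp_nat_mul]
    refine Real.exp_le_exp.2 ?_
    have : c ≤ ν i := le_add_of_nonneg_left (by positivity)
    push_cast
    nlinarith [mul_le_mul_of_nonneg_right this ht]
  have hdec : ∀ t, 0 ≤ t → ∀ i, dualCoeff l (f t) i ^ 2
      ≤ Real.exp (-(2 * c * t)) * dualCoeff l (f 0) i ^ 2 := by
    intro t ht i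
    rw [hD t ht i, mul_pow]
    exact mul_le_mul_of_nonneg_right (hexp t ht i) (sq_nonneg _)
  have hle : ∀ t, 0 ≤ t → ∑' i : ℕ, (1 + (i * Real.pi) ^ 2) * dualCoeff l (f t) i ^ 2
      ≤ Real.exp (-(2 * c * t)) * (C₁ * E) := by
    intro t ht
    calc _ ≤ ∑' i, Real.exp (-(2 * c * t)) * S i := by
          refine Summable.tsum_le_tsum (fun i => ?_)
            (H₁ (f t) (g t) (hf t ht) (hg t ht) (hR t ht)).1 (sum0.mul_left _)
          have := mul_le_mul_of_nonneg_left (hdec t ht i)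
            (by positivity : 0 ≤ 1 + (i * Real.pi) ^ 2)
          rw [hS]; dsimp only; linarith
      _ ≤ _ := by rw [tsum_mul_left]; gcongr
  refine ⟨fun t ht => ?_, fun t ht => ?_, fun s t hs hst => ?_⟩
  · have h := (H₁ (f t) (g t) (hf t ht) (hg t ht) (hR t ht)).2.1
    calc _ ≤ C₁ * (Real.exp (-(2 * c * t)) * (C₁ * E)) := h.trans (by gcongr; exact hle t ht)
      _ = (C₁ * C₁) * Real.exp (-(2 * c * t)) * E := by ring
      _ ≤ _ := by
        gcongr
        have := mul_pos h₂ h₁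
        have := mul_pos (mul_pos h₂ hA0) h₁
        linarith
  · have h := H₂ (f t) (hf t ht)
    have hle' : ∑' i : ℕ, dualCoeff l (f t) i ^ 2 ≤ Real.exp (-(2 * c * t)) * (C₁ * E) := by
      refine le_trans ?_ (hle t ht)
      refine Summable.tsum_le_tsum (fun i => ?_) ?_
        (H₁ (f t) (g t) (hf t ht) (hg t ht) (hR t ht)).1
      · nlinarith [mul_nonneg (sq_nonneg (i * Real.pi)) (sq_nonneg (dualCoeff l (f t) i))]
      · have := (hasSum_sq_dualCoeff l (hf t ht)).summable.mul_left (1 / 2)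
        refine this.congr fun i => by ring
    calc _ ≤ C₂ * (Real.exp (-(2 * c * t)) * (C₁ * E)) := h.trans (by gcongr)
      _ = (C₂ * C₁) * Real.exp (-(2 * c * t)) * E := by ring
      _ ≤ _ := by
        gcongr
        have := mul_pos h₁ h₁
        have := mul_pos (mul_pos h₂ hA0) h₁
        linarith
  · have ht : 0 ≤ t := hs.trans hst
    have hsub : MemLp (fun x => f t x - f s x) 2 volI := (hf t ht).sub (hf s hs)
    have hK1 : Continuous fun x => smoothKernel l 1 x :=
      (continuous_smoothKernel l).comp (Continuous.prodMk_right 1)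
    have h := H₂ _ hsub
    have e1 : ∫ x, smoothKernel l 1 x * (f t x - f s x) ∂volI
        = ∫ x, smoothKernel l 1 x * f t x ∂volI - ∫ x, smoothKernel l 1 x * f s x ∂volI := by
      rw [← integral_sub ((memLp_continuous_mul hK1 (hf t ht)).integrable one_le_two)
        ((memLp_continuous_mul hK1 (hf s hs)).integrable one_le_two)]
      congr 1; ext x; ring
    have e2 : ∀ i, dualCoeff l (fun x => f t x - f s x) i
        = dualCoeff l (f t) i - dualCoeff l (f s) i := by
      intro i
      have hp := (contDiff_dualMode l i).continuous
      rw [dualCoeff, dualCoeff, dualCoeff, ← integral_sub (integrable_mul_continuous (hf t ht) hp)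
        (integrable_mul_continuous (hf s hs) hp)]
      congr 1; ext x; ring
    rw [e1] at h
    have hterm : ∀ i, dualCoeff l (fun x => f t x - f s x) i ^ 2
        ≤ (t - s) * Real.exp (-(2 * c * s)) * A * S i := by
      intro i
      rw [e2, hD t ht i, hD s hs i]
      change (Real.exp (-(ν i * t)) * _ - Real.exp (-(ν i * s)) * _) ^ 2 ≤ _
      have e3 : Real.exp (-(ν i * t)) = Real.exp (-(ν i * s)) * Real.exp (-(ν i * (t - s))) := by
        rw [← Real.exp_add]; congr 1; ring
      have hν0 : 0 ≤ ν i := by simp only [hν]; positivity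
      -- The single power of the rate is exactly what the `H¹` weight of the initial coefficients
      -- can pay for.
      have hνA : ν i ≤ A * (1 + (i * Real.pi) ^ 2) := by
        simp only [hν, hA]
        have p1 : 0 ≤ (i * Real.pi) ^ 2 := sq_nonneg _
        have p2 : 0 ≤ (n * Real.pi) ^ 2 := sq_nonneg _
        have := mul_nonneg hε.le (mul_nonneg p1 p2)
        have := mul_nonneg hc.le p1
        nlinarith
      have h4 := sq_one_sub_exp_neg_le (mul_nonneg hν0 (sub_nonneg.2 hst))
      calc _ = Real.exp (-(ν i * s)) ^ 2 * (1 - Real.exp (-(ν i * (t - s)))) ^ 2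
            * dualCoeff l (f 0) i ^ 2 := by rw [e3]; ring
        _ ≤ Real.exp (-(2 * c * s)) * (ν i * (t - s)) * dualCoeff l (f 0) i ^ 2 := by
            gcongr
            exact hexp s hs i
        _ ≤ Real.exp (-(2 * c * s)) * (A * (1 + (i * Real.pi) ^ 2) * (t - s))
            * dualCoeff l (f 0) i ^ 2 := by
            have := sub_nonneg.2 hst
            gcongr
        _ = _ := by rw [hS]; ring
    have hsum : ∑' i, dualCoeff l (fun x => f t x - f s x) i ^ 2
        ≤ (t - s) * Real.exp (-(2 * c * s)) * A * (C₁ * E) := by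
      have hst' := sub_nonneg.2 hst
      calc _ ≤ ∑' i, (t - s) * Real.exp (-(2 * c * s)) * A * S i :=
            Summable.tsum_le_tsum hterm (Summable.of_nonneg_of_le (fun i => sq_nonneg _) hterm
              (sum0.mul_left _)) (sum0.mul_left _)
        _ ≤ _ := by rw [tsum_mul_left]; gcongr
    calc _ ≤ C₂ * ((t - s) * Real.exp (-(2 * c * s)) * A * (C₁ * E)) :=
          h.trans (by gcongr)
      _ = (C₂ * A * C₁) * (t - s) * Real.exp (-(2 * c * s)) * E := by ring
      _ ≤ _ := by
        have hst' := sub_nonneg.2 hst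
        gcongr
        have := mul_pos h₁ h₁
        have := mul_pos h₂ h₁
        linarith

/-! ### Modes driven through the boundary -/

theorem hasDerivWithinAt_of_integral_eq {y φ : ℝ → ℝ} (hφ : ContinuousOn φ (Set.Ici 0))
    (hy : ∀ t, 0 ≤ t → y t = y 0 + ∫ s in (0 : ℝ)..t, φ s) {t : ℝ} (ht : 0 ≤ t) :
    HasDerivWithinAt y (φ t) (Set.Ici 0) t := by
  -- Freezing `φ` at negative times gives a function continuous on all of `ℝ`, to which the
  -- fundamental theorem of calculus applies.
  have hc : Continuous fun s => φ (max s 0) :=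
    hφ.comp_continuous (by fun_prop) fun s => le_max_right s 0
  have h := (hc.integral_hasStrictDerivAt 0 t).hasDerivAt.const_add (y 0)
  have h2 := h.hasDerivWithinAt (s := Set.Ici 0)
  rw [max_eq_left ht] at h2
  refine h2.congr (fun s hs => ?_) ?_
  · rw [hy s hs]
    congr 1
    refine intervalIntegral.integral_congr fun r hr => ?_
    rw [Set.uIcc_of_le hs] at hr
    simp [max_eq_left hr.1]
  · rw [hy t ht]
    congr 1
    refine intervalIntegral.integral_congr fun r hr => ?_
    rw [Set.uIcc_of_le ht] at hr
    simp [max_eq_left hr.1]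

theorem eq_exp_mul_of_integral_eq {y : ℝ → ℝ} {ν : ℝ} (hc : ContinuousOn y (Set.Ici 0))
    (hy : ∀ t, 0 ≤ t → y t = y 0 + ∫ s in (0 : ℝ)..t, -ν * y s) {t : ℝ} (ht : 0 ≤ t) :
    y t = Real.exp (-(ν * t)) * y 0 := by
  have hd : ∀ s, 0 ≤ s → HasDerivWithinAt y (-ν * y s) (Set.Ici 0) s := fun s hs =>
    hasDerivWithinAt_of_integral_eq (φ := fun s => -ν * y s) (continuousOn_const.mul hc) hy hs
  have hz : ∀ s ∈ Set.Icc 0 t, Real.exp (ν * s) * y s = Real.exp (ν * 0) * y 0 := by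
    refine constant_of_has_deriv_right_zero ?_ ?_
    · exact (by fun_prop : Continuous fun s : ℝ => Real.exp (ν * s)).continuousOn.mul
        (hc.mono Set.Icc_subset_Ici_self)
    · intro s hs
      have h1 : HasDerivAt (fun s : ℝ => Real.exp (ν * s)) (Real.exp (ν * s) * (ν * 1)) s :=
        ((hasDerivAt_id s).const_mul ν).exp
      refine (h1.hasDerivWithinAt.mul ((hd s hs.1).mono (Set.Ici_subset_Ici.2 hs.1))).congr_deriv ?_
      ring
  have h := hz t ⟨ht, le_rfl⟩
  simp only [mul_zero, Real.exp_zero, one_mul] at h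
  rw [← h, ← mul_assoc, ← Real.exp_add]
  simp

/-- Uses `√a ≤ a + 1 ≤ e^a` with `a = δ t`. It absorbs the growth `√T` of the Hölder bound between
the times `0` and `T`. -/
theorem sqrt_mul_exp_neg_le {δ t : ℝ} (hδ : 0 < δ) (ht : 0 ≤ t) :
    Real.sqrt t * Real.exp (-(δ * t)) ≤ 1 / Real.sqrt δ := by
  rw [le_div_iff₀ (Real.sqrt_pos.2 hδ)]
  have hs : Real.sqrt t * Real.sqrt δ = Real.sqrt (δ * t) := by
    rw [mul_comm, ← Real.sqrt_mul hδ.le]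
  have h0 : 0 ≤ δ * t := by positivity
  have h1 : Real.sqrt (δ * t) ≤ Real.exp (δ * t) := by
    have h2 : Real.sqrt (δ * t) ≤ δ * t + 1 := by
      rw [Real.sqrt_le_left (by positivity)]
      nlinarith
    linarith [Real.add_one_le_exp (δ * t)]
  calc Real.sqrt t * Real.exp (-(δ * t)) * Real.sqrt δ
      = Real.sqrt (δ * t) * Real.exp (-(δ * t)) := by rw [← hs]; ring
    _ ≤ Real.exp (δ * t) * Real.exp (-(δ * t)) := by gcongr
    _ = 1 := by rw [← Real.exp_add]; simp

/-- A stable scalar equation with a Hölder continuous input follows its quasi-stationary state. -/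
theorem abs_quasistationary_le {y U : ℝ → ℝ} {σ ρ c R : ℝ} (hc : 0 < c) (hσ : c < σ) (hR : 0 ≤ R)
    (hyc : ContinuousOn y (Set.Ici 0)) (hUc : ContinuousOn U (Set.Ici 0))
    (hy : ∀ t, 0 ≤ t → y t = y 0 + ∫ s in (0 : ℝ)..t, (-σ * y s - ρ * U s))
    (hU : ∀ s t, 0 ≤ s → s ≤ t → |U t - U s| ≤ R * Real.sqrt (t - s) * Real.exp (-(c * s)))
    {T : ℝ} (hT : 0 ≤ T) :
    |y T + ρ / σ * U T| ≤ Real.exp (-(c * T)) *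
      (|y 0 + ρ / σ * U 0| + 2 * |ρ| * R / ((σ - c) * Real.sqrt (σ - c))) := by
  set δ := σ - c with hδ
  have hδ0 : 0 < δ := sub_pos.2 hσ
  have hσ0 : 0 < σ := hc.trans hσ
  set q := Real.sqrt δ with hq
  have hq0 : 0 < q := Real.sqrt_pos.2 hδ0
  have hqq : q * q = δ := Real.mul_self_sqrt hδ0.le
  -- `U` need not be differentiable, so the input is frozen at the final time: `Y' = -σ Y + ρ (U T -
  -- U s)`, and the Hölder bound controls the forcing.
  set Y : ℝ → ℝ := fun s => y s + ρ / σ * U T with hY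
  have hd : ∀ s, 0 ≤ s → HasDerivWithinAt y (-σ * y s - ρ * U s) (Set.Ici 0) s := fun s hs =>
    hasDerivWithinAt_of_integral_eq (φ := fun s => -σ * y s - ρ * U s)
      ((continuousOn_const.mul hyc).sub (continuousOn_const.mul hUc)) hy hs
  -- The majorant is the solution of the comparison problem after linearising `√(T - s) ≤ 1/(2q) +
  -- (q/2)(T - s)`. Its derivative is exactly `e^{δs}` times this linear bound, up to the factor
  -- `|ρ| R`, and the term in `T - s` vanishes at `s = T`.
  have key : ∀ s ∈ Set.Icc 0 T, ‖Real.exp (σ * s) * Y s - Y 0‖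
      ≤ |ρ| * R * (Real.exp (δ * s) * (1 / (δ * q) + 1 / (2 * q) * (T - s))) := by
    refine fun s hs => image_norm_le_of_norm_deriv_right_le_deriv_boundary
      (f := fun s => Real.exp (σ * s) * Y s - Y 0)
      (f' := fun s => Real.exp (σ * s) * (ρ * (U T - U s)))
      (B := fun s => |ρ| * R * (Real.exp (δ * s) * (1 / (δ * q) + 1 / (2 * q) * (T - s))))
      (B' := fun s => |ρ| * R * (Real.exp (δ * s) * (1 / (2 * q) + q / 2 * (T - s))))
      ?_ ?_ ?_ ?_ ?_ hs
    · refine ContinuousOn.sub (ContinuousOn.mul ?_ ?_) continuousOn_const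
      · exact (by fun_prop : Continuous fun s : ℝ => Real.exp (σ * s)).continuousOn
      · exact (hyc.mono Set.Icc_subset_Ici_self).add continuousOn_const
    · intro s hs
      have h1 : HasDerivAt (fun s : ℝ => Real.exp (σ * s)) (Real.exp (σ * s) * (σ * 1)) s :=
        ((hasDerivAt_id s).const_mul σ).exp
      have h2 := ((hd s hs.1).mono (Set.Ici_subset_Ici.2 hs.1)).add_const (ρ / σ * U T)
      refine ((h1.hasDerivWithinAt.mul h2).sub_const (Y 0)).congr_deriv ?_
      field_simp
      ring
    · simp only [mul_zero, Real.exp_zero, one_mul, sub_self, norm_zero, sub_zero]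
      positivity
    · intro s
      have h1 : HasDerivAt (fun s : ℝ => Real.exp (δ * s)) (Real.exp (δ * s) * (δ * 1)) s :=
        ((hasDerivAt_id s).const_mul δ).exp
      have h2 : HasDerivAt (fun s : ℝ => 1 / (δ * q) + 1 / (2 * q) * (T - s))
          (1 / (2 * q) * (-1)) s :=
        (((hasDerivAt_id s).const_sub T).const_mul _).const_add _
      refine ((h1.mul h2).const_mul (|ρ| * R)).congr_deriv ?_
      rw [← hqq]
      field_simp
      ring
    · intro s hs
      have hUs := hU s T hs.1 hs.2.le
      have hTs : 0 ≤ T - s := sub_nonneg.2 hs.2.le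
      have hsq : Real.sqrt (T - s) ≤ 1 / (2 * q) + q / 2 * (T - s) := by
        have h1 := Real.sq_sqrt hTs
        have h2 : 1 / (2 * q) + q / 2 * (T - s) - Real.sqrt (T - s)
            = (1 - q * Real.sqrt (T - s)) ^ 2 / (2 * q) := by
          rw [sub_sq, mul_pow, h1]; field_simp; ring
        have h3 : 0 ≤ (1 - q * Real.sqrt (T - s)) ^ 2 / (2 * q) := by positivity
        linarith
      rw [norm_mul, norm_mul, Real.norm_eq_abs, Real.norm_eq_abs, Real.norm_eq_abs, Real.abs_exp]
      calc Real.exp (σ * s) * (|ρ| * |U T - U s|)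
          ≤ Real.exp (σ * s) * (|ρ| * (R * Real.sqrt (T - s) * Real.exp (-(c * s)))) := by gcongr
        _ = |ρ| * R * ((Real.exp (σ * s) * Real.exp (-(c * s))) * Real.sqrt (T - s)) := by ring
        _ = |ρ| * R * (Real.exp (δ * s) * Real.sqrt (T - s)) := by
            rw [← Real.exp_add]; congr 4; rw [hδ]; ring
        _ ≤ _ := by gcongr
  have hT' := key T ⟨hT, le_rfl⟩
  rw [sub_self, mul_zero, add_zero, Real.norm_eq_abs] at hT'
  have hexp : Real.exp (-(σ * T)) * Real.exp (σ * T) = 1 := by rw [← Real.exp_add]; simp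
  have hexp2 : Real.exp (-(σ * T)) = Real.exp (-(c * T)) * Real.exp (-(δ * T)) := by
    rw [← Real.exp_add]; congr 1; rw [hδ]; ring
  have hexp3 : Real.exp (-(δ * T)) * Real.exp (δ * T) = 1 := by rw [← Real.exp_add]; simp
  have hY0 : |Y 0| ≤ |y 0 + ρ / σ * U 0| + |ρ| * R / σ * Real.sqrt T := by
    have e : Y 0 = (y 0 + ρ / σ * U 0) + ρ / σ * (U T - U 0) := by simp only [hY]; ring
    have h0 := hU 0 T le_rfl hT
    rw [sub_zero, mul_zero, neg_zero, Real.exp_zero, mul_one] at h0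
    rw [e]
    refine (abs_add_le _ _).trans ?_
    gcongr
    rw [abs_mul, abs_div, abs_of_pos hσ0]
    calc |ρ| / σ * |U T - U 0| ≤ |ρ| / σ * (R * Real.sqrt T) := by gcongr
      _ = _ := by ring
  have hYT : |Y T| ≤ Real.exp (-(σ * T)) * (|Y 0| + |ρ| * R * (Real.exp (δ * T) * (1 / (δ * q)))) := by
    have e : Y T = Real.exp (-(σ * T)) * (Y 0 + (Real.exp (σ * T) * Y T - Y 0)) := by
      rw [add_sub_cancel, ← mul_assoc, hexp, one_mul]
    rw [e, abs_mul, Real.abs_exp]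
    gcongr
    exact (abs_add_le _ _).trans (by gcongr)
  have hsq := sqrt_mul_exp_neg_le hδ0 hT
  have h1 : Real.exp (-(δ * T)) ≤ 1 := Real.exp_le_one_iff.2 (by nlinarith)
  calc |Y T| ≤ Real.exp (-(σ * T)) *
        ((|y 0 + ρ / σ * U 0| + |ρ| * R / σ * Real.sqrt T)
          + |ρ| * R * (Real.exp (δ * T) * (1 / (δ * q)))) := hYT.trans (by gcongr)
    _ = Real.exp (-(c * T)) * (Real.exp (-(δ * T)) * |y 0 + ρ / σ * U 0|
        + |ρ| * R / σ * (Real.sqrt T * Real.exp (-(δ * T)))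
        + |ρ| * R * (Real.exp (-(δ * T)) * Real.exp (δ * T)) * (1 / (δ * q))) := by
        rw [hexp2]; ring
    _ ≤ Real.exp (-(c * T)) * (1 * |y 0 + ρ / σ * U 0| + |ρ| * R / δ * (1 / q)
        + |ρ| * R * 1 * (1 / (δ * q))) := by
        rw [hexp3]
        have : δ ≤ σ := by linarith
        gcongr
    _ = _ := by field_simp; ring

/-- Each term is dominated by a difference of `4 n² / (n + J)`, since `(n + J)(n + J + 1) ≤ 4 (J² +
n²)`, and the differences telescope. The linear order in `n` produces the weight `n` in front of
`U²`. -/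
theorem sum_range_sq_div_le {n : ℕ} (hn : 1 ≤ n) (J : ℕ) :
    ∑ j ∈ Finset.range J, (n : ℝ) ^ 2 / ((j : ℝ) ^ 2 + (n : ℝ) ^ 2)
      ≤ 4 * n - 4 * n ^ 2 / (n + J) := by
  have hn' : (1 : ℝ) ≤ n := by exact_mod_cast hn
  induction J with
  | zero => simp; field_simp; simp
  | succ J ih =>
    rw [Finset.sum_range_succ]
    have hJ : (0 : ℝ) ≤ J := Nat.cast_nonneg J
    have h : (n : ℝ) ^ 2 / ((J : ℝ) ^ 2 + (n : ℝ) ^ 2)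
        ≤ 4 * n ^ 2 / (n + J) - 4 * n ^ 2 / (n + (J + 1)) := by
      rw [div_sub_div _ _ (by positivity) (by positivity), div_le_div_iff₀ (by positivity)
        (by positivity)]
      have h2 : ((n : ℝ) + J) * (n + (J + 1)) ≤ 4 * (J ^ 2 + n ^ 2) := by
        nlinarith [sq_nonneg ((n : ℝ) - J)]
      have h3 : 4 * (n : ℝ) ^ 2 * (n + (J + 1)) - (n + J) * (4 * n ^ 2) = 4 * n ^ 2 := by ring
      rw [h3]
      nlinarith [sq_nonneg (n : ℝ)]
    push_cast
    linarith

theorem tsum_sq_div_le {n : ℕ} (hn : 1 ≤ n) :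
    Summable (fun j : ℕ => (n : ℝ) ^ 2 / ((j : ℝ) ^ 2 + (n : ℝ) ^ 2)) ∧
    ∑' j : ℕ, (n : ℝ) ^ 2 / ((j : ℝ) ^ 2 + (n : ℝ) ^ 2) ≤ 4 * n := by
  have h0 : ∀ j : ℕ, 0 ≤ (n : ℝ) ^ 2 / ((j : ℝ) ^ 2 + (n : ℝ) ^ 2) := fun j => by positivity
  have hb : ∀ J, ∑ j ∈ Finset.range J, (n : ℝ) ^ 2 / ((j : ℝ) ^ 2 + (n : ℝ) ^ 2) ≤ 4 * n :=
    fun J => (sum_range_sq_div_le hn J).trans (sub_le_self _ (by positivity))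
  exact ⟨summable_of_sum_range_le h0 hb, Real.tsum_le_of_sum_range_le h0 hb⟩

section

variable {n : ℕ} {b : ℕ → ℝ} {U F G : ℝ}

/-- Here `b j` are the sine coefficients of a mode with boundary value `U` at `1`, while `j π b j +
(-1)^j U` are the cosine coefficients of its derivative; `F` and `G` stand for the squared `L²`
norms. The summand `U²` is the doubled index `0` of the cosine series, the mean of the derivative
being `U`. -/
theorem hasSum_mode_energy (hF : HasSum (fun j => 2 * b j ^ 2) F)
    (hG : HasSum (fun j : ℕ => 2 * (j * Real.pi * b j + (-1) ^ j * U) ^ 2) (G + U ^ 2)) :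
    HasSum (fun j : ℕ => (j * Real.pi * b j + (-1) ^ j * U) ^ 2 + (n * Real.pi) ^ 2 * b j ^ 2)
      (((n * Real.pi) ^ 2 * F + G + U ^ 2) / 2) := by
  convert! (hG.mul_left (1 / 2)).add (hF.mul_left ((n * Real.pi) ^ 2 / 2)) using 1
  · ext j; ring
  · ring

/-- The trace inequality for a single mode. -/
theorem mul_sq_trace_le (hF : HasSum (fun j => 2 * b j ^ 2) F)
    (hG : HasSum (fun j : ℕ => 2 * (j * Real.pi * b j + (-1) ^ j * U) ^ 2) (G + U ^ 2)) :
    n * U ^ 2 ≤ (n * Real.pi) ^ 2 * F + G := by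
  have h := hasSum_mode_energy (n := n) hF hG
  have h1 := sum_le_hasSum (Finset.range (n + 1)) (fun j _ => by positivity) h
  -- For `j ≤ n` the second square dominates `(j π b j)²`, so each summand is at least `U² / 2`.
  -- There are `n + 1` of them, and the additional one pays for the `U²` in the total.
  have h2 : ∑ j ∈ Finset.range (n + 1), U ^ 2 / 2 ≤ ∑ j ∈ Finset.range (n + 1),
      (((j * Real.pi * b j + (-1) ^ j * U) ^ 2 + (n * Real.pi) ^ 2 * b j ^ 2)) := by
    refine Finset.sum_le_sum fun j hj => ?_
    have hjn : (j : ℝ) ≤ n := by exact_mod_cast Nat.lt_succ_iff.1 (Finset.mem_range.1 hj)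
    have hj2 : (j * Real.pi * b j) ^ 2 ≤ (n * Real.pi) ^ 2 * b j ^ 2 := by
      rw [mul_pow (_ * _)]; gcongr
    have hs : ((-1 : ℝ) ^ j * U) ^ 2 = U ^ 2 := by
      rw [mul_pow, ← pow_mul, mul_comm j 2, pow_mul]; norm_num
    nlinarith [sq_nonneg (2 * (j * Real.pi * b j) + (-1) ^ j * U)]
  rw [Finset.sum_const, Finset.card_range, nsmul_eq_mul] at h2
  push_cast at h2
  linarith

end

section

variable {ε lam c κ μ mj mn s : ℝ}

/-- Comparison of the energy of a mode with the energy of its deviation from the quasi-stationary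
state. -/
theorem mode_energy_compare (hε : 0 < ε) (hlam : 0 < lam) (hc : 0 < c) (hκ : 0 < κ)
    (hs : s ^ 2 = 1) (hmn : 0 < mn) (h0 : lam ≤ ε * mn ^ 2)
    (hgap : κ * (mj ^ 2 + mn ^ 2) ≤ ε * (mj ^ 2 + mn ^ 2) - lam - c) (b U : ℝ) :
    (mj * b + s * U) ^ 2 + mn ^ 2 * b ^ 2
      ≤ 2 * ((mj ^ 2 + mn ^ 2) * (b + ε * mj * s / (ε * (mj ^ 2 + mn ^ 2) - lam) * U) ^ 2)
        + 4 * (ε / κ) ^ 2 * (mn ^ 2 / (mj ^ 2 + mn ^ 2)) * U ^ 2 ∧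
    (mj ^ 2 + mn ^ 2) * (b + ε * mj * s / (ε * (mj ^ 2 + mn ^ 2) - lam) * U) ^ 2
      ≤ 2 * ((mj * b + s * U) ^ 2 + mn ^ 2 * b ^ 2)
        + 4 * (ε / κ) ^ 2 * (mn ^ 2 / (mj ^ 2 + mn ^ 2)) * U ^ 2 := by
  set μ := mj ^ 2 + mn ^ 2 with hμ
  have hμ0 : 0 < μ := by positivity
  set σ := ε * μ - lam with hσ
  have hσκ : κ * μ ≤ σ := by linarith
  have hσ0 : 0 < σ := lt_of_lt_of_le (by positivity) hσκ
  set β := b + ε * mj * s / σ * U with hβ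
  set θ := (ε * mn ^ 2 - lam) / σ with hθ
  -- Both components of the energy split into the part carried by the deviation `β` and the part of
  -- the stationary state with boundary value `U`.
  have e1 : mj * b + s * U = mj * β + s * U * θ := by
    rw [hβ, hθ]; field_simp; rw [hσ, hμ]; ring
  have e2 : mn * b = mn * β - s * U * (ε * mj * mn / σ) := by
    rw [hβ]; field_simp; ring
  have hsq : (1 / σ) ^ 2 ≤ (1 / (κ * μ)) ^ 2 := by gcongr
  -- The energy of the stationary state: `mn⁴ + mj² mn² = mn² μ` leaves one factor `mn² / μ`, whose
  -- sum over the frequencies is of order `n`.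
  have hP : θ ^ 2 + (ε * mj * mn / σ) ^ 2 ≤ 2 * (ε / κ) ^ 2 * (mn ^ 2 / μ) := by
    have t1 : θ ^ 2 ≤ (ε * mn ^ 2) ^ 2 * (1 / (κ * μ)) ^ 2 := by
      rw [hθ, div_eq_mul_one_div, mul_pow]
      have : (ε * mn ^ 2 - lam) ^ 2 ≤ (ε * mn ^ 2) ^ 2 :=
        pow_le_pow_left₀ (by linarith) (by linarith) 2
      gcongr
    have t2 : (ε * mj * mn / σ) ^ 2 ≤ (ε * mj * mn) ^ 2 * (1 / (κ * μ)) ^ 2 := by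
      rw [div_eq_mul_one_div, mul_pow]
      gcongr
    have t3 : (ε * mn ^ 2) ^ 2 * (1 / (κ * μ)) ^ 2 + (ε * mj * mn) ^ 2 * (1 / (κ * μ)) ^ 2
        = (ε / κ) ^ 2 * (mn ^ 2 / μ) := by
      have : mj ^ 2 = μ - mn ^ 2 := by rw [hμ]; ring
      rw [mul_pow (ε * mj), mul_pow ε mj, this]
      field_simp
      ring
    have t4 : 0 ≤ (ε / κ) ^ 2 * (mn ^ 2 / μ) := by positivity
    linarith
  have hPU := mul_le_mul_of_nonneg_right hP (sq_nonneg U)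
  have eX : mn ^ 2 * b ^ 2 = (mn * b) ^ 2 := by ring
  have sU : ∀ x : ℝ, (s * U * x) ^ 2 = U ^ 2 * x ^ 2 := by
    intro x; rw [mul_pow, mul_pow, hs, one_mul]
  have s1 := sU θ
  have s2 := sU (ε * mj * mn / σ)
  have eμ : μ * β ^ 2 = (mj * β) ^ 2 + (mn * β) ^ 2 := by rw [hμ]; ring
  rw [eX, eμ]
  have q1 : ∀ x y : ℝ, (x + y) ^ 2 ≤ 2 * x ^ 2 + 2 * y ^ 2 := fun x y => by
    nlinarith [sq_nonneg (x - y)]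
  have q2 : ∀ x y : ℝ, (x - y) ^ 2 ≤ 2 * x ^ 2 + 2 * y ^ 2 := fun x y => by
    nlinarith [sq_nonneg (x + y)]
  have r1 := q1 (mj * β) (s * U * θ)
  have r2 := q2 (mn * β) (s * U * (ε * mj * mn / σ))
  have r3 := q2 (mj * b + s * U) (s * U * θ)
  have r4 := q1 (mn * b) (s * U * (ε * mj * mn / σ))
  rw [← e1] at r1
  rw [← e2] at r2
  have e1' : mj * b + s * U - s * U * θ = mj * β := by rw [e1]; ring
  have e2' : mn * b + s * U * (ε * mj * mn / σ) = mn * β := by rw [e2]; ring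
  rw [e1'] at r3
  rw [e2'] at r4
  constructor <;> linarith

/-- Decay of the energy of one Fourier coefficient of a stable mode. -/
theorem mode_energy_decay (hε : 0 < ε) (hlam : 0 < lam) (hc : 0 < c) (hκ : 0 < κ)
    (hs : s ^ 2 = 1) (hmn : 0 < mn) (h0 : lam ≤ ε * mn ^ 2)
    (hgap : κ * (mj ^ 2 + mn ^ 2) ≤ ε * (mj ^ 2 + mn ^ 2) - lam - c) {b U : ℝ → ℝ} {R : ℝ}
    (hR : 0 ≤ R) (hbc : ContinuousOn b (Set.Ici 0)) (hUc : ContinuousOn U (Set.Ici 0))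
    (hb : ∀ t, 0 ≤ t → b t = b 0 + ∫ r in (0 : ℝ)..t,
      (-(ε * (mj ^ 2 + mn ^ 2) - lam) * b r - ε * mj * s * U r))
    (hU : ∀ r t, 0 ≤ r → r ≤ t → |U t - U r| ≤ R * Real.sqrt (t - r) * Real.exp (-(c * r)))
    {T : ℝ} (hT : 0 ≤ T) :
    (mj * b T + s * U T) ^ 2 + mn ^ 2 * b T ^ 2
      ≤ Real.exp (-(2 * c * T)) * (8 * ((mj * b 0 + s * U 0) ^ 2 + mn ^ 2 * b 0 ^ 2)
          + 16 * (ε / κ) ^ 2 * (mn ^ 2 / (mj ^ 2 + mn ^ 2)) * U 0 ^ 2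
          + 16 * (ε ^ 2 / κ ^ 3) * R ^ 2 * (1 / (mj ^ 2 + mn ^ 2)))
        + 4 * (ε / κ) ^ 2 * (mn ^ 2 / (mj ^ 2 + mn ^ 2)) * U T ^ 2 := by
  have hcmpT := (mode_energy_compare hε hlam hc hκ hs hmn h0 hgap (b T) (U T)).1
  have hcmp0 := (mode_energy_compare hε hlam hc hκ hs hmn h0 hgap (b 0) (U 0)).2
  have hμ0 : 0 < mj ^ 2 + mn ^ 2 := by positivity
  have hμj : mj ^ 2 ≤ mj ^ 2 + mn ^ 2 := by linarith [sq_nonneg mn]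
  generalize hμ : mj ^ 2 + mn ^ 2 = μ at *
  set σ := ε * μ - lam with hσ
  have hδκ : κ * μ ≤ σ - c := by linarith
  have hκμ : 0 < κ * μ := by positivity
  have hδ0 : 0 < σ - c := lt_of_lt_of_le hκμ hδκ
  have h := abs_quasistationary_le (ρ := ε * mj * s) hc (by linarith : c < σ) hR hbc hUc hb hU hT
  set βT := b T + ε * mj * s / σ * U T
  set β0 := b 0 + ε * mj * s / σ * U 0
  have hsq := pow_le_pow_left₀ (abs_nonneg _) h 2
  rw [sq_abs, mul_pow, ← Real.exp_nat_mul] at hsq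
  have hexp : Real.exp (((2 : ℕ) : ℝ) * (-(c * T))) = Real.exp (-(2 * c * T)) := by
    congr 1; push_cast; ring
  rw [hexp] at hsq
  set W := 2 * |ε * mj * s| * R / ((σ - c) * Real.sqrt (σ - c)) with hW
  -- `mj² ≤ μ` and `σ - c ≥ κ μ` give `μ · μ · μ⁻³ = μ⁻¹`, which is summable over the frequencies in
  -- `x`.
  have hW2 : μ * W ^ 2 ≤ 4 * (ε ^ 2 / κ ^ 3) * R ^ 2 * (1 / μ) := by
    have e : W ^ 2 = 4 * ε ^ 2 * mj ^ 2 * R ^ 2 * (1 / (σ - c) ^ 3) := by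
      rw [hW, div_pow, mul_pow, mul_pow, mul_pow, sq_abs, mul_pow, mul_pow ε, hs,
        Real.sq_sqrt hδ0.le]
      field_simp
      ring
    rw [e]
    calc μ * (4 * ε ^ 2 * mj ^ 2 * R ^ 2 * (1 / (σ - c) ^ 3))
        ≤ μ * (4 * ε ^ 2 * μ * R ^ 2 * (1 / (κ * μ) ^ 3)) := by gcongr
      _ = _ := by field_simp
  have hβ : (|β0| + W) ^ 2 ≤ 2 * β0 ^ 2 + 2 * W ^ 2 := by
    rw [← sq_abs β0]; nlinarith [sq_nonneg (|β0| - W)]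
  have hE := Real.exp_pos (-(2 * c * T))
  have h3 : μ * βT ^ 2 ≤ Real.exp (-(2 * c * T)) * (2 * (μ * β0 ^ 2) + 2 * (μ * W ^ 2)) := by
    calc μ * βT ^ 2 ≤ μ * (Real.exp (-(2 * c * T)) * (2 * β0 ^ 2 + 2 * W ^ 2)) := by
          gcongr; exact hsq.trans (by gcongr)
      _ = _ := by ring
  have h4 : Real.exp (-(2 * c * T)) * (2 * (μ * β0 ^ 2) + 2 * (μ * W ^ 2))
      ≤ Real.exp (-(2 * c * T)) * (2 * (2 * ((mj * b 0 + s * U 0) ^ 2 + mn ^ 2 * b 0 ^ 2)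
        + 4 * (ε / κ) ^ 2 * (mn ^ 2 / μ) * U 0 ^ 2)
        + 2 * (4 * (ε ^ 2 / κ ^ 3) * R ^ 2 * (1 / μ))) := by gcongr
  linarith

end

/-- Decay of a stable mode that is driven through the boundary by a Hölder continuous input. -/
theorem exists_high_mode_bound {ε lam c κ : ℝ} (hε : 0 < ε) (hlam : 0 < lam) (hc : 0 < c)
    (hκ : 0 < κ) : ∃ C : ℝ, 0 < C ∧ ∀ n : ℕ, 1 ≤ n →
    (∀ j : ℕ, κ * ((j * Real.pi) ^ 2 + (n * Real.pi) ^ 2)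
      ≤ ε * ((j * Real.pi) ^ 2 + (n * Real.pi) ^ 2) - lam - c) →
    ∀ (b : ℕ → ℝ → ℝ) (U F G : ℝ → ℝ) (R : ℝ), 0 ≤ R →
    (∀ j, ContinuousOn (b j) (Set.Ici 0)) → ContinuousOn U (Set.Ici 0) →
    (∀ j : ℕ, ∀ t, 0 ≤ t → b j t = b j 0 + ∫ r in (0 : ℝ)..t,
      (-(ε * ((j * Real.pi) ^ 2 + (n * Real.pi) ^ 2) - lam) * b j r
        - ε * (j * Real.pi) * (-1) ^ j * U r)) →
    (∀ r t, 0 ≤ r → r ≤ t → |U t - U r| ≤ R * Real.sqrt (t - r) * Real.exp (-(c * r))) →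
    (∀ t, 0 ≤ t → HasSum (fun j => 2 * b j t ^ 2) (F t)) →
    (∀ t, 0 ≤ t → HasSum (fun j : ℕ => 2 * (j * Real.pi * b j t + (-1) ^ j * U t) ^ 2)
      (G t + U t ^ 2)) → ∀ t, 0 ≤ t →
    (1 + (n * Real.pi) ^ 2) * F t + G t ≤ C * (n * U t ^ 2
      + Real.exp (-(2 * c * t)) * ((1 + (n * Real.pi) ^ 2) * F 0 + G 0 + R ^ 2)) := by
  set k0 := (ε / κ) ^ 2 with hk0
  set k1 := ε ^ 2 / κ ^ 3 with hk1
  have hk0' : 0 < k0 := by positivity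
  have hk1' : 0 < k1 := by positivity
  refine ⟨32 + 256 * k0 + 256 * k1, by positivity, ?_⟩
  intro n hn hgap b U F G R hR hbc hUc hb hU hF hG T hT
  have hn' : (1 : ℝ) ≤ n := by exact_mod_cast hn
  have hpi : 1 ≤ Real.pi := by linarith [Real.pi_gt_three]
  have hmn0 : 0 < n * Real.pi := by positivity
  have hnmn : (n : ℝ) ≤ (n * Real.pi) ^ 2 := by
    have h1 : (n : ℝ) ≤ n * Real.pi := le_mul_of_one_le_right (by positivity) hpi
    nlinarith
  have hF0 : 0 ≤ F 0 := (hF 0 le_rfl).nonneg fun j => by positivity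
  have hG0 : n * U 0 ^ 2 ≤ (n * Real.pi) ^ 2 * F 0 + G 0 :=
    mul_sq_trace_le (hF 0 le_rfl) (hG 0 le_rfl)
  have hGT : n * U T ^ 2 ≤ (n * Real.pi) ^ 2 * F T + G T := mul_sq_trace_le (hF T hT) (hG T hT)
  have hFT : 0 ≤ F T := (hF T hT).nonneg fun j => by positivity
  have h0 : lam ≤ ε * (n * Real.pi) ^ 2 := by
    have := hgap 0
    simp only [Nat.cast_zero, zero_mul, ne_eq, OfNat.ofNat_ne_zero, not_false_eq_true, zero_pow,
      zero_add] at this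
    nlinarith [mul_pos hκ (pow_pos hmn0 2)]
  have ha : HasSum (fun j : ℕ => (n * Real.pi) ^ 2 / ((j * Real.pi) ^ 2 + (n * Real.pi) ^ 2))
      (∑' j : ℕ, (n : ℝ) ^ 2 / ((j : ℝ) ^ 2 + (n : ℝ) ^ 2)) := by
    convert! (tsum_sq_div_le hn).1.hasSum using 1
    ext j
    rw [mul_pow, mul_pow, ← add_mul, mul_div_mul_right _ _ (by positivity)]
  have hA := (tsum_sq_div_le hn).2
  set A := ∑' j : ℕ, (n : ℝ) ^ 2 / ((j : ℝ) ^ 2 + (n : ℝ) ^ 2)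
  have hterm : ∀ j : ℕ, (j * Real.pi * b j T + (-1) ^ j * U T) ^ 2 + (n * Real.pi) ^ 2 * b j T ^ 2
      ≤ Real.exp (-(2 * c * T)) * (8 * ((j * Real.pi * b j 0 + (-1) ^ j * U 0) ^ 2
          + (n * Real.pi) ^ 2 * b j 0 ^ 2)
          + (16 * k0 * U 0 ^ 2 + 16 * k1 * R ^ 2 / n) *
            ((n * Real.pi) ^ 2 / ((j * Real.pi) ^ 2 + (n * Real.pi) ^ 2)))
        + 4 * k0 * U T ^ 2 * ((n * Real.pi) ^ 2 / ((j * Real.pi) ^ 2 + (n * Real.pi) ^ 2)) := by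
    intro j
    have hs : ((-1 : ℝ) ^ j) ^ 2 = 1 := by rw [← pow_mul, mul_comm j 2, pow_mul]; norm_num
    refine (mode_energy_decay hε hlam hc hκ hs hmn0 h0 (hgap j) hR (hbc j) hUc (hb j) hU hT).trans ?_
    -- The factor `1 / n` comes from `n ≤ (n π)²`. It compensates the order `n` of the sum, so `R²`
    -- enters with a constant independent of `n`.
    have hinv : 1 / ((j * Real.pi) ^ 2 + (n * Real.pi) ^ 2)
        ≤ 1 / n * ((n * Real.pi) ^ 2 / ((j * Real.pi) ^ 2 + (n * Real.pi) ^ 2)) := by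
      rw [div_mul_div_comm, one_mul, div_le_div_iff₀ (by positivity) (by positivity), one_mul]
      gcongr
    have hE := Real.exp_pos (-(2 * c * T))
    have := mul_le_mul_of_nonneg_left (mul_le_mul_of_nonneg_left hinv
      (by positivity : 0 ≤ 16 * k1 * R ^ 2)) hE.le
    rw [← hk0, ← hk1]
    have e : Real.exp (-(2 * c * T)) * (16 * k1 * R ^ 2 *
        (1 / n * ((n * Real.pi) ^ 2 / ((j * Real.pi) ^ 2 + (n * Real.pi) ^ 2))))
        = Real.exp (-(2 * c * T)) * (16 * k1 * R ^ 2 / n *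
          ((n * Real.pi) ^ 2 / ((j * Real.pi) ^ 2 + (n * Real.pi) ^ 2))) := by ring
    rw [e] at this
    linarith
  have hsum := hasSum_le hterm (hasSum_mode_energy (hF T hT) (hG T hT))
    (((((hasSum_mode_energy (hF 0 le_rfl) (hG 0 le_rfl)).mul_left 8).add
      (ha.mul_left _)).mul_left _).add (ha.mul_left _))
  set E := Real.exp (-(2 * c * T)) with hE
  have hE0 : 0 < E := Real.exp_pos _
  set H0 := (1 + (n * Real.pi) ^ 2) * F 0 + G 0 with hH0
  have hU0 : U 0 ^ 2 ≤ n * U 0 ^ 2 := le_mul_of_one_le_left (sq_nonneg _) hn'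
  have hUT : U T ^ 2 ≤ n * U T ^ 2 := le_mul_of_one_le_left (sq_nonneg _) hn'
  have hn2 : 1 ≤ (n * Real.pi) ^ 2 := hn'.trans hnmn
  have b1 : ((n * Real.pi) ^ 2 * F 0 + G 0 + U 0 ^ 2) / 2 ≤ H0 := by
    rw [hH0]; linarith
  have b2 : (16 * k0 * U 0 ^ 2 + 16 * k1 * R ^ 2 / n) * A ≤ 64 * k0 * H0 + 64 * k1 * R ^ 2 := by
    calc _ ≤ (16 * k0 * U 0 ^ 2 + 16 * k1 * R ^ 2 / n) * (4 * n) := by gcongr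
      _ = 64 * k0 * (n * U 0 ^ 2) + 64 * k1 * R ^ 2 := by field_simp; ring
      _ ≤ _ := by
        gcongr
        rw [hH0]; linarith
  have b3 : 4 * k0 * U T ^ 2 * A ≤ 16 * k0 * (n * U T ^ 2) := by
    calc _ ≤ 4 * k0 * U T ^ 2 * (4 * n) := by gcongr
      _ = _ := by ring
  have b4 : (1 + (n * Real.pi) ^ 2) * F T + G T
      ≤ 4 * (((n * Real.pi) ^ 2 * F T + G T + U T ^ 2) / 2) := by
    have : F T ≤ (n * Real.pi) ^ 2 * F T := le_mul_of_one_le_left hFT hn2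
    have : 0 ≤ G T + U T ^ 2 := (hG T hT).nonneg fun j => by positivity
    linarith [sq_nonneg (U T)]
  have hR2 := sq_nonneg R
  have hH0' : 0 ≤ H0 := by
    have : 0 ≤ n * U 0 ^ 2 := by positivity
    rw [hH0]; linarith
  have hUT0 : 0 ≤ n * U T ^ 2 := by positivity
  calc (1 + (n * Real.pi) ^ 2) * F T + G T
      ≤ 4 * (E * (8 * H0 + (64 * k0 * H0 + 64 * k1 * R ^ 2)) + 16 * k0 * (n * U T ^ 2)) := by
        refine b4.trans ?_
        gcongr
        refine hsum.trans ?_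
        gcongr
    _ = (32 + 256 * k0) * (E * H0) + 256 * k1 * (E * R ^ 2) + 64 * k0 * (n * U T ^ 2) := by ring
    _ ≤ (32 + 256 * k0 + 256 * k1) * (E * H0) + (32 + 256 * k0 + 256 * k1) * (E * R ^ 2)
        + (32 + 256 * k0 + 256 * k1) * (n * U T ^ 2) := by
        have x1 := mul_nonneg hE0.le hH0'
        have x2 := mul_nonneg hE0.le hR2
        refine add_le_add (add_le_add ?_ ?_) ?_
        · exact mul_le_mul_of_nonneg_right (by linarith) x1
        · exact mul_le_mul_of_nonneg_right (by linarith) x2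
        · exact mul_le_mul_of_nonneg_right (by linarith) hUT0
    _ = _ := by ring

/-! ### Partial Fourier coefficients of functions on the square -/

theorem volQ_eq_prod : volQ = volI.prod volI := by
  rw [volQ, Q, volI, Measure.prod_restrict, Measure.volume_eq_prod]

instance : IsProbabilityMeasure volQ := by rw [volQ_eq_prod]; infer_instance

theorem ae_mem_volQ : ∀ᵐ z ∂volQ, z ∈ Set.Ioo (0 : ℝ) 1 ×ˢ Set.Ioo (0 : ℝ) 1 :=
  ae_restrict_mem (measurableSet_Ioo.prod measurableSet_Ioo)

theorem memLp_volQ_of_continuous {w : ℝ × ℝ → ℝ} (hw : Continuous w) : MemLp w 2 volQ := by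
  obtain ⟨C, hC⟩ := ((isCompact_Icc (a := (0 : ℝ)) (b := 1)).prod
    (isCompact_Icc (a := (0 : ℝ)) (b := 1))).exists_bound_of_continuousOn hw.continuousOn
  refine MemLp.of_bound hw.aestronglyMeasurable C ?_
  filter_upwards [ae_mem_volQ] with z hz
  exact hC z ⟨Set.Ioo_subset_Icc_self hz.1, Set.Ioo_subset_Icc_self hz.2⟩

theorem integrable_volQ_mul {f w : ℝ × ℝ → ℝ} (hf : MemLp f 2 volQ) (hw : Continuous w) :
    Integrable (fun z => f z * w z) volQ :=
  hf.integrable_mul (memLp_volQ_of_continuous hw)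

/-- The pairing of `f(x, ·)` with `h`, as a function of `x`. -/
def pair (h : ℝ → ℝ) (f : ℝ × ℝ → ℝ) (x : ℝ) : ℝ := ∫ y, f (x, y) * h y ∂volI

section

variable {f : ℝ × ℝ → ℝ} {h : ℝ → ℝ}

theorem memLp_section (hf : MemLp f 2 volQ) : ∀ᵐ x ∂volI, MemLp (fun y => f (x, y)) 2 volI := by
  have h1 := hf.aestronglyMeasurable
  rw [volQ_eq_prod] at h1
  have h2 := hf.integrable_sq
  rw [volQ_eq_prod] at h2
  filter_upwards [h1.prodMk_left, h2.prod_right_ae] with x hx1 hx2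
  exact (memLp_two_iff_integrable_sq hx1).2 hx2

theorem memLp_pair (hf : MemLp f 2 volQ) (hh : Continuous h) : MemLp (pair h f) 2 volI := by
  have hi := integrable_volQ_mul hf (hh.comp continuous_snd)
  rw [volQ_eq_prod] at hi
  have hm : AEStronglyMeasurable (pair h f) volI := hi.aestronglyMeasurable.integral_prod_right'
  have h2 := hf.integrable_sq
  rw [volQ_eq_prod] at h2
  rw [memLp_two_iff_integrable_sq hm]
  refine (h2.integral_prod_left.mul_const (∫ y, h y ^ 2 ∂volI)).mono' (hm.pow 2) ?_
  filter_upwards [memLp_section hf] with x hx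
  rw [Real.norm_of_nonneg (sq_nonneg _)]
  exact sq_integral_mul_le hx (memLp_of_continuous hh)

theorem integral_pair_mul (hf : MemLp f 2 volQ) (hh : Continuous h) {p : ℝ → ℝ}
    (hp : Continuous p) :
    ∫ x, pair h f x * p x ∂volI = ∫ z, f z * (p z.1 * h z.2) ∂volQ := by
  have hi : Integrable (fun z : ℝ × ℝ => f z * (p z.1 * h z.2)) volQ :=
    integrable_volQ_mul hf ((hp.comp continuous_fst).mul (hh.comp continuous_snd))
  rw [volQ_eq_prod] at hi ⊢
  rw [integral_prod _ hi]
  congr 1; ext x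
  rw [pair, ← integral_mul_const]
  congr 1; ext y
  ring

/-- The terms are nonnegative and serve as their own dominating sequence, with integrable sum `B`.
This integrates a Parseval identity in `y` over `x`. -/
theorem hasSum_integral_sq_pair {e : ℕ → ℝ → ℝ} (he : ∀ n, Continuous (e n))
    {B : ℝ → ℝ} (hf : MemLp f 2 volQ) (hB : Integrable B volI)
    (hs : ∀ᵐ x ∂volI, HasSum (fun n => 2 * pair (e n) f x ^ 2) (B x)) :
    HasSum (fun n => 2 * ∫ x, pair (e n) f x ^ 2 ∂volI) (∫ x, B x ∂volI) := by
  have hm : ∀ n, MemLp (pair (e n) f) 2 volI := fun n => memLp_pair hf (he n)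
  have := hasSum_integral_of_dominated_convergence (μ := volI)
    (F := fun n x => 2 * pair (e n) f x ^ 2) (f := B) (fun n x => 2 * pair (e n) f x ^ 2)
    (fun n => ((hm n).integrable_sq.const_mul 2).aestronglyMeasurable)
    (fun n => Eventually.of_forall fun x => (Real.norm_of_nonneg (by positivity)).le)
    (hs.mono fun x hx => hx.summable)
    (hB.congr (hs.mono fun x hx => hx.tsum_eq.symm)) hs
  simpa only [integral_const_mul] using this

/-- Parseval's identity for sine series in the second variable. -/
theorem hasSum_sq_pair_sn (hf : MemLp f 2 volQ) :
    HasSum (fun n => 2 * ∫ x, pair (sn n) f x ^ 2 ∂volI) (∫ z, f z ^ 2 ∂volQ) := by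
  have h2 := hf.integrable_sq
  rw [volQ_eq_prod] at h2 ⊢
  rw [integral_prod _ h2]
  refine hasSum_integral_sq_pair continuous_sn hf h2.integral_prod_left ?_
  filter_upwards [memLp_section hf] with x hx using hasSum_sq_sn hx

/-- Parseval's identity for cosine series in the second variable. -/
theorem hasSum_sq_pair_cs (hf : MemLp f 2 volQ) :
    HasSum (fun n => 2 * ∫ x, pair (cs n) f x ^ 2 ∂volI)
      (∫ z, f z ^ 2 ∂volQ + ∫ x, pair (cs 0) f x ^ 2 ∂volI) := by
  have h2 := hf.integrable_sq
  have h0 := (memLp_pair hf (continuous_cs 0)).integrable_sq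
  rw [volQ_eq_prod] at h2 ⊢
  rw [integral_prod _ h2, ← integral_add h2.integral_prod_left h0]
  refine hasSum_integral_sq_pair continuous_cs hf (h2.integral_prod_left.add h0) ?_
  filter_upwards [memLp_section hf] with x hx
  have := hasSum_sq_cs hx
  simpa [pair] using this

end

/-! ### Weak gradients -/

theorem isWeakGrad_weakGrad {f : ℝ × ℝ → ℝ} (hf : MemH1 f) : IsWeakGrad f (wdx f) (wdy f) := by
  have : weakGrad f = hf.choose := by rw [weakGrad, dif_pos hf]
  rw [wdx, wdy, this]
  exact hf.choose_spec

/-- The fundamental lemma of the calculus of variations. It makes the choice of representative in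
`weakGrad` immaterial. -/
theorem ae_eq_of_test {p q : ℝ × ℝ → ℝ} (hp : MemLp p 2 volQ) (hq : MemLp q 2 volQ)
    (h : ∀ η : ℝ × ℝ → ℝ, ContDiff ℝ ∞ η → HasCompactSupport η → tsupport η ⊆ Q →
      ∫ z, p z * η z ∂volQ = ∫ z, q z * η z ∂volQ) : p =ᵐ[volQ] q := by
  have hQ : IsOpen Q := isOpen_Ioo.prod isOpen_Ioo
  have hi : IntegrableOn (fun z => p z - q z) Q volume :=
    (hp.integrable one_le_two).sub (hq.integrable one_le_two)
  have key := hQ.ae_eq_zero_of_integral_contDiff_smul_eq_zero (μ := volume)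
    hi.locallyIntegrableOn ?_
  · rw [EventuallyEq, volQ, ae_restrict_iff' hQ.measurableSet]
    filter_upwards [key] with z hz hzQ
    exact sub_eq_zero.1 (hz hzQ)
  · intro g hg hgc hgs
    have h1 : ∫ z, g z • (p z - q z) ∂volume = ∫ z, g z • (p z - q z) ∂volQ := by
      refine (setIntegral_eq_integral_of_forall_compl_eq_zero fun z hz => ?_).symm
      have : g z = 0 := image_eq_zero_of_notMem_tsupport fun hz' => hz (hgs hz')
      simp [this]
    have h2 := h g hg hgc hgs
    rw [h1]
    have h3 : ∀ z, g z • (p z - q z) = p z * g z - q z * g z := fun z => by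
      simp only [smul_eq_mul]; ring
    simp_rw [h3]
    rw [integral_sub (integrable_volQ_mul hp hg.continuous)
      (integrable_volQ_mul hq hg.continuous), h2, sub_self]

theorem IsWeakGrad.ae_eq {f p q : ℝ × ℝ → ℝ} (h : IsWeakGrad f p q) :
    wdx f =ᵐ[volQ] p ∧ wdy f =ᵐ[volQ] q := by
  have h' := isWeakGrad_weakGrad ⟨(p, q), h⟩
  refine ⟨ae_eq_of_test h'.memLp_x h.memLp_x fun η h1 h2 h3 => ?_,
    ae_eq_of_test h'.memLp_y h.memLp_y fun η h1 h2 h3 => ?_⟩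
  · have a := h'.weak_x η h1 h2 h3
    have b := h.weak_x η h1 h2 h3
    linarith
  · have a := h'.weak_y η h1 h2 h3
    have b := h.weak_y η h1 h2 h3
    linarith

theorem hasDerivAt_dx {η : ℝ × ℝ → ℝ} (hη : ContDiff ℝ ∞ η) (x y : ℝ) :
    HasDerivAt (fun s => η (s, y)) (dx η (x, y)) x := by
  have : Differentiable ℝ fun s => η (s, y) :=
    (hη.comp (contDiff_prodMk_left y)).differentiable (by simp)
  exact (this x).hasDerivAt

theorem hasDerivAt_dy {η : ℝ × ℝ → ℝ} (hη : ContDiff ℝ ∞ η) (x y : ℝ) :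
    HasDerivAt (fun s => η (x, s)) (dy η (x, y)) y := by
  have : Differentiable ℝ fun s => η (x, s) :=
    (hη.comp (contDiff_prodMk_right x)).differentiable (by simp)
  exact (this y).hasDerivAt

theorem continuous_dx {η : ℝ × ℝ → ℝ} (hη : ContDiff ℝ ∞ η) : Continuous (dx η) := by
  have h : dx η = fun z => fderiv ℝ η z (1, 0) := by
    ext z
    have h1 := (hη.differentiable (by simp) z).hasFDerivAt.comp_hasDerivAt z.1
      (f := fun s => (s, z.2)) ((hasDerivAt_id z.1).prodMk (hasDerivAt_const z.1 z.2))
    exact h1.deriv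
  rw [h]
  exact (hη.continuous_fderiv (by simp)).clm_apply continuous_const

theorem continuous_dy {η : ℝ × ℝ → ℝ} (hη : ContDiff ℝ ∞ η) : Continuous (dy η) := by
  have h : dy η = fun z => fderiv ℝ η z (0, 1) := by
    ext z
    have h1 := (hη.differentiable (by simp) z).hasFDerivAt.comp_hasDerivAt z.2
      (f := fun s => (z.1, s)) ((hasDerivAt_const z.2 z.1).prodMk (hasDerivAt_id z.2))
    exact h1.deriv
  rw [h]
  exact (hη.continuous_fderiv (by simp)).clm_apply continuous_const

section

variable {p h : ℝ → ℝ}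

theorem integral_deriv_eq_zero {F F' : ℝ → ℝ} (hd : ∀ x, HasDerivAt F (F' x) x)
    (hc : Continuous F') (h0 : F 0 = 0) (h1 : F 1 = 0) : ∫ x, F' x ∂volI = 0 := by
  rw [integral_volI, intervalIntegral.integral_eq_sub_of_hasDerivAt (fun x _ => hd x)
    (hc.intervalIntegrable _ _), h0, h1, sub_zero]

theorem integral_product_dx (hp : ContDiff ℝ ∞ p) (hh : ContDiff ℝ ∞ h) (hp0 : p 0 = 0)
    (hp1 : p 1 = 0) {η : ℝ × ℝ → ℝ} (hη : ContDiff ℝ ∞ η) :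
    ∫ z, (p z.1 * h z.2 * dx η z + deriv p z.1 * h z.2 * η z) ∂volQ = 0 := by
  have cp := hp.continuous
  have ch := hh.continuous
  have cp' := hp.continuous_deriv (by simp)
  have cη := hη.continuous
  have cη' := continuous_dx hη
  have hc : Continuous fun z : ℝ × ℝ => p z.1 * h z.2 * dx η z + deriv p z.1 * h z.2 * η z := by
    fun_prop
  have hi := (memLp_volQ_of_continuous hc).integrable one_le_two
  rw [volQ_eq_prod] at hi ⊢
  rw [integral_prod_symm _ hi]
  refine integral_eq_zero_of_ae (Eventually.of_forall fun y => ?_)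
  refine integral_deriv_eq_zero (F := fun x => p x * h y * η (x, y)) (fun x => ?_)
    (hc.comp (Continuous.prodMk_left y)) (by simp [hp0]) (by simp [hp1])
  refine ((((hp.differentiable (by simp) x).hasDerivAt).mul_const (h y)).mul
    (hasDerivAt_dx hη x y)).congr_deriv ?_
  ring

theorem integral_product_dy (hp : ContDiff ℝ ∞ p) (hh : ContDiff ℝ ∞ h) (hh0 : h 0 = 0)
    (hh1 : h 1 = 0) {η : ℝ × ℝ → ℝ} (hη : ContDiff ℝ ∞ η) :
    ∫ z, (p z.1 * h z.2 * dy η z + p z.1 * deriv h z.2 * η z) ∂volQ = 0 := by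
  have cp := hp.continuous
  have ch := hh.continuous
  have ch' := hh.continuous_deriv (by simp)
  have cη := hη.continuous
  have cη' := continuous_dy hη
  have hc : Continuous fun z : ℝ × ℝ => p z.1 * h z.2 * dy η z + p z.1 * deriv h z.2 * η z := by
    fun_prop
  have hi := (memLp_volQ_of_continuous hc).integrable one_le_two
  rw [volQ_eq_prod] at hi ⊢
  rw [integral_prod _ hi]
  refine integral_eq_zero_of_ae (Eventually.of_forall fun x => ?_)
  refine integral_deriv_eq_zero (F := fun y => p x * h y * η (x, y)) (fun y => ?_)
    (hc.comp (Continuous.prodMk_right x)) (by simp [hh0]) (by simp [hh1])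
  refine ((((hh.differentiable (by simp) y).hasDerivAt).const_mul (p x)).mul
    (hasDerivAt_dy hη x y)).congr_deriv ?_
  ring

theorem isWeakGrad_product (hp : ContDiff ℝ ∞ p) (hh : ContDiff ℝ ∞ h) (hp0 : p 0 = 0)
    (hp1 : p 1 = 0) (hh0 : h 0 = 0) (hh1 : h 1 = 0) :
    IsWeakGrad (fun z => p z.1 * h z.2) (fun z => deriv p z.1 * h z.2)
      (fun z => p z.1 * deriv h z.2) := by
  have cp := hp.continuous
  have ch := hh.continuous
  have cp' := hp.continuous_deriv (by simp)
  have ch' := hh.continuous_deriv (by simp)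
  have mf : MemLp (fun z : ℝ × ℝ => p z.1 * h z.2) 2 volQ :=
    memLp_volQ_of_continuous (by fun_prop)
  have mx : MemLp (fun z : ℝ × ℝ => deriv p z.1 * h z.2) 2 volQ :=
    memLp_volQ_of_continuous (by fun_prop)
  have my : MemLp (fun z : ℝ × ℝ => p z.1 * deriv h z.2) 2 volQ :=
    memLp_volQ_of_continuous (by fun_prop)
  refine ⟨mf, mx, my, fun η hη _ _ => ?_, fun η hη _ _ => ?_⟩
  · have := integral_product_dx hp hh hp0 hp1 hη
    rw [integral_add (integrable_volQ_mul mf (continuous_dx hη))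
      (integrable_volQ_mul mx hη.continuous)] at this
    linarith
  · have := integral_product_dy hp hh hh0 hh1 hη
    rw [integral_add (integrable_volQ_mul mf (continuous_dy hη))
      (integrable_volQ_mul my hη.continuous)] at this
    linarith

/-- Products of smooth functions that vanish at the end points lie in `H¹₀`. -/
theorem memH10_product (hp : ContDiff ℝ ∞ p) (hh : ContDiff ℝ ∞ h) (hp0 : p 0 = 0)
    (hp1 : p 1 = 0) (hh0 : h 0 = 0) (hh1 : h 1 = 0) :
    MemH10 (fun z => p z.1 * h z.2) := by
  have hw := isWeakGrad_product hp hh hp0 hp1 hh0 hh1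
  obtain ⟨ex, ey⟩ := hw.ae_eq
  refine ⟨⟨(_, _), hw⟩, MemLp.zero, MemLp.zero, MemLp.zero, MemLp.zero, fun η hη => ?_,
    fun η hη => ?_⟩
  · simp only [Pi.zero_apply, zero_mul, integral_zero, sub_zero]
    rw [← integral_product_dx hp hh hp0 hp1 hη]
    refine integral_congr_ae ?_
    filter_upwards [ex] with z hz
    rw [hz]
  · simp only [Pi.zero_apply, zero_mul, integral_zero, sub_zero]
    rw [← integral_product_dy hp hh hh0 hh1 hη]
    refine integral_congr_ae ?_
    filter_upwards [ey] with z hz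
    rw [hz]

end

/-! ### The modes of a function with given traces -/

/-- Gauss-Green with `ζ(x) sin (n π y)`. Since `ζ` is not required to vanish anywhere, the identity
encodes both the weak derivative of the mode and its values at `0` and `1`. -/
theorem HasTrace.pair_sn_relation {f : ℝ × ℝ → ℝ} {g : ℝ → ℝ} (hf : HasTrace f 0 g 0 0) (n : ℕ)
    {ζ : ℝ → ℝ} (hζ : ContDiff ℝ ∞ ζ) :
    ∫ x, (pair (sn n) f x * deriv ζ x + pair (sn n) (wdx f) x * ζ x) ∂volI
      = (∫ y, g y * sn n y ∂volI) * ζ 1 := by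
  have hw := isWeakGrad_weakGrad hf.memH1
  have cζ := hζ.continuous
  have cζ' := hζ.continuous_deriv (by simp)
  have cs' := continuous_sn n
  have hη : ContDiff ℝ ∞ fun z : ℝ × ℝ => ζ z.1 * sn n z.2 :=
    (hζ.comp contDiff_fst).mul ((contDiff_sn n).comp contDiff_snd)
  have hdx : dx (fun z : ℝ × ℝ => ζ z.1 * sn n z.2) = fun z => deriv ζ z.1 * sn n z.2 := by
    ext z
    rw [dx, (((hζ.differentiable (by simp) z.1).hasDerivAt).mul_const (sn n z.2)).deriv]
  have h := hf.green_x _ hη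
  rw [hdx, integral_add (integrable_volQ_mul hw.memLp (by fun_prop))
    (integrable_volQ_mul hw.memLp_x (by fun_prop)), ← integral_pair_mul hw.memLp cs' cζ',
    ← integral_pair_mul hw.memLp_x cs' cζ] at h
  rw [integral_add (integrable_mul_continuous (memLp_pair hw.memLp cs') cζ')
    (integrable_mul_continuous (memLp_pair hw.memLp_x cs') cζ), h, ← integral_mul_const]
  simp only [Pi.zero_apply, zero_mul, integral_zero, sub_zero]
  congr 1; ext y; ring

/-- Gauss-Green with `ζ(x) cos (n π y)`: the cosine does not vanish at `y = 0, 1`, but the traces of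
`f` do, so no boundary term remains. -/
theorem HasTrace.pair_cs_wdy {f : ℝ × ℝ → ℝ} {g : ℝ → ℝ} (hf : HasTrace f 0 g 0 0) (n : ℕ) :
    pair (cs n) (wdy f) =ᵐ[volI] fun x => n * Real.pi * pair (sn n) f x := by
  have hw := isWeakGrad_weakGrad hf.memH1
  have c1 := continuous_sn n
  have c2 := continuous_cs n
  have m1 := memLp_pair hw.memLp_y c2
  have m2 := (memLp_pair hw.memLp c1).const_mul (n * Real.pi)
  refine ae_eq_of_integral_contDiff_smul_eq (m1.integrable one_le_two).locallyIntegrable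
    (m2.integrable one_le_two).locallyIntegrable fun ζ hζ _ => ?_
  have cζ := hζ.continuous
  have hη : ContDiff ℝ ∞ fun z : ℝ × ℝ => ζ z.1 * cs n z.2 :=
    (hζ.comp contDiff_fst).mul ((contDiff_cs n).comp contDiff_snd)
  have hdy : dy (fun z : ℝ × ℝ => ζ z.1 * cs n z.2)
      = fun z => -(n * Real.pi) * (ζ z.1 * sn n z.2) := by
    ext z
    rw [dy, ((hasDerivAt_cs n z.2).const_mul (ζ z.1)).deriv]
    ring
  have h := hf.green_y _ hη
  rw [hdy, integral_add (integrable_volQ_mul hw.memLp (by fun_prop))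
    (integrable_volQ_mul hw.memLp_y (by fun_prop)), ← integral_pair_mul hw.memLp_y c2 cζ] at h
  simp only [Pi.zero_apply, zero_mul, integral_zero, sub_zero] at h
  have e1 : ∫ z, f z * (-(n * Real.pi) * (ζ z.1 * sn n z.2)) ∂volQ
      = -(n * Real.pi) * ∫ x, pair (sn n) f x * ζ x ∂volI := by
    rw [integral_pair_mul hw.memLp c1 cζ, ← integral_const_mul]
    congr 1; ext z; ring
  rw [e1] at h
  have e2 : ∫ x, ζ x • pair (cs n) (wdy f) x ∂volI = ∫ x, pair (cs n) (wdy f) x * ζ x ∂volI := by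
    congr 1; ext x; simp only [smul_eq_mul]; ring
  have e3 : ∫ x, ζ x • (n * Real.pi * pair (sn n) f x) ∂volI
      = n * Real.pi * ∫ x, pair (sn n) f x * ζ x ∂volI := by
    rw [← integral_const_mul]
    congr 1; ext x; simp only [smul_eq_mul]; ring
  rw [e2, e3]
  linarith

/-- The part of the squared `H¹` norm that is carried by the `n`-th mode. -/
def modeEnergy (n : ℕ) (f : ℝ × ℝ → ℝ) : ℝ :=
  (1 + (n * Real.pi) ^ 2) * ∫ x, pair (sn n) f x ^ 2 ∂volI + ∫ x, pair (sn n) (wdx f) x ^ 2 ∂volI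

theorem modeEnergy_nonneg (n : ℕ) (f : ℝ × ℝ → ℝ) : 0 ≤ modeEnergy n f :=
  add_nonneg (mul_nonneg (by positivity) (integral_nonneg fun x => sq_nonneg _))
    (integral_nonneg fun x => sq_nonneg _)

theorem modeEnergy_zero (f : ℝ × ℝ → ℝ) : modeEnergy 0 f = 0 := by
  simp [modeEnergy, pair]

/-- The squared `H¹` norm is the sum of the energies of the modes. -/
theorem HasTrace.hasSum_modeEnergy {f : ℝ × ℝ → ℝ} {g : ℝ → ℝ} (hf : HasTrace f 0 g 0 0) :
    HasSum (fun n => 2 * modeEnergy n f) (h1Norm f ^ 2) := by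
  have hw := isWeakGrad_weakGrad hf.memH1
  have i1 := hw.memLp.integrable_sq
  have i2 := hw.memLp_x.integrable_sq
  have i3 := hw.memLp_y.integrable_sq
  have h1 := hasSum_sq_pair_sn hw.memLp
  have h2 := hasSum_sq_pair_sn hw.memLp_x
  have h3 := hasSum_sq_pair_cs hw.memLp_y
  have e3 : ∀ n : ℕ, ∫ x, pair (cs n) (wdy f) x ^ 2 ∂volI
      = (n * Real.pi) ^ 2 * ∫ x, pair (sn n) f x ^ 2 ∂volI := by
    intro n
    rw [← integral_const_mul]
    refine integral_congr_ae ?_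
    filter_upwards [hf.pair_cs_wdy n] with x hx
    rw [hx]; ring
  simp only [e3] at h3
  have hN : h1Norm f ^ 2 = ∫ z, f z ^ 2 ∂volQ + ∫ z, wdx f z ^ 2 ∂volQ
      + ∫ z, wdy f z ^ 2 ∂volQ := by
    rw [h1Norm, Real.sq_sqrt (integral_nonneg fun z => by positivity),
      integral_add (i1.fun_add i2) i3, integral_add i1 i2]
  rw [hN]
  convert! (h1.add h2).add h3 using 1
  · ext n; rw [modeEnergy]; ring
  · simp

/-- The Fourier coefficients of the `n`-th mode. -/
theorem HasTrace.hasSum_coeff {f : ℝ × ℝ → ℝ} {g : ℝ → ℝ} (hf : HasTrace f 0 g 0 0) (n : ℕ) :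
    HasSum (fun j => 2 * (∫ x, pair (sn n) f x * sn j x ∂volI) ^ 2)
      (∫ x, pair (sn n) f x ^ 2 ∂volI) ∧
    HasSum (fun j : ℕ => 2 * (j * Real.pi * (∫ x, pair (sn n) f x * sn j x ∂volI)
      + (-1) ^ j * ∫ y, g y * sn n y ∂volI) ^ 2)
      (∫ x, pair (sn n) (wdx f) x ^ 2 ∂volI + (∫ y, g y * sn n y ∂volI) ^ 2) := by
  have hw := isWeakGrad_weakGrad hf.memH1
  have m1 := memLp_pair hw.memLp (continuous_sn n)
  have m2 := memLp_pair hw.memLp_x (continuous_sn n)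
  refine ⟨hasSum_sq_sn m1, ?_⟩
  have hc : ∀ j : ℕ, ∫ x, pair (sn n) (wdx f) x * cs j x ∂volI
      = j * Real.pi * (∫ x, pair (sn n) f x * sn j x ∂volI)
        + (-1) ^ j * ∫ y, g y * sn n y ∂volI := by
    intro j
    have h := hf.pair_sn_relation n (contDiff_cs j)
    have hd : deriv (cs j) = fun x => -(j * Real.pi * sn j x) :=
      funext fun x => (hasDerivAt_cs j x).deriv
    have cS := continuous_sn j
    rw [hd, integral_add (integrable_mul_continuous m1 (by fun_prop))
      (integrable_mul_continuous m2 (continuous_cs j)), cs_at_one] at h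
    have e : ∫ x, pair (sn n) f x * -(j * Real.pi * sn j x) ∂volI
        = -(j * Real.pi) * ∫ x, pair (sn n) f x * sn j x ∂volI := by
      rw [← integral_const_mul]; congr 1; ext x; ring
    rw [e] at h
    linarith
  have h := hasSum_sq_cs m2
  have h0 := hc 0
  simp only [cs_zero, mul_one, Nat.cast_zero, zero_mul, zero_add, pow_zero, one_mul] at h0
  simp only [hc, h0] at h
  exact h

/-! ### The modes of a solution -/

section

variable {ε lam : ℝ} {U : ℝ → ℝ → ℝ} {u : ℝ → ℝ × ℝ → ℝ}

theorem IsSolution.memLp (hu : IsSolution ε lam U u) {t : ℝ} (ht : 0 ≤ t) :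
    MemLp (u t) 2 volQ :=
  (isWeakGrad_weakGrad (hu.memH1 t ht)).memLp

theorem integral_sq_eq_eLpNorm {f : ℝ × ℝ → ℝ} (hf : MemLp f 2 volQ) :
    ∫ z, f z ^ 2 ∂volQ = (eLpNorm f 2 volQ).toReal ^ 2 := by
  have h0 : 0 ≤ ∫ z, f z ^ 2 ∂volQ := integral_nonneg fun z => sq_nonneg _
  rw [hf.eLpNorm_eq_integral_rpow_norm (by simp) (by simp)]
  simp only [ENNReal.toReal_ofNat, Real.rpow_ofNat, Real.norm_eq_abs, sq_abs]
  rw [ENNReal.toReal_ofReal (by positivity), ← Real.rpow_natCast, ← Real.rpow_mul h0]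
  norm_num

/-- Cauchy-Schwarz and continuity in time with values in `L²`. This makes the integrated equations
for the coefficients differentiable. -/
theorem IsSolution.continuousOn_integral_mul (hu : IsSolution ε lam U u) {w : ℝ × ℝ → ℝ}
    (hw : Continuous w) : ContinuousOn (fun s => ∫ z, u s z * w z ∂volQ) (Set.Ici 0) := by
  intro t ht
  have mw := memLp_volQ_of_continuous hw
  have hlim := hu.continuous_L2 t ht
  have h1 : Tendsto (fun s => (eLpNorm (u s - u t) 2 volQ).toReal ^ 2 * ∫ z, w z ^ 2 ∂volQ)
      (𝓝[Set.Ici 0] t) (𝓝 0) := by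
    have := ((ENNReal.tendsto_toReal ENNReal.zero_ne_top).comp hlim).pow 2
    simpa using this.mul_const (∫ z, w z ^ 2 ∂volQ)
  have h2 : Tendsto (fun s => (∫ z, u s z * w z ∂volQ - ∫ z, u t z * w z ∂volQ) ^ 2)
      (𝓝[Set.Ici 0] t) (𝓝 0) := by
    refine squeeze_zero' (Eventually.of_forall fun s => sq_nonneg _) ?_ h1
    filter_upwards [self_mem_nhdsWithin] with s hs
    have ms : MemLp (u s - u t) 2 volQ := (hu.memLp hs).sub (hu.memLp ht)
    rw [← integral_sq_eq_eLpNorm ms, ← integral_sub (integrable_volQ_mul (hu.memLp hs) hw)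
      (integrable_volQ_mul (hu.memLp ht) hw)]
    simp_rw [← sub_mul]
    exact sq_integral_mul_le ms mw
  have h3 := h2.sqrt
  simp only [Real.sqrt_sq_eq_abs, Real.sqrt_zero] at h3
  exact tendsto_sub_nhds_zero_iff.1 ((tendsto_zero_iff_abs_tendsto_zero _).2 h3)

theorem IsSolution.continuousOn_integral_pair (hu : IsSolution ε lam U u) {h p : ℝ → ℝ}
    (hh : Continuous h) (hp : Continuous p) :
    ContinuousOn (fun s => ∫ x, pair h (u s) x * p x ∂volI) (Set.Ici 0) := by
  refine (hu.continuousOn_integral_mul (w := fun z => p z.1 * h z.2) (by fun_prop)).congr ?_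
  intro s hs
  exact integral_pair_mul (hu.memLp hs) hh hp

/-- The weak equation, tested with `p(x) sin(n π y)`. -/
theorem IsSolution.integral_pair_eq (hu : IsSolution ε lam U u) (n : ℕ) {p : ℝ → ℝ}
    (hp : ContDiff ℝ ∞ p) (hp0 : p 0 = 0) (hp1 : p 1 = 0) {t : ℝ} (ht : 0 ≤ t) :
    ∫ x, pair (sn n) (u t) x * p x ∂volI = ∫ x, pair (sn n) (u 0) x * p x ∂volI
      + ∫ s in (0 : ℝ)..t, (ε * (∫ x, pair (sn n) (u s) x * deriv (deriv p) x ∂volI)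
        - ε * (∫ y, U s y * sn n y ∂volI) * deriv p 1
        + (lam - ε * (n * Real.pi) ^ 2) * ∫ x, pair (sn n) (u s) x * p x ∂volI) := by
  have hsn := contDiff_sn n
  have cS := continuous_sn n
  have cC := continuous_cs n
  have cp := hp.continuous
  have hp' : ContDiff ℝ ∞ (deriv p) := (contDiff_infty_iff_deriv.1 hp).2
  have cp' := hp'.continuous
  have cp'' := hp'.continuous_deriv (by simp)
  have hdsn : deriv (sn n) = fun y => n * Real.pi * cs n y :=
    funext fun y => (hasDerivAt_sn n y).deriv
  have hv := memH10_product hp hsn hp0 hp1 (sn_at_zero n) (sn_at_one n)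
  obtain ⟨ex, ey⟩ := (isWeakGrad_product hp hsn hp0 hp1 (sn_at_zero n) (sn_at_one n)).ae_eq
  have h := (hu.weak_eq _ hv t ht).2
  rw [integral_pair_mul (hu.memLp ht) cS cp, integral_pair_mul (hu.memLp le_rfl) cS cp,
    ← sub_eq_iff_eq_add', h]
  refine intervalIntegral.integral_congr fun s hs => ?_
  rw [Set.uIcc_of_le ht] at hs
  have hs0 := hs.1
  have hw := isWeakGrad_weakGrad (hu.memH1 s hs0)
  have hb := hu.boundary s hs0
  have m1 := memLp_pair hw.memLp cS
  have mx := memLp_pair hw.memLp_x cS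
  have ix : Integrable (fun z : ℝ × ℝ => wdx (u s) z * (deriv p z.1 * sn n z.2)) volQ :=
    integrable_volQ_mul hw.memLp_x (by fun_prop)
  have iy : Integrable (fun z : ℝ × ℝ => wdy (u s) z * (p z.1 * cs n z.2)) volQ :=
    integrable_volQ_mul hw.memLp_y (by fun_prop)
  have i0 : Integrable (fun z : ℝ × ℝ => u s z * (p z.1 * sn n z.2)) volQ :=
    integrable_volQ_mul hw.memLp (by fun_prop)
  have e1 : ∫ z, (-ε * (wdx (u s) z * wdx (fun z => p z.1 * sn n z.2) z
      + wdy (u s) z * wdy (fun z => p z.1 * sn n z.2) z)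
      + lam * (u s z * (p z.1 * sn n z.2))) ∂volQ
      = -ε * (∫ z, wdx (u s) z * (deriv p z.1 * sn n z.2) ∂volQ
        + n * Real.pi * ∫ z, wdy (u s) z * (p z.1 * cs n z.2) ∂volQ)
        + lam * ∫ z, u s z * (p z.1 * sn n z.2) ∂volQ := by
    rw [← integral_const_mul (n * Real.pi), ← integral_add ix (iy.const_mul _),
      ← integral_const_mul (-ε), ← integral_const_mul lam,
      ← integral_add ((ix.fun_add (iy.const_mul _)).const_mul _) (i0.const_mul _)]
    refine integral_congr_ae ?_
    filter_upwards [ex, ey] with z hzx hzy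
    rw [hzx, hzy, hdsn]
    ring
  have e2 : ∫ x, pair (cs n) (wdy (u s)) x * p x ∂volI
      = n * Real.pi * ∫ x, pair (sn n) (u s) x * p x ∂volI := by
    rw [← integral_const_mul]
    refine integral_congr_ae ?_
    filter_upwards [hb.pair_cs_wdy n] with x hx
    rw [hx]; ring
  -- Gauss-Green tested with `p'` moves the remaining `x`-derivative off `u`; since `p'(1)` need not
  -- vanish, this is where the control enters.
  have e3 := hb.pair_sn_relation n hp'
  rw [integral_add (integrable_mul_continuous m1 cp'') (integrable_mul_continuous mx cp')] at e3
  rw [e1, ← integral_pair_mul hw.memLp_x cS cp', ← integral_pair_mul hw.memLp_y cC cp,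
    ← integral_pair_mul hw.memLp cS cp, e2]
  linear_combination (-ε) * e3

end

theorem memH10_zero : MemH10 (fun _ => 0) := by
  have h := memH10_product (p := fun _ => 0) (h := fun _ => 0) contDiff_const contDiff_const
    rfl rfl rfl rfl
  simpa using h

/-! ### A finite-dimensional boundedness principle -/

/-- The vectors whose products with a sequence of rows are square summable. -/
def sqSummableSubmodule {m : ℕ} (w : ℕ → Fin m → ℝ) : Submodule ℝ (Fin m → ℝ) where
  carrier := {a | Summable fun n => (w n ⬝ᵥ a) ^ 2}
  zero_mem' := by simp [summable_zero]
  add_mem' := by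
    intro a b ha hb
    refine Summable.of_nonneg_of_le (fun n => sq_nonneg _) (fun n => ?_)
      ((ha.mul_left 2).add (hb.mul_left 2))
    rw [dotProduct_add]
    nlinarith [sq_nonneg (w n ⬝ᵥ a - w n ⬝ᵥ b)]
  smul_mem' := by
    intro r a ha
    refine (ha.mul_left (r ^ 2)).congr fun n => ?_
    rw [dotProduct_smul, smul_eq_mul, mul_pow]

/-- On the finite-dimensional subspace of admissible vectors the sum is a finite quadratic form:
expand in a basis and use that the coordinate map is continuous. Mere finiteness is thereby upgraded
to a uniform bound. -/
theorem exists_tsum_sq_dotProduct_le {m : ℕ} (w : ℕ → Fin m → ℝ) :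
    ∃ C : ℝ, 0 ≤ C ∧ ∀ a : Fin m → ℝ, (Summable fun n => (w n ⬝ᵥ a) ^ 2) →
      ∑' n, (w n ⬝ᵥ a) ^ 2 ≤ C * ∑ k, a k ^ 2 := by
  set V := sqSummableSubmodule w
  set B := Module.finBasis ℝ V
  set T := LinearMap.toContinuousLinearMap B.equivFun.toLinearMap
  have hS : ∀ l, Summable fun n => (w n ⬝ᵥ (B l : Fin m → ℝ)) ^ 2 := fun l => (B l).2
  set S : ℝ := ∑ l, ∑' n, (w n ⬝ᵥ (B l : Fin m → ℝ)) ^ 2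
  have hS0 : 0 ≤ S := Finset.sum_nonneg fun l _ => tsum_nonneg fun n => sq_nonneg _
  refine ⟨Module.finrank ℝ V * ‖T‖ ^ 2 * S, by positivity, fun a ha => ?_⟩
  set v : V := ⟨a, ha⟩
  have hrep : a = ∑ l, B.equivFun v l • (B l : Fin m → ℝ) := by
    have h := congrArg Subtype.val (B.sum_equivFun v)
    rw [Submodule.coe_sum] at h
    exact h.symm
  have hnorm : ‖v‖ ^ 2 ≤ ∑ k, a k ^ 2 := by
    have h0 : 0 ≤ ∑ k, a k ^ 2 := Finset.sum_nonneg fun k _ => sq_nonneg _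
    have h1 : ‖a‖ ≤ Real.sqrt (∑ k, a k ^ 2) := by
      rw [pi_norm_le_iff_of_nonneg (Real.sqrt_nonneg _)]
      intro k
      rw [Real.norm_eq_abs, ← Real.sqrt_sq_eq_abs]
      exact Real.sqrt_le_sqrt (Finset.single_le_sum (f := fun k => a k ^ 2)
        (fun k _ => sq_nonneg _) (Finset.mem_univ k))
    calc ‖v‖ ^ 2 = ‖a‖ ^ 2 := rfl
      _ ≤ Real.sqrt (∑ k, a k ^ 2) ^ 2 := by gcongr
      _ = _ := Real.sq_sqrt h0
  have hcoef : ∑ l, B.equivFun v l ^ 2 ≤ Module.finrank ℝ V * (‖T‖ ^ 2 * ∑ k, a k ^ 2) := by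
    have h1 : ∀ l, B.equivFun v l ^ 2 ≤ ‖T‖ ^ 2 * ∑ k, a k ^ 2 := by
      intro l
      have h2 : ‖T v l‖ ≤ ‖T‖ * ‖v‖ := (norm_le_pi_norm (T v) l).trans (T.le_opNorm v)
      have h3 := pow_le_pow_left₀ (norm_nonneg _) h2 2
      rw [Real.norm_eq_abs, sq_abs, mul_pow] at h3
      exact h3.trans (by gcongr)
    calc _ ≤ ∑ l : Fin (Module.finrank ℝ V), ‖T‖ ^ 2 * ∑ k, a k ^ 2 :=
          Finset.sum_le_sum fun l _ => h1 l
      _ = _ := by simp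
  have hterm : ∀ n, (w n ⬝ᵥ a) ^ 2
      ≤ (∑ l, B.equivFun v l ^ 2) * ∑ l, (w n ⬝ᵥ (B l : Fin m → ℝ)) ^ 2 := by
    intro n
    have : w n ⬝ᵥ a = ∑ l, B.equivFun v l * (w n ⬝ᵥ (B l : Fin m → ℝ)) := by
      conv_lhs => rw [hrep]
      rw [dotProduct_sum]
      simp [dotProduct_smul]
    rw [this]
    exact Finset.sum_mul_sq_le_sq_mul_sq _ _ _
  have hsum : Summable fun n => ∑ l, (w n ⬝ᵥ (B l : Fin m → ℝ)) ^ 2 := summable_sum fun l _ => hS l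
  calc ∑' n, (w n ⬝ᵥ a) ^ 2
      ≤ ∑' n, (∑ l, B.equivFun v l ^ 2) * ∑ l, (w n ⬝ᵥ (B l : Fin m → ℝ)) ^ 2 :=
        Summable.tsum_le_tsum hterm ha (hsum.mul_left _)
    _ = (∑ l, B.equivFun v l ^ 2) * S := by
        rw [tsum_mul_left, Summable.tsum_finsetSum fun l _ => hS l]
    _ ≤ (Module.finrank ℝ V * (‖T‖ ^ 2 * ∑ k, a k ^ 2)) * S := by gcongr
    _ = _ := by ring

/-- Full row rank makes `A` surjective, and `A A† A = A` says that `A A†` fixes the range of `A`. -/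
theorem mul_pinv_of_rank {a b : ℕ} {A : Matrix (Fin a) (Fin b) ℝ} (h : A.rank = a) :
    A * pinv A = 1 := by
  have hsurj : Function.Surjective A.mulVecLin := by
    rw [← LinearMap.range_eq_top]
    apply Submodule.eq_top_of_finrank_eq
    rw [← Matrix.rank, h]
    simp
  have h1 : ∀ w : Fin a → ℝ, (A * pinv A) *ᵥ w = w := by
    intro w
    obtain ⟨v, rfl⟩ := hsurj w
    rw [Matrix.mulVecLin_apply, Matrix.mulVec_mulVec, (pinv_spec A).mul_mul_self]
  ext i j
  have := congrFun (h1 (Pi.single j 1)) i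
  simpa [Matrix.one_apply, Pi.single_apply] using this

/-! ### The feedback law in terms of modes -/

theorem sineCoeff_eq (n : ℕ) (h : ℝ → ℝ) : sineCoeff n h = 2 * ∫ y, h y * sn n y ∂volI := by
  rw [sineCoeff, integral_volI]; rfl

/-- The value that backstepping prescribes at `x = 1` for the `n`-th mode. -/
def modalControl (l : ℝ) (n : ℕ) (f : ℝ × ℝ → ℝ) : ℝ :=
  ∫ x, smoothKernel l 1 x * pair (sn n) f x ∂volI

theorem modalFeedback_eq {ε lam c : ℝ} (hl : 0 ≤ (lam + c) / ε) (n : ℕ) (f : ℝ × ℝ → ℝ) :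
    modalFeedback ε lam c n f = 2 * modalControl ((lam + c) / ε) n f := by
  rw [modalFeedback, modalControl, ← integral_volI
    (fun ξ => kernel ((lam + c) / ε) 1 ξ * sineCoeff n (fun y => f (ξ, y))), ← integral_const_mul]
  refine integral_congr_ae ?_
  filter_upwards [ae_mem_volI] with x hx
  rw [kernel_eq_smoothKernel hl hx.1.le hx.2.le, sineCoeff_eq, pair]
  ring

/-- The coefficients of the control with respect to the shape functions. -/
def controlCoeff (ε lam c : ℝ) (N : ℕ) {m : ℕ} (φ : Fin m → ℝ → ℝ) (f : ℝ × ℝ → ℝ) :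
    Fin m → ℝ :=
  pinv (shapeMatrix N φ) *ᵥ fun i : Fin N => 2 * modalControl ((lam + c) / ε) (i + 1) f

/-- The coefficients of the shape functions with respect to the `n`-th sine mode. -/
def shapeRow {m : ℕ} (φ : Fin m → ℝ → ℝ) (n : ℕ) (k : Fin m) : ℝ := ∫ y, φ k y * sn n y ∂volI

section

variable {ε lam c : ℝ} {N m : ℕ} {φ : Fin m → ℝ → ℝ}

theorem feedback_eq (hl : 0 ≤ (lam + c) / ε) (f : ℝ × ℝ → ℝ) (y : ℝ) :
    feedback ε lam c N φ f y = ∑ k, φ k y * controlCoeff ε lam c N φ f k := by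
  simp only [feedback, controlCoeff, modalFeedback_eq hl]

theorem integral_feedback_mul_sn (hl : 0 ≤ (lam + c) / ε) (hφ : ∀ k, MemLp (φ k) 2 volI)
    (f : ℝ × ℝ → ℝ) (n : ℕ) :
    ∫ y, feedback ε lam c N φ f y * sn n y ∂volI
      = shapeRow φ n ⬝ᵥ controlCoeff ε lam c N φ f := by
  have e : ∀ y, feedback ε lam c N φ f y * sn n y
      = ∑ k, (φ k y * sn n y) * controlCoeff ε lam c N φ f k := by
    intro y
    rw [feedback_eq hl, Finset.sum_mul]
    exact Finset.sum_congr rfl fun k _ => by ring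
  simp_rw [e]
  rw [integral_finsetSum _ fun k _ =>
    (integrable_mul_continuous (hφ k) (continuous_sn n)).mul_const _]
  simp only [integral_mul_const, dotProduct, shapeRow]

/-- `Φ Φ† = 1` makes each controlled mode receive precisely its backstepping value. The factor `2`
of the sine coefficients occurs on both sides and cancels. -/
theorem shapeRow_dotProduct_controlCoeff (hrank : (shapeMatrix N φ).rank = N) (f : ℝ × ℝ → ℝ)
    (i : Fin N) : shapeRow φ (i + 1) ⬝ᵥ controlCoeff ε lam c N φ f
      = modalControl ((lam + c) / ε) (i + 1) f := by
  have h : shapeMatrix N φ *ᵥ controlCoeff ε lam c N φ f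
      = fun i : Fin N => 2 * modalControl ((lam + c) / ε) (i + 1) f := by
    rw [controlCoeff, Matrix.mulVec_mulVec, mul_pinv_of_rank hrank, Matrix.one_mulVec]
  have h1 := congrFun h i
  have h2 : (shapeMatrix N φ *ᵥ controlCoeff ε lam c N φ f) i
      = 2 * (shapeRow φ (i + 1) ⬝ᵥ controlCoeff ε lam c N φ f) := by
    simp only [Matrix.mulVec, dotProduct, shapeMatrix, Matrix.of_apply, sineCoeff_eq, shapeRow,
      Finset.mul_sum, mul_assoc]
  linarith

theorem sum_sq_mulVec_le {a b : Type*} [Fintype a] [Fintype b] (P : Matrix b a ℝ) (g : a → ℝ) :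
    ∑ k, (P *ᵥ g) k ^ 2 ≤ (∑ k, ∑ i, P k i ^ 2) * ∑ i, g i ^ 2 := by
  rw [Finset.sum_mul]
  refine Finset.sum_le_sum fun k _ => ?_
  exact Finset.sum_mul_sq_le_sq_mul_sq _ _ _

/-- By Parseval. The Hölder constants of the inputs are thus square summable over the modes, without
smoothness of the shape functions. -/
theorem summable_sq_shapeRow (hφ : ∀ k, MemLp (φ k) 2 volI) :
    Summable fun n => ∑ k, shapeRow φ n k ^ 2 := by
  refine summable_sum fun k _ => ?_
  refine ((hasSum_sq_sn (hφ k)).summable.mul_left (1 / 2)).congr fun n => ?_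
  rw [shapeRow]; ring

end

/-! ### The zero solution -/

theorem isClosedLoopSolution_zero {ε lam c : ℝ} (N : ℕ) {m : ℕ} (φ : Fin m → ℝ → ℝ) :
    IsClosedLoopSolution ε lam c N φ (fun _ _ => 0) := by
  have hw : IsWeakGrad (fun _ => 0) (fun _ => 0) (fun _ => 0) := by
    have := isWeakGrad_product (p := fun _ => 0) (h := fun _ => 0) contDiff_const contDiff_const
      rfl rfl rfl rfl
    simpa using this
  have hf : feedback ε lam c N φ (fun _ => 0) = 0 := by
    ext y
    have : (fun i : Fin N => modalFeedback ε lam c (i + 1) (fun _ => 0)) = 0 := by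
      ext i; simp [modalFeedback, sineCoeff]
    simp [feedback, this]
  -- The weak gradient is a chosen representative, so that of the zero function is known to vanish
  -- only almost everywhere.
  obtain ⟨ex, ey⟩ := hw.ae_eq
  have h0 : ∀ v : ℝ × ℝ → ℝ, ∫ z, (-ε * (wdx (fun _ => 0) z * wdx v z
      + wdy (fun _ => 0) z * wdy v z) + lam * ((0 : ℝ) * v z)) ∂volQ = 0 := by
    intro v
    refine integral_eq_zero_of_ae ?_
    filter_upwards [ex, ey] with z hx hy
    rw [hx, hy]; simp
  refine ⟨fun t _ => memH10_zero.memH1, fun t _ => ?_, fun t _ => ?_, fun v _ t _ => ?_⟩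
  · simpa using tendsto_const_nhds
  · dsimp only
    rw [hf]
    exact memH10_zero
  · simp only [h0]
    simp

/-! ### Estimates for the closed loop -/

section

variable {ε lam c : ℝ} {N m : ℕ} {φ : Fin m → ℝ → ℝ} {u : ℝ → ℝ × ℝ → ℝ}

theorem continuous_smoothKernel_one (l : ℝ) : Continuous fun x => smoothKernel l 1 x :=
  (continuous_smoothKernel l).comp (Continuous.prodMk_right 1)

theorem modalControl_eq (l : ℝ) (n : ℕ) (f : ℝ × ℝ → ℝ) :
    modalControl l n f = ∫ x, pair (sn n) f x * smoothKernel l 1 x ∂volI := by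
  rw [modalControl]; congr 1; ext x; ring

theorem integral_sq_pair_le_modeEnergy (n : ℕ) (f : ℝ × ℝ → ℝ) :
    ∫ x, pair (sn n) f x ^ 2 ∂volI + ∫ x, pair (sn n) (wdx f) x ^ 2 ∂volI ≤ modeEnergy n f := by
  have h0 : 0 ≤ ∫ x, pair (sn n) f x ^ 2 ∂volI := integral_nonneg fun x => sq_nonneg _
  have := mul_nonneg (sq_nonneg (n * Real.pi)) h0
  rw [modeEnergy]
  linarith

theorem modeEnergy_le (n : ℕ) (f : ℝ × ℝ → ℝ) : modeEnergy n f ≤ (1 + (n * Real.pi) ^ 2) *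
    (∫ x, pair (sn n) f x ^ 2 ∂volI + ∫ x, pair (sn n) (wdx f) x ^ 2 ∂volI) := by
  have h0 : 0 ≤ ∫ x, pair (sn n) (wdx f) x ^ 2 ∂volI := integral_nonneg fun x => sq_nonneg _
  have := mul_nonneg (sq_nonneg (n * Real.pi)) h0
  rw [modeEnergy]
  linarith

/-- The controlled modes of a closed-loop solution decay. -/
theorem exists_controlled_mode_bound (hε : 0 < ε) (hlam : 0 < lam) (hc : 0 < c)
    (hφ : ∀ k, MemLp (φ k) 2 volI) (hrank : (shapeMatrix N φ).rank = N) (i : Fin N) :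
    ∃ C : ℝ, 0 < C ∧ ∀ u : ℝ → ℝ × ℝ → ℝ, IsClosedLoopSolution ε lam c N φ u →
      (∀ t, 0 ≤ t → modeEnergy (i + 1) (u t)
        ≤ C * Real.exp (-(2 * c * t)) * modeEnergy (i + 1) (u 0)) ∧
      (∀ t, 0 ≤ t → modalControl ((lam + c) / ε) (i + 1) (u t) ^ 2
        ≤ C * Real.exp (-(2 * c * t)) * modeEnergy (i + 1) (u 0)) ∧
      (∀ s t, 0 ≤ s → s ≤ t → (modalControl ((lam + c) / ε) (i + 1) (u t)
          - modalControl ((lam + c) / ε) (i + 1) (u s)) ^ 2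
        ≤ C * (t - s) * Real.exp (-(2 * c * s)) * modeEnergy (i + 1) (u 0)) := by
  set l := (lam + c) / ε with hl_def
  have hl : 0 ≤ l := by positivity
  set n : ℕ := i + 1 with hn
  obtain ⟨C, hC, H⟩ := exists_low_mode_bound l hε hc n
  refine ⟨(1 + (n * Real.pi) ^ 2) * C, by positivity, fun u hu => ?_⟩
  have hb : ∀ t, 0 ≤ t → ∫ y, feedback ε lam c N φ (u t) y * sn n y ∂volI
      = modalControl l n (u t) := fun t ht => by
    rw [integral_feedback_mul_sn hl hφ, shapeRow_dotProduct_controlCoeff hrank]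
  have hf : ∀ t, 0 ≤ t → MemLp (pair (sn n) (u t)) 2 volI := fun t ht =>
    memLp_pair (hu.memLp ht) (continuous_sn n)
  have hg : ∀ t, 0 ≤ t → MemLp (pair (sn n) (wdx (u t))) 2 volI := fun t ht =>
    memLp_pair (isWeakGrad_weakGrad (hu.memH1 t ht)).memLp_x (continuous_sn n)
  have key := H (fun t => pair (sn n) (u t)) (fun t => pair (sn n) (wdx (u t))) hf hg ?_ ?_
  · obtain ⟨H1, H2, H3⟩ := key
    have hE := integral_sq_pair_le_modeEnergy n (u 0)
    have hone : 1 ≤ 1 + (n * Real.pi) ^ 2 := le_add_of_nonneg_right (sq_nonneg _)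
    have hE0 := modeEnergy_nonneg n (u 0)
    refine ⟨fun t ht => ?_, fun t ht => ?_, fun s t hs hst => ?_⟩
    · calc _ ≤ (1 + (n * Real.pi) ^ 2) * (C * Real.exp (-(2 * c * t)) * modeEnergy n (u 0)) :=
            (modeEnergy_le n (u t)).trans (by gcongr; exact (H1 t ht).trans (by gcongr))
        _ = _ := by ring
    · calc _ ≤ 1 * C * Real.exp (-(2 * c * t)) * modeEnergy n (u 0) := by
            rw [one_mul]; exact (H2 t ht).trans (by gcongr)
        _ ≤ _ := by gcongr
    · have hst' := sub_nonneg.2 hst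
      calc _ ≤ 1 * C * (t - s) * Real.exp (-(2 * c * s)) * modeEnergy n (u 0) := by
            rw [one_mul]; exact (H3 s t hs hst).trans (by gcongr)
        _ ≤ _ := by gcongr
  · intro t ht j
    have h := (hu.boundary t ht).pair_sn_relation n (contDiff_cs j)
    have hd : deriv (cs j) = fun x => -(j * Real.pi * sn j x) :=
      funext fun x => (hasDerivAt_cs j x).deriv
    rw [hd, hb t ht, cs_at_one] at h
    exact h
  · intro t ht j
    have hp := contDiff_dualMode l j
    have hk := continuous_smoothKernel_one l
    refine eq_exp_mul_of_integral_eq (y := fun t => dualCoeff l (pair (sn n) (u t)) j)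
      (hu.continuousOn_integral_pair (continuous_sn n) hp.continuous) (fun t ht => ?_) ht
    have h := hu.integral_pair_eq n hp (dualMode_at_zero l j) (dualMode_at_one l j) ht
    refine h.trans ?_
    congr 1
    refine intervalIntegral.integral_congr fun s hs => ?_
    rw [Set.uIcc_of_le ht] at hs
    have e : ∫ x, pair (sn n) (u s) x * deriv (deriv (dualMode l j)) x ∂volI
        = -((j * Real.pi) ^ 2 + l) * dualCoeff l (pair (sn n) (u s)) j
          + j * Real.pi * (-1) ^ j * modalControl l n (u s) := by
      rw [dualCoeff, modalControl_eq, ← integral_const_mul, ← integral_const_mul, ← integral_add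
        ((integrable_mul_continuous (hf s hs.1) hp.continuous).const_mul _)
        ((integrable_mul_continuous (hf s hs.1) hk).const_mul _)]
      congr 1; ext x
      rw [deriv_deriv_dualMode]; ring
    have e' : ∫ x, pair (sn n) (u s) x * dualMode l j x ∂volI
        = dualCoeff l (pair (sn n) (u s)) j := rfl
    simp only [e, e', hb s hs.1, deriv_dualMode_at_one]
    -- The two boundary terms with `modalControl` cancel, and this identity turns the rate `ε ((j
    -- π)² + l) + ε (n π)² - lam` into `ε ((j π)² + (n π)²) + c`.
    have hεl : ε * l = lam + c := by rw [hl_def]; field_simp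
    linear_combination (-dualCoeff l (pair (sn n) (u s)) j) * hεl

/-- Bounds for the coefficients of the control, in terms of the energy of the controlled modes. -/
theorem exists_controlCoeff_bound (hε : 0 < ε) (hlam : 0 < lam) (hc : 0 < c)
    (hφ : ∀ k, MemLp (φ k) 2 volI) (hrank : (shapeMatrix N φ).rank = N) :
    ∃ C : ℝ, 0 < C ∧ ∀ u : ℝ → ℝ × ℝ → ℝ, IsClosedLoopSolution ε lam c N φ u →
      (∀ i : Fin N, ∀ t, 0 ≤ t → modeEnergy (i + 1) (u t)
        ≤ C * Real.exp (-(2 * c * t)) * modeEnergy (i + 1) (u 0)) ∧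
      (∀ t, 0 ≤ t → ∑ k, controlCoeff ε lam c N φ (u t) k ^ 2
        ≤ C * Real.exp (-(2 * c * t)) * ∑ i : Fin N, modeEnergy (i + 1) (u 0)) ∧
      (∀ s t, 0 ≤ s → s ≤ t → ∑ k, (controlCoeff ε lam c N φ (u t) k
          - controlCoeff ε lam c N φ (u s) k) ^ 2
        ≤ C * (t - s) * Real.exp (-(2 * c * s)) * ∑ i : Fin N, modeEnergy (i + 1) (u 0)) := by
  choose C hC H using exists_controlled_mode_bound hε hlam hc hφ hrank
  set S := ∑ i, C i
  have hS : 0 ≤ S := Finset.sum_nonneg fun i _ => (hC i).le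
  have hCS : ∀ i, C i ≤ S := fun i =>
    Finset.single_le_sum (f := C) (fun j _ => (hC j).le) (Finset.mem_univ i)
  set P := ∑ k, ∑ i, pinv (shapeMatrix N φ) k i ^ 2
  have hP : 0 ≤ P := Finset.sum_nonneg fun k _ => Finset.sum_nonneg fun i _ => sq_nonneg _
  refine ⟨S + P * (4 * S) + 1, by positivity, fun u hu => ⟨fun i t ht => ?_, fun t ht => ?_,
    fun s t hs hst => ?_⟩⟩
  · refine ((H i u hu).1 t ht).trans ?_
    have := modeEnergy_nonneg (i + 1) (u 0)
    have := hCS i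
    have : 0 ≤ P * (4 * S) := by positivity
    gcongr
    linarith
  · refine (sum_sq_mulVec_le _ _).trans ?_
    have h1 : ∑ i : Fin N, (2 * modalControl ((lam + c) / ε) (i + 1) (u t)) ^ 2
        ≤ ∑ i : Fin N, 4 * (S * Real.exp (-(2 * c * t)) * modeEnergy (i + 1) (u 0)) := by
      refine Finset.sum_le_sum fun i _ => ?_
      have h2 := (H i u hu).2.1 t ht
      have := modeEnergy_nonneg (i + 1) (u 0)
      have h3 : C i * Real.exp (-(2 * c * t)) * modeEnergy (i + 1) (u 0)
          ≤ S * Real.exp (-(2 * c * t)) * modeEnergy (i + 1) (u 0) := by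
        gcongr; exact hCS i
      linarith
    rw [← Finset.mul_sum, ← Finset.mul_sum] at h1
    set E := ∑ i : Fin N, modeEnergy (i + 1) (u 0)
    have hE : 0 ≤ E := Finset.sum_nonneg fun i _ => modeEnergy_nonneg _ _
    calc _ ≤ P * (4 * (S * Real.exp (-(2 * c * t)) * E)) := by gcongr
      _ = P * (4 * S) * Real.exp (-(2 * c * t)) * E := by ring
      _ ≤ _ := by gcongr; linarith
  · have h1 : ∑ i : Fin N, (2 * modalControl ((lam + c) / ε) (i + 1) (u t)
          - 2 * modalControl ((lam + c) / ε) (i + 1) (u s)) ^ 2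
        ≤ ∑ i : Fin N, 4 * (S * (t - s) * Real.exp (-(2 * c * s)) * modeEnergy (i + 1) (u 0)) := by
      refine Finset.sum_le_sum fun i _ => ?_
      have h2 := (H i u hu).2.2 s t hs hst
      have := modeEnergy_nonneg (i + 1) (u 0)
      have hst' := sub_nonneg.2 hst
      have h3 : C i * (t - s) * Real.exp (-(2 * c * s)) * modeEnergy (i + 1) (u 0)
          ≤ S * (t - s) * Real.exp (-(2 * c * s)) * modeEnergy (i + 1) (u 0) := by
        gcongr; exact hCS i
      linarith
    rw [← Finset.mul_sum, ← Finset.mul_sum] at h1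
    set E := ∑ i : Fin N, modeEnergy (i + 1) (u 0)
    have hE : 0 ≤ E := Finset.sum_nonneg fun i _ => modeEnergy_nonneg _ _
    have hst' := sub_nonneg.2 hst
    have h2 := sum_sq_mulVec_le (pinv (shapeMatrix N φ))
      ((fun i : Fin N => 2 * modalControl ((lam + c) / ε) (i + 1) (u t))
        - fun i : Fin N => 2 * modalControl ((lam + c) / ε) (i + 1) (u s))
    rw [Matrix.mulVec_sub] at h2
    calc _ ≤ P * (4 * (S * (t - s) * Real.exp (-(2 * c * s)) * E)) :=
          h2.trans (mul_le_mul_of_nonneg_left h1 hP)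
      _ = P * (4 * S) * (t - s) * Real.exp (-(2 * c * s)) * E := by ring
      _ ≤ _ := by gcongr; linarith

/-- The hypothesis gives `ε (N π)² ≥ lam + c`, hence strict inequality at `N + 1`. The ratio of `lam
+ c` to the eigenvalue is largest at `n = N + 1`, `j = 0`, which dictates `κ = ε - (lam + c) / D`.
-/
theorem exists_spectral_gap (hε : 0 < ε) (hlam : 0 < lam) (hc : 0 < c)
    (hN : Real.sqrt ((c + lam) / (Real.pi ^ 2 * ε)) ≤ (N : ℝ)) :
    ∃ κ : ℝ, 0 < κ ∧ ∀ n : ℕ, N + 1 ≤ n → ∀ j : ℕ,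
      κ * ((j * Real.pi) ^ 2 + (n * Real.pi) ^ 2)
        ≤ ε * ((j * Real.pi) ^ 2 + (n * Real.pi) ^ 2) - lam - c := by
  have hπ := Real.pi_pos
  have h1 : (c + lam) / (Real.pi ^ 2 * ε) ≤ (N : ℝ) ^ 2 := (Real.sqrt_le_left (by positivity)).1 hN
  rw [div_le_iff₀ (by positivity)] at h1
  set D : ℝ := (((N : ℝ) + 1) * Real.pi) ^ 2
  have hD : 0 < D := by positivity
  refine ⟨ε - (lam + c) / D, ?_, fun n hn j => ?_⟩
  · rw [sub_pos, div_lt_iff₀ hD]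
    have : (N : ℝ) ^ 2 < ((N : ℝ) + 1) ^ 2 := by
      have : (0 : ℝ) ≤ N := Nat.cast_nonneg N
      nlinarith
    calc lam + c ≤ (N : ℝ) ^ 2 * (Real.pi ^ 2 * ε) := by linarith
      _ < ((N : ℝ) + 1) ^ 2 * (Real.pi ^ 2 * ε) := by gcongr
      _ = ε * D := by ring
  · have hn' : (N : ℝ) + 1 ≤ n := by exact_mod_cast hn
    have h2 : D ≤ (j * Real.pi) ^ 2 + (n * Real.pi) ^ 2 := by
      have : D ≤ (n * Real.pi) ^ 2 :=
        pow_le_pow_left₀ (by positivity) (mul_le_mul_of_nonneg_right hn' hπ.le) 2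
      linarith [sq_nonneg (j * Real.pi)]
    have h3 : (lam + c) / D * D ≤ (lam + c) / D * ((j * Real.pi) ^ 2 + (n * Real.pi) ^ 2) := by
      gcongr
    rw [div_mul_cancel₀ _ hD.ne'] at h3
    linarith

/-- The uncontrolled modes of a closed-loop solution. -/
theorem exists_uncontrolled_mode_bound (hε : 0 < ε) (hlam : 0 < lam) (hc : 0 < c)
    (hN : Real.sqrt ((c + lam) / (Real.pi ^ 2 * ε)) ≤ (N : ℝ))
    (hφ : ∀ k, MemLp (φ k) 2 volI) {K : ℝ} (hK : 0 < K) :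
    ∃ C : ℝ, 0 < C ∧ ∀ u : ℝ → ℝ × ℝ → ℝ, IsClosedLoopSolution ε lam c N φ u → ∀ E : ℝ, 0 ≤ E →
      (∀ s t, 0 ≤ s → s ≤ t → ∑ k, (controlCoeff ε lam c N φ (u t) k
          - controlCoeff ε lam c N φ (u s) k) ^ 2
        ≤ K * (t - s) * Real.exp (-(2 * c * s)) * E) →
      ∀ n : ℕ, N + 1 ≤ n → ∀ t, 0 ≤ t → modeEnergy n (u t)
        ≤ C * (n * (shapeRow φ n ⬝ᵥ controlCoeff ε lam c N φ (u t)) ^ 2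
          + Real.exp (-(2 * c * t)) * (modeEnergy n (u 0)
            + (∑ k, shapeRow φ n k ^ 2) * (K * E))) := by
  obtain ⟨κ, hκ, hgap⟩ := exists_spectral_gap hε hlam hc hN
  obtain ⟨C, hC, H⟩ := exists_high_mode_bound hε hlam hc hκ
  refine ⟨C, hC, fun u hu E hE hdiff n hn t ht => ?_⟩
  have hl : 0 ≤ (lam + c) / ε := by positivity
  set r := ∑ k, shapeRow φ n k ^ 2
  have hr : 0 ≤ r := Finset.sum_nonneg fun k _ => sq_nonneg _
  set U : ℝ → ℝ := fun t => shapeRow φ n ⬝ᵥ controlCoeff ε lam c N φ (u t)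
  have hb : ∀ t, ∫ y, feedback ε lam c N φ (u t) y * sn n y ∂volI = U t := fun t =>
    integral_feedback_mul_sn hl hφ (u t) n
  have hcoeff : ∀ t : ℝ, 0 ≤ t → _ := fun t ht => (hu.boundary t ht).hasSum_coeff n
  simp only [hb] at hcoeff
  have hcontU : ContinuousOn U (Set.Ici 0) := by
    have hmc : ∀ n, ContinuousOn (fun t => modalControl ((lam + c) / ε) n (u t)) (Set.Ici 0) := by
      intro n
      simp only [modalControl_eq]
      exact hu.continuousOn_integral_pair (continuous_sn n) (continuous_smoothKernel_one _)
    simp only [U, dotProduct, controlCoeff, Matrix.mulVec]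
    exact continuousOn_finsetSum _ fun k _ => continuousOn_const.mul
      (continuousOn_finsetSum _ fun i _ => continuousOn_const.mul
        (continuousOn_const.mul (hmc _)))
  -- The Hölder constant `√(r K E)` results from Cauchy-Schwarz in `ℝᵐ` between the row of shape
  -- coefficients and the increment of the control coefficients.
  have key := H n (by omega) (hgap n hn) (fun j t => ∫ x, pair (sn n) (u t) x * sn j x ∂volI) U
    (fun t => ∫ x, pair (sn n) (u t) x ^ 2 ∂volI)
    (fun t => ∫ x, pair (sn n) (wdx (u t)) x ^ 2 ∂volI) (Real.sqrt (r * (K * E)))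
    (Real.sqrt_nonneg _)
    (fun j => hu.continuousOn_integral_pair (continuous_sn n) (continuous_sn j)) hcontU ?_ ?_
    (fun t ht => (hcoeff t ht).1) (fun t ht => (hcoeff t ht).2) t ht
  · rw [Real.sq_sqrt (by positivity)] at key
    exact key
  · intro j t ht
    have h := hu.integral_pair_eq n (contDiff_sn j) (sn_at_zero j) (sn_at_one j) ht
    refine h.trans ?_
    congr 1
    refine intervalIntegral.integral_congr fun s hs => ?_
    have hd : deriv (sn j) = fun x => j * Real.pi * cs j x :=
      funext fun x => (hasDerivAt_sn j x).deriv
    have hdd : ∀ x, deriv (deriv (sn j)) x = -(j * Real.pi) ^ 2 * sn j x := by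
      intro x
      rw [hd, ((hasDerivAt_cs j x).const_mul (j * Real.pi)).deriv]
      ring
    have e : ∫ x, pair (sn n) (u s) x * deriv (deriv (sn j)) x ∂volI
        = -(j * Real.pi) ^ 2 * ∫ x, pair (sn n) (u s) x * sn j x ∂volI := by
      rw [← integral_const_mul]
      congr 1; ext x
      rw [hdd]; ring
    have hd1 : deriv (sn j) 1 = j * Real.pi * (-1) ^ j := by rw [hd, ← cs_at_one]
    rw [e, hb, hd1]
    ring
  · intro s t hs hst
    have hst' := sub_nonneg.2 hst
    have e : U t - U s = ∑ k, shapeRow φ n k * (controlCoeff ε lam c N φ (u t) k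
        - controlCoeff ε lam c N φ (u s) k) := by
      simp only [U, dotProduct, mul_sub, Finset.sum_sub_distrib]
    have hsq : (U t - U s) ^ 2 ≤ r * (K * E) * (t - s) * Real.exp (-(2 * c * s)) := by
      rw [e]
      refine (Finset.sum_mul_sq_le_sq_mul_sq _ _ _).trans ?_
      calc _ ≤ r * (K * (t - s) * Real.exp (-(2 * c * s)) * E) :=
            mul_le_mul_of_nonneg_left (hdiff s t hs hst) hr
        _ = _ := by ring
    have hexp : Real.exp (-(2 * c * s)) = Real.exp (-(c * s)) ^ 2 := by
      rw [← Real.exp_nat_mul]; congr 1; push_cast; ring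
    refine abs_le_of_sq_le_sq ?_ (by positivity)
    rw [mul_pow, mul_pow, Real.sq_sqrt (by positivity), Real.sq_sqrt hst', ← hexp]
    exact hsq

/-- The trace inequality for the modes of a closed-loop solution. -/
theorem IsClosedLoopSolution.mul_sq_le_modeEnergy (hl : 0 ≤ (lam + c) / ε)
    (hφ : ∀ k, MemLp (φ k) 2 volI) (hu : IsClosedLoopSolution ε lam c N φ u) {t : ℝ} (ht : 0 ≤ t)
    (n : ℕ) : n * (shapeRow φ n ⬝ᵥ controlCoeff ε lam c N φ (u t)) ^ 2 ≤ modeEnergy n (u t) := by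
  have h := (hu.boundary t ht).hasSum_coeff n
  rw [integral_feedback_mul_sn hl hφ] at h
  refine (mul_sq_trace_le h.1 h.2).trans ?_
  have h0 : 0 ≤ ∫ x, pair (sn n) (u t) x ^ 2 ∂volI := integral_nonneg fun x => sq_nonneg _
  rw [modeEnergy]
  linarith

/-- Together with `two_mul_le_of_le'` it brings controlled and uncontrolled modes under one
majorant, so that the series over all modes can be compared term by term. -/
theorem two_mul_le_of_le {K L X A B W R : ℝ} (hK : 0 ≤ K) (hL : 0 ≤ L) (hX : 0 ≤ X) (hB : 0 ≤ B)
    (hW : 0 ≤ W) (hR : 0 ≤ R) (h : A ≤ K * X * B) :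
    2 * A ≤ (K + L) * (2 * W + X * (2 * B + 2 * R)) := by
  have h1 := mul_nonneg hL (mul_nonneg hX hB)
  have h2 := mul_nonneg (add_nonneg hK hL) (add_nonneg hW (mul_nonneg hX hR))
  linear_combination 2 * h + 2 * h1 + 2 * h2

theorem two_mul_le_of_le' {K L X A B W Q R : ℝ} (hK : 0 ≤ K) (hX : 0 ≤ X)
    (hB : 0 ≤ B) (hW : 0 ≤ W) (hQ : 0 ≤ Q) (hR : 0 ≤ R) (h : A ≤ L * (W + X * (B + R * Q))) :
    2 * A ≤ (K + L) * (2 * W + X * (2 * B + 2 * Q * R)) := by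
  have h1 := mul_nonneg hK (add_nonneg hW (mul_nonneg hX (add_nonneg hB (mul_nonneg hR hQ))))
  linear_combination 2 * h + 2 * h1

/-- Exponential decay of the squared `H¹` norm of closed-loop solutions. -/
theorem exists_sq_h1Norm_le (hε : 0 < ε) (hlam : 0 < lam) (hc : 0 < c)
    (hN : Real.sqrt ((c + lam) / (Real.pi ^ 2 * ε)) ≤ (N : ℝ))
    (hφ : ∀ k, MemLp (φ k) 2 volI) (hrank : (shapeMatrix N φ).rank = N) :
    ∃ C : ℝ, 0 < C ∧ ∀ u : ℝ → ℝ × ℝ → ℝ, IsClosedLoopSolution ε lam c N φ u → ∀ t, 0 ≤ t →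
      h1Norm (u t) ^ 2 ≤ C * Real.exp (-(2 * c * t)) * h1Norm (u 0) ^ 2 := by
  have hl : 0 ≤ (lam + c) / ε := by positivity
  obtain ⟨K, hK, HK⟩ := exists_controlCoeff_bound hε hlam hc hφ hrank
  obtain ⟨L, hL, HL⟩ := exists_uncontrolled_mode_bound hε hlam hc hN hφ hK
  -- The weight `√n` on the rows turns the squared products into the boundary terms `n U_n²`.
  obtain ⟨V, hV, HV⟩ := exists_tsum_sq_dotProduct_le
    fun n : ℕ => Real.sqrt n • shapeRow φ n
  have hr := summable_sq_shapeRow hφ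
  set r := ∑' n, ∑ k, shapeRow φ n k ^ 2
  have hr0 : 0 ≤ r := tsum_nonneg fun n => Finset.sum_nonneg fun k _ => sq_nonneg _
  refine ⟨(K + L) * (V * K + 1 + r * K), by positivity, fun u hu t ht => ?_⟩
  obtain ⟨h1, h2, h3⟩ := HK u hu
  set E := ∑ i : Fin N, modeEnergy (i + 1) (u 0)
  have hE0 : 0 ≤ E := Finset.sum_nonneg fun i _ => modeEnergy_nonneg _ _
  replace h1 := fun i => h1 i t ht
  replace h2 := h2 t ht
  replace h3 := fun n hn => HL u hu E hE0 h3 n hn t ht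
  set X := Real.exp (-(2 * c * t))
  have hX : 0 < X := Real.exp_pos _
  have s0 := (hu.boundary 0 le_rfl).hasSum_modeEnergy
  have st := (hu.boundary t ht).hasSum_modeEnergy
  have hEle : 2 * E ≤ h1Norm (u 0) ^ 2 := by
    have e : E = ∑ n ∈ (Finset.range N).map (addRightEmbedding 1), modeEnergy n (u 0) := by
      rw [Finset.sum_map]
      exact Fin.sum_univ_eq_sum_range (fun n => modeEnergy (n + 1) (u 0)) N
    rw [e, Finset.mul_sum]
    exact sum_le_hasSum _ (fun n _ => mul_nonneg zero_le_two (modeEnergy_nonneg _ _)) s0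
  clear_value E X
  set U : ℕ → ℝ := fun n => shapeRow φ n ⬝ᵥ controlCoeff ε lam c N φ (u t)
  have hwU : ∀ n : ℕ, ((Real.sqrt n • shapeRow φ n) ⬝ᵥ controlCoeff ε lam c N φ (u t)) ^ 2
      = n * U n ^ 2 := by
    intro n
    rw [smul_dotProduct, smul_eq_mul, mul_pow, Real.sq_sqrt (Nat.cast_nonneg n)]
  -- Convergence is only qualitative here, from `u t ∈ H¹` and the trace inequality; the bound with
  -- decay in `hUle` comes from the finite-dimensional principle.
  have hUsum : Summable fun n : ℕ => n * U n ^ 2 :=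
    Summable.of_nonneg_of_le (fun n => by positivity) (hu.mul_sq_le_modeEnergy hl hφ ht)
      ((st.summable.mul_left (1 / 2)).congr fun n => by ring)
  have hUle : ∑' n : ℕ, n * U n ^ 2 ≤ V * (K * X * E) := by
    have := HV (controlCoeff ε lam c N φ (u t)) (by simpa only [hwU] using hUsum)
    simp only [hwU] at this
    exact this.trans (by gcongr)
  have hmode : ∀ n : ℕ, 2 * modeEnergy n (u t) ≤ (K + L) * (2 * (n * U n ^ 2)
      + X * (2 * modeEnergy n (u 0) + 2 * (K * E) * ∑ k, shapeRow φ n k ^ 2)) := by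
    intro n
    have hrn : 0 ≤ ∑ k, shapeRow φ n k ^ 2 := Finset.sum_nonneg fun k _ => sq_nonneg _
    have hUn : 0 ≤ n * U n ^ 2 := mul_nonneg (Nat.cast_nonneg n) (sq_nonneg _)
    have hEn := modeEnergy_nonneg n (u 0)
    have hKE : 0 ≤ K * E := mul_nonneg hK.le hE0
    rcases n with _ | i
    · rw [modeEnergy_zero]
      have h4 := mul_nonneg hX.le (mul_nonneg (mul_nonneg zero_le_two hKE) hrn)
      have h5 := mul_nonneg hX.le (mul_nonneg zero_le_two hEn)
      refine (mul_zero _).trans_le (mul_nonneg (add_nonneg hK.le hL.le) ?_)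
      linear_combination 2 * hUn + h4 + h5
    · by_cases hnN : i < N
      · have h : modeEnergy (i + 1) (u t) ≤ K * X * modeEnergy (i + 1) (u 0) := h1 ⟨i, hnN⟩
        rw [mul_assoc 2 (K * E)]
        exact two_mul_le_of_le hK.le hL.le hX.le hEn hUn (mul_nonneg hKE hrn) h
      · have h := h3 (i + 1) (by omega)
        exact two_mul_le_of_le' hK.le hX.le hEn hUn hKE hrn h
  have hsum := hasSum_le hmode st (((hUsum.hasSum.mul_left 2).add
    ((s0.add (hr.hasSum.mul_left (2 * (K * E)))).mul_left X)).mul_left (K + L))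
  refine hsum.trans ?_
  set H0 := h1Norm (u 0) ^ 2
  calc _ ≤ (K + L) * (2 * (V * (K * X * E)) + X * (H0 + 2 * (K * E) * r)) := by gcongr
    _ = (K + L) * (V * K * (2 * E) + H0 + r * K * (2 * E)) * X := by ring
    _ ≤ (K + L) * (V * K * H0 + H0 + r * K * H0) * X := by gcongr
    _ = _ := by ring

end

end SquareControl

end

theorem mainTheorem2 (ε lam c : ℝ) (hε : 0 < ε) (hlam : 0 < lam) (hc : 0 < c)
    (N m : ℕ) (hN : Real.sqrt ((c + lam) / (Real.pi ^ 2 * ε)) ≤ (N : ℝ))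
    (φ : Fin m → ℝ → ℝ) (hφ : ∀ k, MeasureTheory.MemLp (φ k) 2 SquareControl.volI)
    (hrank : (SquareControl.shapeMatrix N φ).rank = N) :
    SquareControl.IsClosedLoopSolution ε lam c N φ (fun _ _ => 0) ∧
    ∃ M : ℝ, 0 < M ∧ ∀ u : ℝ → ℝ × ℝ → ℝ,
      SquareControl.IsClosedLoopSolution ε lam c N φ u →
      ∀ t : ℝ, 0 ≤ t →
        SquareControl.h1Norm (u t) ≤ M * Real.exp (-c * t) * SquareControl.h1Norm (u 0) := by
  refine ⟨SquareControl.isClosedLoopSolution_zero N φ, ?_⟩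
  obtain ⟨C, hC, H⟩ := SquareControl.exists_sq_h1Norm_le hε hlam hc hN hφ hrank
  refine ⟨Real.sqrt C, Real.sqrt_pos.2 hC, fun u hu t ht => ?_⟩
  have h0 : 0 ≤ SquareControl.h1Norm (u 0) := Real.sqrt_nonneg _
  refine le_of_sq_le_sq ?_ (by positivity)
  refine (H u hu t ht).trans_eq ?_
  rw [mul_pow, mul_pow, Real.sq_sqrt hC.le, ← Real.exp_nat_mul]
  congr 3
  push_cast
  ring
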